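/- **Setting.** Let $0<\beta<1/2$, let $\mathcal L^2=\mathcal L^2([0,1])$ and let $(e_n)_{n\ge1}$ be a complete orthonormal basis of $\mathcal L^2$. For $\alpha>0$ let $$I^\alpha_{0^+}f(x)=\frac1{\Gamma(\alpha)}\int_0^x f(t)(x-t)^{\alpha-1}dt,\qquad I^\alpha_{1^-}f(x)=\frac1{\Gamma(\alpha)}\int_x^1 f(t)(t-x)^{\alpha-1}dt .$$ Put $h_n^{1-\beta}=I^{1-\beta}_{1^-}e_n$. Let $\mathcal I_{\beta,2}=I^\beta_{0^+}(\mathcal L^2)$ with inverse map $I^{-\beta}_{0^+}:\mathcal I_{\beta,2}\to\mathcal L^2$, and let $\mathfrak J_\beta:\mathcal I_{\beta,2}\to\ell^2$ be the isometry $$\mathfrak J_\beta\omega=\sum_n\Big(\int_0^1 h_n^{1-\beta}\,d\omega\Big)x_n=\sum_n\langle e_n,I_{0^+}^{-\beta}\omega\rangle_{\mathcal L^2}\,x_n,$$ where $(x_n)$ is the canonical basis of $\ell^2$. Let $m_\beta$ be the law on $\ell^2$ of $\mathfrak J_\beta B$, where $B=\sum_n Y_n I^1_{0^+}e_n$ with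 $Y_n$ i.i.d. standard Gaussian (a Brownian motion on $[0,1]$). For a real Hilbert space $E$, $\mathcal C^k_b(\ell^2;E)$ is the set of $k$ times Fréchet differentiable $F:\ell^2\to E$ with $\|F\|_{\mathcal C^k_b}:=\sup_{1\le j\le k}\sup_x\|\nabla^{(j)}F(x)\|_{E\otimes(\ell^2)^{\otimes j}}<\infty$ (Hilbert tensor, i.e. Hilbert–Schmidt, norm), and $\|\nabla^{(2)}G\|_\infty=\sup_x\|\nabla^{(2)}G(x)\|_{E\otimes(\ell^2)^{\otimes2}}$. For probability measures on $\ell^2$, $$\rho_3(\nu,\mu)=\sup\Big\{\int F\,d\nu-\int F\,d\mu:\ F\in\mathcal C^3_b(\ell^2;\mathbf R),\ \|F\|_{\mathcal C^3_b}\le1\Big\}.$$ For a real Hilbert space $\mathcal X$, $H\in\ell^2\otimes \mathcal X$ (identified with a Hilbert–Schmidt operator $\mathcal X\to\ell^2$, so that $\operatorname{trace}_{\mathcal X}(H\otimes H)=HH^*$) and $\alpha\ge0$, a probability measure $\nu$ on $\ell^2$ satisfies $\operatorname{Hyp}(\mathcal X,H,\alpha)$ if for all $G\in\mathcal C_b^2(\ell^2;\ell^2)$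 the two integrals below exist and $$\Big|\int x\cdot G(x)\,d\nu(x)-\int\operatorname{trace}\big(\operatorname{trace}_{\mathcal X}(H\otimes H)\circ\nabla G(x)\big)\,d\nu(x)\Big|\le\alpha\,\|\nabla^{(2)}G\|_\infty .$$ Let $X_1,X_2,\dots$ be i.i.d. with $P(X_j=1)=P(X_j=-1)=\tfrac12$ and, for $m\ge1$ and $t\in[0,1]$, $$B_m^\sharp(t)=\frac1{\sqrt m}\Big(\sum_{j=1}^{\lfloor mt\rfloor}X_j+(mt-\lfloor mt\rfloor)X_{\lfloor mt\rfloor+1}\Big).$$ Let $\nu_m^\sharp$ be the law of $\mathfrak J_\beta B_m^\sharp$ on $\ell^2$, and $$H_m^\sharp(j)=\sqrt m\sum_n\Big(\int_{(j-1)/m}^{j/m}h_n^{1-\beta}(s)\,ds\Big)x_n\in\ell^2,\qquad H_m^\sharp=\sum_{j=1}^m x_j\otimes H_m^\sharp(j)\in\ell^2\otimes\ell^2 .$$ **Theorem.** For every $m\ge1$, the probability measure $\nu_m^\sharp$ satisfies $\operatorname{Hyp}(\ell^2,H_m^\sharp,1)$, and it also satisfies $\operatorname{Hyp}\big(\ell^2,H_m^\sharp,\sum_{j=1}^m\|H_m^\sharp(j)\|_{\ell^2}^3\big)$.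 Furthermore, for every $\varepsilon>0$ there is $m_0$ such that for all $m\ge m_0$, $$\rho_3(\nu_m^\sharp,m_\beta)\le(1+\varepsilon)\,\frac{m^{2\beta-1}}{2(1-2\beta)\,\Gamma(1-\beta)^2}.$$ -/

import Mathlib

open MeasureTheory ProbabilityTheory Filter Topology
open scoped ENNReal InnerProductSpace

noncomputable section

namespace DonskerRate

/-! ### The spaces `ℒ²([0,1])` and `ℓ²` -/

/-- Lebesgue measure on `[0,1]`. -/
abbrev vol01 : Measure ℝ := volume.restrict (Set.Icc (0 : ℝ) 1)

/-- The Hilbert space `ℒ²([0,1])`. -/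
abbrev L2I : Type := Lp ℝ 2 vol01

/-- The Hilbert space `ℓ²` of real square summable sequences. -/
abbrev EllTwo : Type := lp (fun _ : ℕ => ℝ) 2

instance instMeasurableSpaceEllTwo : MeasurableSpace EllTwo := borel EllTwo

instance instBorelSpaceEllTwo : BorelSpace EllTwo := ⟨rfl⟩

/-- The canonical orthonormal basis of `ℓ²`. -/
def xvec (n : ℕ) : EllTwo := lp.single 2 n (1 : ℝ)

/-- The element of `ℓ²` with coordinates `c` (and `0` when `c` is not square summable). -/
def ofCoeffs (c : ℕ → ℝ) : EllTwo :=
  open Classical in if h : Memℓp c 2 then ⟨c, h⟩ else 0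

/-! ### Fractional integrals and Besov-Liouville spaces -/

/-- Left Riemann-Liouville fractional integral of order `α > 0` on `[0,1]`. -/
def rlLeft (α : ℝ) (f : ℝ → ℝ) (x : ℝ) : ℝ :=
  (Real.Gamma α)⁻¹ * ∫ t in (0 : ℝ)..x, f t * (x - t) ^ (α - 1)

/-- Right Riemann-Liouville fractional integral of order `α > 0` on `[0,1]`. -/
def rlRight (α : ℝ) (f : ℝ → ℝ) (x : ℝ) : ℝ :=
  (Real.Gamma α)⁻¹ * ∫ t in x..(1 : ℝ), f t * (t - x) ^ (α - 1)

/-- `ω` (as a function modulo null sets of `[0,1]`) belongs to the Besov-Liouville space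
`ℐ⁺_{β,2}`, the image of `ℒ²([0,1])` under the left fractional integral of order `β`. -/
def MemBesovLiouville (β : ℝ) (ω : ℝ → ℝ) : Prop :=
  ∃ f : L2I, ω =ᵐ[vol01] rlLeft β f

/-- The `β`-th derivative of `ω ∈ ℐ⁺_{β,2}`: the element `f` of `ℒ²([0,1])` whose left fractional
integral of order `β` is `ω` (it is unique, since fractional integration is injective).
By convention `0` if `ω` is not in `ℐ⁺_{β,2}`. -/
def fracDeriv (β : ℝ) (ω : ℝ → ℝ) : L2I :=
  open Classical in if h : MemBesovLiouville β ω then h.choose else 0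

/-- The isometry `𝔍_β : ℐ⁺_{β,2} → ℓ²`. Its `n`-th coordinate is
`∫ h_n^{1-β} dω = ⟨I_{1-}^{β-1} h_n^{1-β}, I_{0+}^{-β} ω⟩ = ⟨e_n, I_{0+}^{-β} ω⟩` in `ℒ²([0,1])`. -/
def frakJ (e : HilbertBasis ℕ ℝ L2I) (β : ℝ) (ω : ℝ → ℝ) : EllTwo :=
  e.repr (fracDeriv β ω)

/-- The functions `h_n^{1-β}`, right fractional integrals of order `1-β` of the basis. -/
def hfun (e : HilbertBasis ℕ ℝ L2I) (β : ℝ) (n : ℕ) : ℝ → ℝ := rlRight (1 - β) (e n)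

/-! ### The Wiener measure transported to `ℓ²` -/

/-- The Itô-Nisio series `B(t) = ∑ₙ xₙ (I_{0+}^1 e_n)(t)`, limit of its partial sums. When the
`xₙ` are independent standard Gaussian variables, it converges almost surely for every `t`
in `[0,1]` and defines a Brownian motion. -/
def brownianSeries (e : HilbertBasis ℕ ℝ L2I) (x : ℕ → ℝ) (t : ℝ) : ℝ :=
  limUnder atTop (fun N : ℕ => ∑ n ∈ Finset.range N, x n * rlLeft 1 (e n) t)

/-- The Gaussian measure `m_β` on `ℓ²`: the law of `𝔍_β B`, where `B` is the Brownian motion given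
by the Itô-Nisio series in independent standard Gaussian variables. -/
def mBeta (e : HilbertBasis ℕ ℝ L2I) (β : ℝ) : Measure EllTwo :=
  (Measure.infinitePi (fun _ : ℕ => gaussianReal 0 1)).map
    (fun x => frakJ e β (brownianSeries e x))

/-! ### Test functions and the distances `ρ_k` -/

/-- The norm of a `j`-linear map on `ℓ²` with values in a Hilbert space `E`, as an element of the
Hilbert tensor product `E ⊗ (ℓ²)^{⊗ j}`. -/
def hsNorm {E : Type*} [NormedAddCommGroup E] [NormedSpace ℝ E] {j : ℕ}
    (T : ContinuousMultilinearMap ℝ (fun _ : Fin j => EllTwo) E) : ℝ≥0∞ :=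
  (∑' i : Fin j → ℕ, ‖T (fun a => xvec (i a))‖ₑ ^ 2) ^ (1 / 2 : ℝ)

/-- The supremum over `ℓ²` of the tensor norm of the `j`-th derivative of `F`. -/
def supDeriv {E : Type*} [NormedAddCommGroup E] [NormedSpace ℝ E] (j : ℕ) (F : EllTwo → E) :
    ℝ≥0∞ :=
  ⨆ x : EllTwo, hsNorm (iteratedFDeriv ℝ j F x)

/-- The quantity `‖F‖_{𝒞^k_b}`: the supremum over `j = 1, …, k` of the sup norms of the
`j`-th derivatives. -/
def cbNorm {E : Type*} [NormedAddCommGroup E] [NormedSpace ℝ E] (k : ℕ) (F : EllTwo → E) :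
    ℝ≥0∞ :=
  ⨆ j ∈ Finset.Icc 1 k, supDeriv j F

/-- The class `𝒞^k_b(ℓ²; E)`: functions which are `k` times Fréchet differentiable, with bounded
derivatives of orders `1, …, k`. -/
def IsCb {E : Type*} [NormedAddCommGroup E] [NormedSpace ℝ E] (k : ℕ) (F : EllTwo → E) : Prop :=
  (∀ j < k, Differentiable ℝ (iteratedFDeriv ℝ j F)) ∧ cbNorm k F < ⊤

/-- The distance `ρ_k(ν, μ)`, supremum of `∫ F dν - ∫ F dμ` over the real test functions `F` with
`‖F‖_{𝒞^k_b} ≤ 1`. It is `∞` if some test function is not integrable. -/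
def rho (k : ℕ) (ν μ : Measure EllTwo) : ℝ≥0∞ :=
  open Classical in
  ⨆ (F : EllTwo → ℝ) (_ : IsCb k F) (_ : cbNorm k F ≤ 1),
    if Integrable F ν ∧ Integrable F μ then ENNReal.ofReal (∫ x, F x ∂ν - ∫ x, F x ∂μ) else ⊤

/-! ### The hypothesis `Hyp(𝒳, H, α)` -/

/-- Trace of an operator of `ℓ²`, computed in the canonical basis. -/
def opTrace (T : EllTwo →L[ℝ] EllTwo) : ℝ := ∑' n : ℕ, ⟪T (xvec n), xvec n⟫_ℝ

/-- The partial trace `trace_𝒳(H ⊗ H)` as an operator of `ℓ²`. The tensor `H ∈ ℓ² ⊗ 𝒳` is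
identified with a (Hilbert-Schmidt) operator from `𝒳` to `ℓ²`, for which `trace_𝒳(H ⊗ H) = H H^*`,
that is, `∑ᵢ (H bᵢ) ⊗ (H bᵢ)` for any orthonormal basis `b` of `𝒳`. -/
def partialTrace {𝒳 : Type*} [NormedAddCommGroup 𝒳] [InnerProductSpace ℝ 𝒳] [CompleteSpace 𝒳]
    (H : 𝒳 →L[ℝ] EllTwo) : EllTwo →L[ℝ] EllTwo :=
  H ∘L ContinuousLinearMap.adjoint H

/-- `ν` is a probability measure which satisfies `Hyp(𝒳, H, α)`, where `H ∈ ℓ² ⊗ 𝒳` is identified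
with a Hilbert-Schmidt operator from `𝒳` to `ℓ²`: for all `G ∈ 𝒞²_b(ℓ²; ℓ²)`,
`|∫ x.G(x) dν - ∫ trace(trace_𝒳(H ⊗ H) ∘ ∇G(x)) dν| ≤ α ‖∇⁽²⁾G‖_∞`. -/
def Hyp {𝒳 : Type*} [NormedAddCommGroup 𝒳] [InnerProductSpace ℝ 𝒳] [CompleteSpace 𝒳]
    (H : 𝒳 →L[ℝ] EllTwo) (α : ℝ) (ν : Measure EllTwo) : Prop :=
  (Summable fun n : ℕ => ‖ContinuousLinearMap.adjoint H (xvec n)‖ ^ 2) ∧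
  IsProbabilityMeasure ν ∧
  ∀ G : EllTwo → EllTwo, IsCb 2 G →
    Integrable (fun x => ⟪x, G x⟫_ℝ) ν ∧
    Integrable (fun x => opTrace (partialTrace H ∘L fderiv ℝ G x)) ν ∧
    |∫ x, ⟪x, G x⟫_ℝ ∂ν - ∫ x, opTrace (partialTrace H ∘L fderiv ℝ G x) ∂ν|
      ≤ α * (supDeriv 2 G).toReal

/-! ### The interpolated Rademacher random walk -/

/-- The path `B_m^♯(t) = m^{-1/2} (∑_{j ≤ ⌊mt⌋} X_j + (mt - ⌊mt⌋) X_{⌊mt⌋+1})` built on the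
steps `X_1 = x 0, X_2 = x 1, …` -/
def interpWalk (m : ℕ) (x : ℕ → ℝ) (t : ℝ) : ℝ :=
  (Real.sqrt m)⁻¹ *
    (∑ j ∈ Finset.range ⌊(m : ℝ) * t⌋₊, x j
      + ((m : ℝ) * t - (⌊(m : ℝ) * t⌋₊ : ℝ)) * x ⌊(m : ℝ) * t⌋₊)

/-- The measure `ν_m^♯`: the law of `𝔍_β B_m^♯`. -/
def nuSharp {Ω : Type*} [MeasurableSpace Ω] (P : Measure Ω) (X : ℕ → Ω → ℝ)
    (e : HilbertBasis ℕ ℝ L2I) (β : ℝ) (m : ℕ) : Measure EllTwo :=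
  P.map (fun w => frakJ e β (interpWalk m (fun n => X n w)))

/-- The `n`-th coordinate of `H_m^♯(j)`, with `j = 0, …, m - 1`. -/
def hSharpCoeff (e : HilbertBasis ℕ ℝ L2I) (β : ℝ) (m : ℕ) (j : Fin m) (n : ℕ) : ℝ :=
  Real.sqrt m * ∫ s in ((j : ℝ) / m)..(((j : ℝ) + 1) / m), hfun e β n s

/-- The vector `H_m^♯(j) = ∑ₙ (√m ∫_{j/m}^{(j+1)/m} h_n^{1-β}(s) ds) xₙ` of `ℓ²`; see
`memℓp_hSharpCoeff`. -/
def hSharp (e : HilbertBasis ℕ ℝ L2I) (β : ℝ) (m : ℕ) (j : Fin m) : EllTwo :=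
  ofCoeffs (hSharpCoeff e β m j)

/-- The tensor `H_m^♯ = ∑_j x_j ⊗ H_m^♯(j)` as an operator of `ℓ²`, with
`(x ⊗ y) v = ⟨x, v⟩ y`. -/
def HSharp (e : HilbertBasis ℕ ℝ L2I) (β : ℝ) (m : ℕ) : EllTwo →L[ℝ] EllTwo :=
  ∑ j : Fin m, (innerSL ℝ (xvec j)).smulRight (hSharp e β m j)

/-! ### The coordinates of `H_m^♯(j)` are square summable -/

/-- The kernel `(s - t)_+^{α - 1}`. -/
def rlKernel (α s t : ℝ) : ℝ := if t < s then (s - t) ^ (α - 1) else 0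

theorem measurable_rlKernel (α : ℝ) : Measurable (fun p : ℝ × ℝ => rlKernel α p.2 p.1) := by
  unfold rlKernel
  refine Measurable.ite (measurableSet_lt measurable_fst measurable_snd) ?_ measurable_const
  exact (measurable_snd.sub measurable_fst).pow_const _

theorem rlKernel_nonneg (α s t : ℝ) : 0 ≤ rlKernel α s t := by
  unfold rlKernel
  split_ifs with h
  · exact Real.rpow_nonneg (by linarith) _
  · exact le_rfl

theorem integrableOn_rlKernel {α : ℝ} (hα : 0 < α) {a s : ℝ} (has : a ≤ s) :
    IntegrableOn (fun t => rlKernel α s t) (Set.Ioc a s) ∧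
      ∫ t in Set.Ioc a s, rlKernel α s t = (s - a) ^ α / α := by
  have h1 : IntervalIntegrable (fun u : ℝ => u ^ (α - 1)) volume (s - a) (s - s) :=
    intervalIntegral.intervalIntegrable_rpow' (by linarith)
  have h2 : IntervalIntegrable (fun t : ℝ => (s - t) ^ (α - 1)) volume a s := by
    have := h1.comp_sub_left s
    simpa using this
  have hae : (fun t => (s - t) ^ (α - 1)) =ᵐ[volume.restrict (Set.Ioc a s)]
      (fun t => rlKernel α s t) := by
    have hne : ∀ᵐ t : ℝ ∂(volume.restrict (Set.Ioc a s)), t ≠ s :=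
      ae_restrict_of_ae (by simp [ae_iff])
    filter_upwards [hne, ae_restrict_mem measurableSet_Ioc] with t ht hm
    have : t < s := lt_of_le_of_ne hm.2 ht
    simp [rlKernel, this]
  refine ⟨((intervalIntegrable_iff_integrableOn_Ioc_of_le has).1 h2).congr hae, ?_⟩
  rw [← integral_congr_ae hae, ← intervalIntegral.integral_of_le has,
    intervalIntegral.integral_comp_sub_left (fun u : ℝ => u ^ (α - 1)) s,
    integral_rpow (Or.inl (by linarith))]
  simp [Real.zero_rpow hα.ne']

theorem integrableOn_rlKernel' {α : ℝ} (hα : 0 < α) {a b s : ℝ} (ha : 0 ≤ a) (hs : s ≤ 1) :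
    IntegrableOn (fun t => rlKernel α s t) (Set.Ioc a b) ∧
      ∫ t in Set.Ioc a b, rlKernel α s t ≤ 1 / α := by
  rcases le_or_gt a s with has | has
  · obtain ⟨h1, h2⟩ := integrableOn_rlKernel hα has
    have hz : IntegrableOn (fun t => rlKernel α s t) (Set.Ioi s) := by
      refine (integrableOn_zero : IntegrableOn (fun _ : ℝ => (0 : ℝ)) (Set.Ioi s) volume).congr_fun
        (fun t ht => ?_) measurableSet_Ioi
      simp [rlKernel, not_lt.2 (le_of_lt (Set.mem_Ioi.1 ht))]
    have hz0 : ∫ t in Set.Ioi s, rlKernel α s t = 0 := by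
      rw [setIntegral_congr_fun (g := fun _ => (0 : ℝ)) measurableSet_Ioi]
      · simp
      · intro t ht
        simp [rlKernel, not_lt.2 (le_of_lt (Set.mem_Ioi.1 ht))]
    have hu : IntegrableOn (fun t => rlKernel α s t) (Set.Ioi a) := by
      rw [← Set.Ioc_union_Ioi_eq_Ioi has]
      exact h1.union hz
    refine ⟨hu.mono_set Set.Ioc_subset_Ioi_self, ?_⟩
    calc ∫ t in Set.Ioc a b, rlKernel α s t ≤ ∫ t in Set.Ioi a, rlKernel α s t :=
          setIntegral_mono_set hu (ae_of_all _ fun t => rlKernel_nonneg α s t)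
            Set.Ioc_subset_Ioi_self.eventuallyLE
      _ = (s - a) ^ α / α := by
          rw [← Set.Ioc_union_Ioi_eq_Ioi has,
            setIntegral_union Set.Ioc_disjoint_Ioi_same
              measurableSet_Ioi h1 hz, h2, hz0, add_zero]
      _ ≤ 1 / α := by
          gcongr
          exact Real.rpow_le_one (by linarith) (by linarith) hα.le
  · have h0 : Set.EqOn (fun t => rlKernel α s t) (fun _ => (0 : ℝ)) (Set.Ioc a b) := by
      intro t ht
      simp [rlKernel, not_lt.2 (le_of_lt (has.trans ht.1))]
    refine ⟨(integrableOn_zero : IntegrableOn (fun _ : ℝ => (0 : ℝ)) (Set.Ioc a b) volume).congr_fun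
      h0.symm measurableSet_Ioc, ?_⟩
    rw [setIntegral_congr_fun measurableSet_Ioc h0]
    simp [hα.le]

/-- Fractional integration by parts against the indicator function of an interval. -/
theorem exists_inner_eq_integral_rlRight {α : ℝ} (hα : 0 < α) {a b : ℝ} (ha : 0 ≤ a)
    (hab : a ≤ b) (hb : b ≤ 1) :
    ∃ g : L2I, ∀ f : L2I, ∫ t in a..b, rlRight α f t = ⟪f, g⟫_ℝ := by
  have hKm : Measurable (fun s : ℝ => ∫ t in Set.Ioc a b, rlKernel α s t) := by
    have : StronglyMeasurable (fun p : ℝ × ℝ => rlKernel α p.1 p.2) :=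
      ((measurable_rlKernel α).comp measurable_swap).stronglyMeasurable
    exact (this.integral_prod_right (ν := volume.restrict (Set.Ioc a b))).measurable
  have hmem : ∀ᵐ s ∂vol01, s ∈ Set.Icc (0 : ℝ) 1 := ae_restrict_mem measurableSet_Icc
  have hKb : ∀ᵐ s ∂vol01, ‖∫ t in Set.Ioc a b, rlKernel α s t‖ ≤ 1 / α := by
    filter_upwards [hmem] with s hs
    rw [Real.norm_of_nonneg (integral_nonneg fun t => rlKernel_nonneg α s t)]
    exact (integrableOn_rlKernel' hα ha hs.2).2
  have hK : MemLp (fun s : ℝ => (Real.Gamma α)⁻¹ * ∫ t in Set.Ioc a b, rlKernel α s t) 2 vol01 :=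
    (MemLp.of_bound hKm.aestronglyMeasurable _ hKb).const_mul _
  refine ⟨hK.toLp _, fun f => ?_⟩
  have hf : Integrable (fun s => f s) vol01 :=
    (Lp.memLp f).integrable (by norm_num)
  have hfm : AEStronglyMeasurable (fun s => f s) vol01 := hf.aestronglyMeasurable
  have hin : ∀ t ∈ Set.Ioc a b,
      rlRight α f t = ∫ s, (Real.Gamma α)⁻¹ * (f s * rlKernel α s t) ∂vol01 := by
    intro t ht
    have ht0 : 0 ≤ t := ha.trans ht.1.le
    have ht1 : t ≤ 1 := ht.2.trans hb
    rw [integral_const_mul, rlRight, intervalIntegral.integral_of_le ht1]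
    congr 1
    have hsub : Set.Ioc t 1 ⊆ Set.Icc (0 : ℝ) 1 := fun s hs => ⟨ht0.trans hs.1.le, hs.2⟩
    have hzero : ∀ s ∈ Set.Icc (0 : ℝ) 1 \ Set.Ioc t 1, f s * rlKernel α s t = 0 := by
      intro s hs
      have : ¬ t < s := fun h => hs.2 ⟨h, hs.1.2⟩
      simp [rlKernel, this]
    refine Eq.trans ?_
      (setIntegral_eq_of_subset_of_forall_sdiff_eq_zero measurableSet_Icc hsub hzero).symm
    refine setIntegral_congr_fun measurableSet_Ioc fun s hs => ?_
    simp [rlKernel, hs.1]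
  rw [intervalIntegral.integral_of_le hab, setIntegral_congr_fun measurableSet_Ioc hin]
  have hint : Integrable (Function.uncurry fun t s : ℝ =>
      (Real.Gamma α)⁻¹ * (f s * rlKernel α s t)) ((volume.restrict (Set.Ioc a b)).prod vol01) := by
    have hm : AEStronglyMeasurable (Function.uncurry fun t s : ℝ =>
        (Real.Gamma α)⁻¹ * (f s * rlKernel α s t))
        ((volume.restrict (Set.Ioc a b)).prod vol01) :=
      (hfm.comp_snd.mul (measurable_rlKernel α).aestronglyMeasurable).const_mul _
    refine (integrable_prod_iff' hm).2 ⟨?_, ?_⟩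
    · filter_upwards [hmem] with s hs
      exact ((integrableOn_rlKernel' hα ha hs.2).1.const_mul (f s)).const_mul _
    · refine (hf.norm.const_mul (‖(Real.Gamma α)⁻¹‖ * (1 / α))).mono'
        hm.norm.prod_swap.integral_prod_right' ?_
      filter_upwards [hmem] with s hs
      rw [Real.norm_of_nonneg (integral_nonneg fun t => norm_nonneg _)]
      have : ∀ t, ‖Function.uncurry (fun t s : ℝ =>
          (Real.Gamma α)⁻¹ * (f s * rlKernel α s t)) (t, s)‖
          = ‖(Real.Gamma α)⁻¹‖ * ‖f s‖ * rlKernel α s t := by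
        intro t
        simp only [Function.uncurry, norm_mul, Real.norm_of_nonneg (rlKernel_nonneg α s t)]
        ring
      simp only [this]
      rw [integral_const_mul]
      calc _ ≤ ‖(Real.Gamma α)⁻¹‖ * ‖f s‖ * (1 / α) := by
            gcongr
            exact (integrableOn_rlKernel' hα ha hs.2).2
        _ = _ := by ring
  rw [integral_integral_swap hint, L2.inner_def]
  refine integral_congr_ae ?_
  filter_upwards [hK.coeFn_toLp] with s hs
  rw [hs, integral_const_mul, integral_const_mul]
  simp only [RCLike.inner_apply, conj_trivial]
  ring

theorem memℓp_hSharpCoeff (e : HilbertBasis ℕ ℝ L2I) {β : ℝ} (hβ : β < 1) (m : ℕ) (j : Fin m) :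
    Memℓp (hSharpCoeff e β m j) 2 := by
  have hm : (0 : ℝ) < m := by exact_mod_cast j.pos
  have hj : ((j : ℕ) : ℝ) + 1 ≤ m := by exact_mod_cast j.isLt
  obtain ⟨g, hg⟩ := exists_inner_eq_integral_rlRight (α := 1 - β) (by linarith)
    (a := ((j : ℕ) : ℝ) / m) (b := (((j : ℕ) : ℝ) + 1) / m) (by positivity) (by gcongr; linarith)
    ((div_le_one hm).2 hj)
  have : hSharpCoeff e β m j = e.repr (Real.sqrt m • g) := by
    funext n
    rw [e.repr_apply_apply, inner_smul_right]
    simp only [hSharpCoeff, hfun, hg (e n)]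
  rw [this]
  exact lp.memℓp _

end DonskerRate

end

/-! ### Fractional calculus on `L2I`, and the walk as a finite sum of vectors of ℓ². -/

noncomputable section

namespace DonskerRate

/-! ### Composition and injectivity of fractional integrals -/

/-! Put α = 1 - β, so that 1/2 < α < 1, and let D be `rlOp α` followed by the coordinates in the
basis (e_n). Since I^1 = I^β I^α, the isometry `frakJ` sends I^1 f to D f. The interpolated walk is
I^1 of ∑ X_j f_j, where the f_j = `stepUnit m j` are orthonormal. Hence ν_m is the law of ∑ X_j h_j
with h_j = D f_j = `hSharp`, while m_β is the law of ∑ Y_n D e_n (`mBeta_eq_gaussLaw`).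

Stein-type bounds. With all signs frozen but the j-th, the gap between the expectations of X_j⟨h_j,
G⟩ and ⟨h_j, ∇G h_j⟩ is an error of the trapezoidal rule. Summing over j gives the constant ½ ∑
‖h_j‖³ (`hyp_map_sumVec`). The constant 1 then follows from ∑ ‖h_j‖³ ≤ 2, uniformly in m and β
(`sum_norm_rlOp_stepUnit_cube_le`).

Rate. The intermediate law is that of ∑ Y_j h_j with Gaussian Y_j, j < m. The measure m_β is its
convolution with a centred Gaussian law (`gaussLaw_eq_conv`), and a second order Taylor expansion
costs half the trace of that remainder, namely ½ (∑ ‖D e_n‖² - ∑ ‖D f_j‖²). This is bounded by the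
announced main term (`hilbertSchmidt_sub_le`).

The passage from Rademacher to Gaussian coefficients must therefore be o(m^(2β-1)). The usual
Lindeberg bound by ∑ ‖h_j‖³ is of order m^(-1/2), too large when β ≤ 1/4. The two laws share their
first three moments, but the test functions have no fourth derivative. The missing regularity comes
from the Gaussian variables already exchanged: h_j is close to the average of its n predecessors,
and a translation of the Gaussian sum along that average moves its law by at most a constant times
n^(-1/2) in total variation. Telescoping over n (`abs_smoothed_second_difference_le`) gives an error
O(m^(β-1) + m^(-1)) (`exists_abs_integral_rad_sub_stdG_le`), which is negligible. -/

theorem integral_rpow_mul_rpow_eq_Gamma {a b L : ℝ} (ha : 0 < a) (hb : 0 < b) (hab : a + b = 1)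
    (hL : 0 < L) :
    ∫ x in (0 : ℝ)..L, x ^ (b - 1) * (L - x) ^ (a - 1) = Real.Gamma a * Real.Gamma b := by
  have h := Complex.betaIntegral_scaled (b : ℂ) (a : ℂ) hL
  have h2 := Complex.Gamma_mul_Gamma_eq_betaIntegral (s := (b : ℂ)) (t := (a : ℂ))
    (by simpa) (by simpa)
  have hba : (b : ℂ) + a = 1 := by rw [add_comm]; exact_mod_cast hab
  rw [hba, Complex.Gamma_one, one_mul] at h2
  rw [hba, sub_self, Complex.cpow_zero, one_mul, ← h2, Complex.Gamma_ofReal,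
    Complex.Gamma_ofReal] at h
  have h3 : ((∫ x in (0 : ℝ)..L, x ^ (b - 1) * (L - x) ^ (a - 1) : ℝ) : ℂ)
      = ∫ x in (0 : ℝ)..L, (x : ℂ) ^ ((b : ℂ) - 1) * ((L : ℂ) - x) ^ ((a : ℂ) - 1) := by
    rw [← intervalIntegral.integral_ofReal]
    refine intervalIntegral.integral_congr fun x hx => ?_
    rw [Set.uIcc_of_le hL.le] at hx
    have h1 : (0 : ℝ) ≤ L - x := by linarith [hx.2]
    simp only [Complex.ofReal_mul]
    rw [Complex.ofReal_cpow hx.1, Complex.ofReal_cpow h1]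
    push_cast
    ring
  rw [h] at h3
  rw [mul_comm]
  exact_mod_cast h3

/-- The Beta integral loses its dependence on x - s exactly because a + b = 1; this is the
composition I^a I^b = I^1 at the level of kernels. -/
theorem integral_rlKernel_mul_rlKernel {a b s x : ℝ} (ha : 0 < a) (hb : 0 < b) (hab : a + b = 1)
    (hsx : s < x) :
    ∫ t, rlKernel a x t * rlKernel b t s = Real.Gamma a * Real.Gamma b := by
  rw [← integral_rpow_mul_rpow_eq_Gamma ha hb hab (sub_pos.2 hsx),
    intervalIntegral.integral_of_le (sub_pos.2 hsx).le]
  have h1 : ∀ t, rlKernel a x t * rlKernel b t s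
      = (Set.Ioo s x).indicator (fun t => (t - s) ^ (b - 1) * (x - s - (t - s)) ^ (a - 1)) t := by
    intro t
    simp only [rlKernel, Set.indicator, Set.mem_Ioo]
    by_cases h1 : s < t <;> by_cases h2 : t < x <;> simp [h1, h2, mul_comm]
  simp_rw [h1]
  rw [integral_indicator measurableSet_Ioo, ← integral_Ioc_eq_integral_Ioo,
    ← intervalIntegral.integral_of_le hsx.le, ← intervalIntegral.integral_of_le (sub_pos.2 hsx).le,
    intervalIntegral.integral_comp_sub_right (fun t => t ^ (b - 1) * (x - s - t) ^ (a - 1)) s]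
  simp

theorem integrable_rlKernel_mul_rlKernel {a b : ℝ} (ha : 0 < a) (hb : 0 < b) (hab : a + b = 1)
    (s x : ℝ) : Integrable (fun t => rlKernel a x t * rlKernel b t s) := by
  rcases lt_or_ge s x with h | h
  · apply Integrable.of_integral_ne_zero
    rw [integral_rlKernel_mul_rlKernel ha hb hab h]
    exact (mul_pos (Real.Gamma_pos_of_pos ha) (Real.Gamma_pos_of_pos hb)).ne'
  · have : ∀ t, rlKernel a x t * rlKernel b t s = 0 := by
      intro t
      simp only [rlKernel]
      by_cases h1 : t < x
      · simp [not_lt.2 (h1.le.trans h)]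
      · simp [h1]
    simp [this]

theorem rlLeft_eq_integral_vol01 (α : ℝ) (f : ℝ → ℝ) {x : ℝ} (hx : x ∈ Set.Icc (0 : ℝ) 1) :
    rlLeft α f x = (Real.Gamma α)⁻¹ * ∫ t, f t * rlKernel α x t ∂vol01 := by
  rw [rlLeft, intervalIntegral.integral_of_le hx.1, integral_Ioc_eq_integral_Ioo]
  congr 1
  have hsub : Set.Ioo 0 x ⊆ Set.Icc (0 : ℝ) 1 := fun t ht => ⟨ht.1.le, ht.2.le.trans hx.2⟩
  have hae : ∀ᵐ t ∂(volume : Measure ℝ), t ∈ Set.Icc (0 : ℝ) 1 \ Set.Ioo 0 x →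
      f t * rlKernel α x t = 0 := by
    have h0 : ∀ᵐ t ∂(volume : Measure ℝ), t ≠ 0 := by simp [ae_iff]
    filter_upwards [h0] with t ht hm
    have : ¬ t < x := fun h => hm.2 ⟨lt_of_le_of_ne hm.1.1 ht.symm, h⟩
    simp [rlKernel, this]
  rw [setIntegral_eq_of_subset_of_ae_sdiff_eq_zero measurableSet_Icc.nullMeasurableSet hsub hae]
  refine setIntegral_congr_fun measurableSet_Ioo fun t ht => ?_
  simp [rlKernel, ht.2]

theorem rlLeft_congr {α : ℝ} {f g : ℝ → ℝ} (h : f =ᵐ[vol01] g) {x : ℝ}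
    (hx : x ∈ Set.Icc (0 : ℝ) 1) : rlLeft α f x = rlLeft α g x := by
  rw [rlLeft_eq_integral_vol01 α f hx, rlLeft_eq_integral_vol01 α g hx]
  congr 1
  refine integral_congr_ae ?_
  filter_upwards [h] with t ht
  rw [ht]

theorem rlLeft_one_eq (f : ℝ → ℝ) (x : ℝ) : rlLeft 1 f x = ∫ t in (0 : ℝ)..x, f t := by
  simp [rlLeft]

/-- The semigroup property `I^a I^b = I^1` for `a + b = 1`. -/
theorem rlLeft_rlLeft {a b : ℝ} (ha : 0 < a) (hb : 0 < b) (hab : a + b = 1) {f : ℝ → ℝ}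
    (hf : Integrable f vol01) {x : ℝ} (hx : x ∈ Set.Icc (0 : ℝ) 1) :
    rlLeft a (rlLeft b f) x = rlLeft 1 f x := by
  have hGa := (Real.Gamma_pos_of_pos ha).ne'
  have hGb := (Real.Gamma_pos_of_pos hb).ne'
  have hker : ∀ s ∈ Set.Icc (0 : ℝ) 1, ∀ t, t ∉ Set.Icc (0 : ℝ) 1 →
      rlKernel a x t * rlKernel b t s = 0 := by
    intro s hs t ht
    by_cases h1 : t < x
    · have : ¬ s < t := fun h => ht ⟨hs.1.trans h.le, h1.le.trans hx.2⟩
      simp [rlKernel, this]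
    · simp [rlKernel, h1]
  have hmem : ∀ᵐ s ∂vol01, s ∈ Set.Icc (0 : ℝ) 1 := ae_restrict_mem measurableSet_Icc
  have hval : ∀ s ∈ Set.Icc (0 : ℝ) 1, ∫ t, rlKernel a x t * rlKernel b t s ∂vol01
      = Real.Gamma a * Real.Gamma b * rlKernel 1 x s := by
    intro s hs
    rw [setIntegral_eq_integral_of_forall_compl_eq_zero (fun t ht => hker s hs t ht)]
    rcases lt_or_ge s x with h | h
    · rw [integral_rlKernel_mul_rlKernel ha hb hab h]
      simp [rlKernel, h]
    · have : ∀ t, rlKernel a x t * rlKernel b t s = 0 := by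
        intro t
        by_cases h1 : t < x
        · simp [rlKernel, not_lt.2 (h1.le.trans h)]
        · simp [rlKernel, h1]
      simp_rw [this]
      simp [rlKernel, not_lt.2 h]
  have hint : Integrable (Function.uncurry fun t s : ℝ =>
      f s * rlKernel b t s * rlKernel a x t) (vol01.prod vol01) := by
    have hm : AEStronglyMeasurable (Function.uncurry fun t s : ℝ =>
        f s * rlKernel b t s * rlKernel a x t) (vol01.prod vol01) :=
      (hf.aestronglyMeasurable.comp_snd.mul
        ((measurable_rlKernel b).comp measurable_swap).aestronglyMeasurable).mul
        (((measurable_rlKernel a).comp (measurable_fst.prodMk measurable_const))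
          |>.aestronglyMeasurable)
    refine (integrable_prod_iff' hm).2 ⟨?_, ?_⟩
    · refine ae_of_all _ fun s => ?_
      have := ((integrable_rlKernel_mul_rlKernel ha hb hab s x).restrict
        (s := Set.Icc 0 1)).const_mul (f s)
      refine this.congr (ae_of_all _ fun t => ?_)
      simp only [Function.uncurry]; ring
    · refine (hf.norm.const_mul (Real.Gamma a * Real.Gamma b)).mono'
        hm.norm.prod_swap.integral_prod_right' ?_
      filter_upwards [hmem] with s hs
      rw [Real.norm_of_nonneg (integral_nonneg fun t => norm_nonneg _)]
      have : ∀ t, ‖Function.uncurry (fun t s : ℝ => f s * rlKernel b t s * rlKernel a x t) (t, s)‖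
          = ‖f s‖ * (rlKernel a x t * rlKernel b t s) := by
        intro t
        simp only [Function.uncurry, norm_mul, Real.norm_of_nonneg (rlKernel_nonneg _ _ _)]
        ring
      simp only [this]
      rw [integral_const_mul, hval s hs, mul_comm]
      refine mul_le_mul_of_nonneg_right ?_ (norm_nonneg _)
      have : rlKernel 1 x s ≤ 1 := by
        unfold rlKernel
        split_ifs <;> simp
      have hpos := mul_pos (Real.Gamma_pos_of_pos ha) (Real.Gamma_pos_of_pos hb)
      exact mul_le_of_le_one_right hpos.le this
  rw [rlLeft_eq_integral_vol01 a _ hx, rlLeft_eq_integral_vol01 1 _ hx]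
  have h1 : ∫ t, rlLeft b f t * rlKernel a x t ∂vol01
      = (Real.Gamma b)⁻¹ * ∫ t, ∫ s, f s * rlKernel b t s * rlKernel a x t ∂vol01 ∂vol01 := by
    rw [← integral_const_mul]
    refine integral_congr_ae ?_
    filter_upwards [hmem] with t ht
    rw [rlLeft_eq_integral_vol01 b f ht, integral_mul_const]
    ring
  rw [h1, integral_integral_swap hint]
  have h2 : ∀ᵐ s ∂vol01, ∫ t, f s * rlKernel b t s * rlKernel a x t ∂vol01
      = Real.Gamma a * Real.Gamma b * (f s * rlKernel 1 x s) := by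
    filter_upwards [hmem] with s hs
    calc _ = f s * ∫ t, rlKernel a x t * rlKernel b t s ∂vol01 := by
          rw [← integral_const_mul]
          congr 1; funext t; ring
      _ = _ := by rw [hval s hs]; ring
  rw [integral_congr_ae h2, integral_const_mul, Real.Gamma_one]
  field_simp

theorem L2I_integrable (f : L2I) : Integrable (fun s => f s) vol01 :=
  (Lp.memLp f).integrable (by norm_num)

/-- Lebesgue differentiation recovers f and g from their primitives almost everywhere. Working on
the open interval makes the equality of primitives hold in a neighbourhood of each point. -/
theorem L2I_eq_of_rlLeft_one_eq {f g : L2I}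
    (h : ∀ x ∈ Set.Icc (0 : ℝ) 1, rlLeft 1 f x = rlLeft 1 g x) : f = g := by
  have hi : ∀ f : L2I, IntervalIntegrable (fun s => f s) volume 0 1 := fun f =>
    (intervalIntegrable_iff_integrableOn_Icc_of_le zero_le_one).2 (L2I_integrable f)
  refine Lp.ext ?_
  change ∀ᵐ x ∂(volume.restrict (Set.Icc (0 : ℝ) 1)), f x = g x
  rw [← restrict_Ioo_eq_restrict_Icc, ae_restrict_iff' measurableSet_Ioo]
  filter_upwards [(hi f).ae_hasDerivAt_integral, (hi g).ae_hasDerivAt_integral] with x hf hg hx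
  have hx' : x ∈ Set.uIcc (0 : ℝ) 1 := by
    rw [Set.uIcc_of_le zero_le_one]; exact Set.Ioo_subset_Icc_self hx
  have h1 := hf hx' 0 Set.left_mem_uIcc
  have h2 := hg hx' 0 Set.left_mem_uIcc
  refine h1.unique (h2.congr_of_eventuallyEq ?_)
  filter_upwards [Ioo_mem_nhds hx.1 hx.2] with y hy
  simpa [rlLeft_one_eq] using h y (Set.Ioo_subset_Icc_self hy)

/-- Applying I^(1-β) to both sides reduces the claim to the injectivity of I^1. -/
theorem rlLeft_injective {β : ℝ} (hβ0 : 0 < β) (hβ : β < 1) {f g : L2I}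
    (h : rlLeft β f =ᵐ[vol01] rlLeft β g) : f = g := by
  refine L2I_eq_of_rlLeft_one_eq fun x hx => ?_
  rw [← rlLeft_rlLeft (a := 1 - β) (b := β) (by linarith) hβ0 (by ring) (L2I_integrable f) hx,
    ← rlLeft_rlLeft (a := 1 - β) (b := β) (by linarith) hβ0 (by ring) (L2I_integrable g) hx]
  exact rlLeft_congr h hx

/-- The choice made in `fracDeriv` is harmless by injectivity, so any exhibited preimage computes
`frakJ`. -/
theorem frakJ_eq {β : ℝ} (hβ0 : 0 < β) (hβ : β < 1) (e : HilbertBasis ℕ ℝ L2I) {ω : ℝ → ℝ}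
    {f : L2I} (h : ω =ᵐ[vol01] rlLeft β f) : frakJ e β ω = e.repr f := by
  have hm : MemBesovLiouville β ω := ⟨f, h⟩
  rw [frakJ, fracDeriv, dif_pos hm]
  congr 1
  exact rlLeft_injective hβ0 hβ (hm.choose_spec.symm.trans h)

end DonskerRate

end

noncomputable section

namespace DonskerRate

/-! ### The fractional integral as a Hilbert-Schmidt operator -/

theorem integral_rlKernel_vol01 {α x : ℝ} (hα : 0 < α) (hx : x ∈ Set.Icc (0 : ℝ) 1) :
    Integrable (fun t => rlKernel α x t) vol01 ∧ ∫ t, rlKernel α x t ∂vol01 = x ^ α / α := by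
  have h1 := integrableOn_rlKernel' (a := 0) (b := 1) hα le_rfl hx.2
  refine ⟨(integrableOn_Icc_iff_integrableOn_Ioc).2 h1.1, ?_⟩
  change ∫ t in Set.Icc (0 : ℝ) 1, rlKernel α x t = _
  rw [integral_Icc_eq_integral_Ioc,
    setIntegral_eq_of_subset_of_forall_sdiff_eq_zero measurableSet_Ioc
      (Set.Ioc_subset_Ioc_right hx.2) (fun t ht => ?_), (integrableOn_rlKernel hα hx.1).2, sub_zero]
  have : ¬ t < x := fun h => ht.2 ⟨ht.1.1, h.le⟩
  simp [rlKernel, this]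

theorem rlKernel_sq {α : ℝ} (s t : ℝ) : rlKernel α s t ^ 2 = rlKernel (2 * α - 1) s t := by
  unfold rlKernel
  split_ifs with h
  · rw [← Real.rpow_natCast, ← Real.rpow_mul (by linarith)]
    congr 1; push_cast; ring
  · simp

/-- The squared kernel is the kernel of order 2α - 1, integrable because 2α - 1 > 0. This is where β
< 1/2 enters. -/
theorem memLp_kernel {α x : ℝ} (hα : 1 / 2 < α) (hx : x ∈ Set.Icc (0 : ℝ) 1) :
    MemLp (fun t => (Real.Gamma α)⁻¹ * rlKernel α x t) 2 vol01 := by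
  refine MemLp.const_mul ?_ _
  have hm : Measurable (rlKernel α x) :=
    (measurable_rlKernel α).comp (measurable_id.prodMk measurable_const)
  rw [memLp_two_iff_integrable_sq hm.aestronglyMeasurable]
  simp_rw [rlKernel_sq]
  exact (integral_rlKernel_vol01 (by linarith) hx).1

/-- For α > 1/2 evaluation at x is a bounded functional; linearity, the sup bound and the Parseval
computation of the Hilbert-Schmidt norm all rest on this. -/
theorem rlLeft_eq_inner {α x : ℝ} (hα : 1 / 2 < α) (hx : x ∈ Set.Icc (0 : ℝ) 1) (f : L2I) :
    rlLeft α f x = ⟪(memLp_kernel hα hx).toLp _, f⟫_ℝ := by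
  rw [rlLeft_eq_integral_vol01 _ _ hx, L2.inner_def, ← integral_const_mul]
  refine integral_congr_ae ?_
  filter_upwards [(memLp_kernel hα hx).coeFn_toLp] with t ht
  rw [ht]
  simp only [RCLike.inner_apply, conj_trivial]
  ring

theorem norm_kernel_sq {α x : ℝ} (hα : 1 / 2 < α) (hx : x ∈ Set.Icc (0 : ℝ) 1) :
    ‖(memLp_kernel hα hx).toLp _‖ ^ 2 =
      x ^ (2 * α - 1) / ((2 * α - 1) * Real.Gamma α ^ 2) := by
  rw [← real_inner_self_eq_norm_sq, L2.inner_def]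
  have : ∫ t, (Real.Gamma α)⁻¹ ^ 2 * rlKernel (2 * α - 1) x t ∂vol01
      = x ^ (2 * α - 1) / ((2 * α - 1) * Real.Gamma α ^ 2) := by
    rw [integral_const_mul, (integral_rlKernel_vol01 (by linarith) hx).2]
    field_simp
  rw [← this]
  refine integral_congr_ae ?_
  filter_upwards [(memLp_kernel hα hx).coeFn_toLp] with t ht
  rw [ht]
  simp only [RCLike.inner_apply, conj_trivial]
  rw [← rlKernel_sq]
  ring

theorem aestronglyMeasurable_rlLeft (α : ℝ) (f : L2I) :
    AEStronglyMeasurable (rlLeft α f) vol01 := by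
  have hm : AEStronglyMeasurable (fun p : ℝ × ℝ => f p.2 * rlKernel α p.1 p.2)
      (vol01.prod vol01) :=
    (L2I_integrable f).aestronglyMeasurable.comp_snd.mul
      ((measurable_rlKernel α).comp measurable_swap).aestronglyMeasurable
  refine (hm.integral_prod_right'.const_mul (Real.Gamma α)⁻¹).congr ?_
  filter_upwards [ae_restrict_mem measurableSet_Icc] with x hx
  rw [rlLeft_eq_integral_vol01 α _ hx]

theorem abs_rlLeft_le {α x : ℝ} (hα : 1 / 2 < α) (hx : x ∈ Set.Icc (0 : ℝ) 1) (f : L2I) :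
    ‖rlLeft α f x‖ ≤ Real.sqrt (1 / ((2 * α - 1) * Real.Gamma α ^ 2)) * ‖f‖ := by
  have hG := Real.Gamma_pos_of_pos (show 0 < α by linarith)
  rw [rlLeft_eq_inner hα hx]
  refine (norm_inner_le_norm _ _).trans (mul_le_mul_of_nonneg_right ?_ (norm_nonneg _))
  refine Real.le_sqrt_of_sq_le ?_
  rw [norm_kernel_sq hα hx]
  have h1 : 0 < 2 * α - 1 := by linarith
  gcongr
  exact Real.rpow_le_one hx.1 hx.2 h1.le

theorem memLp_rlLeft {α : ℝ} (hα : 1 / 2 < α) (f : L2I) : MemLp (rlLeft α f) 2 vol01 := by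
  refine MemLp.of_bound (aestronglyMeasurable_rlLeft α f)
    (Real.sqrt (1 / ((2 * α - 1) * Real.Gamma α ^ 2)) * ‖f‖) ?_
  filter_upwards [ae_restrict_mem measurableSet_Icc] with x hx
  exact abs_rlLeft_le hα hx f

instance : IsProbabilityMeasure vol01 := ⟨by simp⟩

/-- The left fractional integral of order `α > 1/2` as an operator of `ℒ²([0,1])`. -/
def rlOp (α : ℝ) (hα : 1 / 2 < α) : L2I →L[ℝ] L2I :=
  LinearMap.mkContinuous
    { toFun := fun f => (memLp_rlLeft hα f).toLp _
      map_add' := fun f g => by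
        rw [← MemLp.toLp_add]
        refine (MemLp.toLp_eq_toLp_iff _ _).2 ?_
        filter_upwards [ae_restrict_mem measurableSet_Icc] with x hx
        simp only [Pi.add_apply]
        rw [rlLeft_eq_inner hα hx, rlLeft_eq_inner hα hx, rlLeft_eq_inner hα hx, inner_add_right]
      map_smul' := fun c f => by
        simp only [RingHom.id_apply]
        rw [← MemLp.toLp_const_smul]
        refine (MemLp.toLp_eq_toLp_iff _ _).2 ?_
        filter_upwards [ae_restrict_mem measurableSet_Icc] with x hx
        simp only [Pi.smul_apply]
        rw [rlLeft_eq_inner hα hx, rlLeft_eq_inner hα hx, inner_smul_right, smul_eq_mul] }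
    (Real.sqrt (1 / ((2 * α - 1) * Real.Gamma α ^ 2)))
    (fun f => by
      have := Lp.norm_le_of_ae_bound (f := (memLp_rlLeft hα f).toLp _)
        (C := Real.sqrt (1 / ((2 * α - 1) * Real.Gamma α ^ 2)) * ‖f‖) (by positivity) (by
          filter_upwards [ae_restrict_mem measurableSet_Icc, (memLp_rlLeft hα f).coeFn_toLp]
            with x hx hf
          rw [hf]
          exact abs_rlLeft_le hα hx f)
      simpa [measureUnivNNReal] using this)

theorem rlOp_coeFn {α : ℝ} (hα : 1 / 2 < α) (f : L2I) : rlOp α hα f =ᵐ[vol01] rlLeft α f :=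
  (memLp_rlLeft hα f).coeFn_toLp

theorem norm_sq_eq_integral (f : L2I) : ‖f‖ ^ 2 = ∫ x, f x ^ 2 ∂vol01 := by
  rw [← real_inner_self_eq_norm_sq, L2.inner_def]
  simp [sq]

theorem integrable_sq (f : L2I) : Integrable (fun x => f x ^ 2) vol01 :=
  (memLp_two_iff_integrable_sq (Lp.memLp f).1).1 (Lp.memLp f)

theorem norm_rlOp_sq {α : ℝ} (hα : 1 / 2 < α) (f : L2I) :
    ‖rlOp α hα f‖ ^ 2 = ∫ x, rlLeft α f x ^ 2 ∂vol01 := by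
  rw [norm_sq_eq_integral]
  refine integral_congr_ae ?_
  filter_upwards [rlOp_coeFn hα f] with x hx
  rw [hx]

/-- Parseval applied to the kernel at each fixed x gives the sum of the squared values at x;
integrating in x gives the squared Hilbert-Schmidt norm. -/
theorem hasSum_norm_rlOp_sq {α : ℝ} (hα : 1 / 2 < α) (e : HilbertBasis ℕ ℝ L2I) :
    HasSum (fun n => ‖rlOp α hα (e n)‖ ^ 2)
      (1 / ((2 * α - 1) * (2 * α) * Real.Gamma α ^ 2)) := by
  have hG := Real.Gamma_pos_of_pos (show 0 < α by linarith)
  have h1 : 0 < 2 * α - 1 := by linarith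
  simp_rw [norm_rlOp_sq]
  have hI : ∫ x, x ^ (2 * α - 1) / ((2 * α - 1) * Real.Gamma α ^ 2) ∂vol01
      = 1 / ((2 * α - 1) * (2 * α) * Real.Gamma α ^ 2) := by
    change ∫ x in Set.Icc (0 : ℝ) 1, _ = _
    rw [integral_Icc_eq_integral_Ioc, ← intervalIntegral.integral_of_le zero_le_one,
      intervalIntegral.integral_div, integral_rpow (Or.inl (by linarith))]
    simp only [sub_add_cancel, Real.one_rpow]
    rw [Real.zero_rpow (by linarith)]
    field_simp
    ring
  have hS : ∀ x ∈ Set.Icc (0 : ℝ) 1, HasSum (fun n => rlLeft α (e n) x ^ 2)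
      (x ^ (2 * α - 1) / ((2 * α - 1) * Real.Gamma α ^ 2)) := by
    intro x hx
    rw [← norm_kernel_sq hα hx, ← real_inner_self_eq_norm_sq]
    convert! e.hasSum_inner_mul_inner _ _ using 2 with n
    rw [rlLeft_eq_inner hα hx, sq]
    congr 1
    exact real_inner_comm _ _
  rw [← hI]
  have hmem : ∀ᵐ s ∂vol01, s ∈ Set.Icc (0 : ℝ) 1 := ae_restrict_mem measurableSet_Icc
  refine hasSum_integral_of_dominated_convergence (fun n x => rlLeft α (e n) x ^ 2)
    (fun n => (aestronglyMeasurable_rlLeft α (e n)).pow 2) (fun n => ae_of_all _ fun x => by simp)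
    ?_ ?_ ?_
  · filter_upwards [hmem] with x hx using (hS x hx).summable
  · refine Integrable.congr (f := fun x : ℝ => x ^ (2 * α - 1) / ((2 * α - 1) * Real.Gamma α ^ 2))
      ?_ ?_
    · refine Integrable.of_integral_ne_zero ?_
      rw [hI]
      positivity
    · filter_upwards [hmem] with x hx using (hS x hx).tsum_eq.symm
  · filter_upwards [hmem] with x hx using hS x hx

/-! ### Step functions -/

theorem restrict_vol01 {a b : ℝ} (ha : 0 ≤ a) (hb : b ≤ 1) :
    vol01.restrict (Set.Ioc a b) = volume.restrict (Set.Ioc a b) :=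
  Measure.restrict_restrict_of_subset fun _ ht => ⟨ha.trans ht.1.le, ht.2.trans hb⟩

/-- The indicator function of `(a, b]` in `ℒ²([0,1])`. -/
def stepVec (a b : ℝ) : L2I :=
  indicatorConstLp 2 (measurableSet_Ioc : MeasurableSet (Set.Ioc a b)) (measure_ne_top _ _) 1

theorem stepVec_coeFn (a b : ℝ) :
    stepVec a b =ᵐ[vol01] (Set.Ioc a b).indicator fun _ => (1 : ℝ) := indicatorConstLp_coeFn

theorem inner_stepVec {a b : ℝ} (ha : 0 ≤ a) (hab : a ≤ b) (hb : b ≤ 1) (f : L2I) :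
    ⟪stepVec a b, f⟫_ℝ = ∫ t in a..b, f t := by
  rw [stepVec, L2.inner_indicatorConstLp_one, restrict_vol01 ha hb,
    intervalIntegral.integral_of_le hab]

theorem rlLeft_one_eq_inner {t : ℝ} (ht : t ∈ Set.Icc (0 : ℝ) 1) (f : L2I) :
    rlLeft 1 f t = ⟪stepVec 0 t, f⟫_ℝ := by
  rw [rlLeft_one_eq, inner_stepVec le_rfl ht.1 ht.2]

theorem rlLeft_stepVec {α a b x : ℝ} (ha : 0 ≤ a) (hb : b ≤ 1) (hx : x ∈ Set.Icc (0 : ℝ) 1) :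
    rlLeft α (stepVec a b) x = (Real.Gamma α)⁻¹ * ∫ t in Set.Ioc a b, rlKernel α x t := by
  rw [rlLeft_eq_integral_vol01 α _ hx]
  congr 1
  have h1 : ∫ t, stepVec a b t * rlKernel α x t ∂vol01
      = ∫ t, (Set.Ioc a b).indicator (fun t => rlKernel α x t) t ∂vol01 := by
    refine integral_congr_ae ?_
    filter_upwards [stepVec_coeFn a b] with t ht
    rw [ht]
    by_cases h : t ∈ Set.Ioc a b <;> simp [h]
  rw [h1, integral_indicator measurableSet_Ioc, restrict_vol01 ha hb]

theorem inner_stepVec_stepVec {a b t : ℝ} (ha : 0 ≤ a) (hb : b ≤ 1) (c : ℝ) :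
    ⟪stepVec c t, stepVec a b⟫_ℝ = max (min b t - max a c) 0 := by
  rw [real_inner_comm, stepVec, L2.inner_indicatorConstLp_one, restrict_vol01 ha hb]
  have h1 : stepVec c t =ᵐ[volume.restrict (Set.Ioc a b)]
      (Set.Ioc c t).indicator fun _ => (1 : ℝ) := by
    rw [← restrict_vol01 ha hb]
    exact ae_restrict_of_ae (stepVec_coeFn c t)
  rw [integral_congr_ae h1, setIntegral_indicator measurableSet_Ioc, Set.Ioc_inter_Ioc]
  simp [Measure.real, ENNReal.toReal_ofReal']

end DonskerRate

end

noncomputable section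

namespace DonskerRate

/-- Fubini, as in `exists_inner_eq_integral_rlRight`, but with the representing vector explicit:
this identifies the coordinates of `hSharp`. -/
theorem integral_rlRight_eq_inner {α : ℝ} (hα : 1 / 2 < α) {a b : ℝ} (ha : 0 ≤ a)
    (hab : a ≤ b) (hb : b ≤ 1) (f : L2I) :
    ∫ t in a..b, rlRight α f t = ⟪f, rlOp α hα (stepVec a b)⟫_ℝ := by
  have hα0 : 0 < α := by linarith
  have hmem : ∀ᵐ s ∂vol01, s ∈ Set.Icc (0 : ℝ) 1 := ae_restrict_mem measurableSet_Icc
  have hf := L2I_integrable f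
  have hin : ∀ t ∈ Set.Ioc a b,
      rlRight α f t = ∫ s, (Real.Gamma α)⁻¹ * (f s * rlKernel α s t) ∂vol01 := by
    intro t ht
    have ht0 : 0 ≤ t := ha.trans ht.1.le
    rw [integral_const_mul, rlRight, intervalIntegral.integral_of_le (ht.2.trans hb)]
    congr 1
    have hsub : Set.Ioc t 1 ⊆ Set.Icc (0 : ℝ) 1 := fun s hs => ⟨ht0.trans hs.1.le, hs.2⟩
    have hzero : ∀ s ∈ Set.Icc (0 : ℝ) 1 \ Set.Ioc t 1, f s * rlKernel α s t = 0 := by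
      intro s hs
      have : ¬ t < s := fun h => hs.2 ⟨h, hs.1.2⟩
      simp [rlKernel, this]
    refine Eq.trans ?_
      (setIntegral_eq_of_subset_of_forall_sdiff_eq_zero measurableSet_Icc hsub hzero).symm
    refine setIntegral_congr_fun measurableSet_Ioc fun s hs => ?_
    simp [rlKernel, hs.1]
  rw [intervalIntegral.integral_of_le hab, setIntegral_congr_fun measurableSet_Ioc hin]
  have hint : Integrable (Function.uncurry fun t s : ℝ =>
      (Real.Gamma α)⁻¹ * (f s * rlKernel α s t)) ((volume.restrict (Set.Ioc a b)).prod vol01) := by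
    have hm : AEStronglyMeasurable (Function.uncurry fun t s : ℝ =>
        (Real.Gamma α)⁻¹ * (f s * rlKernel α s t))
        ((volume.restrict (Set.Ioc a b)).prod vol01) :=
      (hf.aestronglyMeasurable.comp_snd.mul
        (measurable_rlKernel α).aestronglyMeasurable).const_mul _
    refine (integrable_prod_iff' hm).2 ⟨?_, ?_⟩
    · filter_upwards [hmem] with s hs
      exact ((integrableOn_rlKernel' hα0 ha hs.2).1.const_mul (f s)).const_mul _
    · refine (hf.norm.const_mul (‖(Real.Gamma α)⁻¹‖ * (1 / α))).mono'
        hm.norm.prod_swap.integral_prod_right' ?_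
      filter_upwards [hmem] with s hs
      rw [Real.norm_of_nonneg (integral_nonneg fun t => norm_nonneg _)]
      have : ∀ t, ‖Function.uncurry (fun t s : ℝ =>
          (Real.Gamma α)⁻¹ * (f s * rlKernel α s t)) (t, s)‖
          = ‖(Real.Gamma α)⁻¹‖ * ‖f s‖ * rlKernel α s t := by
        intro t
        simp only [Function.uncurry, norm_mul, Real.norm_of_nonneg (rlKernel_nonneg α s t)]
        ring
      simp only [this]
      rw [integral_const_mul, mul_right_comm]
      gcongr
      exact (integrableOn_rlKernel' hα0 ha hs.2).2
  rw [integral_integral_swap hint, L2.inner_def]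
  refine integral_congr_ae ?_
  filter_upwards [rlOp_coeFn hα (stepVec a b), hmem] with s hs hs1
  rw [hs, rlLeft_stepVec ha hb hs1, integral_const_mul, integral_const_mul]
  simp only [RCLike.inner_apply, conj_trivial]
  ring

/-! ### The orthonormal step functions and the vectors `H_m^♯(j)` -/

/-- The normalized indicator function of `(j/m, (j+1)/m]`. -/
def stepUnit (m j : ℕ) : L2I := Real.sqrt m • stepVec ((j : ℝ) / m) (((j : ℝ) + 1) / m)

theorem div_bounds {m j : ℕ} (hj : j < m) :
    (0 : ℝ) ≤ (j : ℝ) / m ∧ (j : ℝ) / m ≤ ((j : ℝ) + 1) / m ∧ ((j : ℝ) + 1) / m ≤ 1 := by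
  have hm : (0 : ℝ) < m := by exact_mod_cast (Nat.zero_le j).trans_lt hj
  have hj' : (j : ℝ) + 1 ≤ m := by exact_mod_cast hj
  exact ⟨by positivity, by gcongr; linarith, (div_le_one hm).2 hj'⟩

theorem inner_stepUnit {m i j : ℕ} (hj : j < m) :
    ⟪stepUnit m i, stepUnit m j⟫_ℝ = if i = j then 1 else 0 := by
  have hm : (0 : ℝ) < m := by exact_mod_cast (Nat.zero_le j).trans_lt hj
  obtain ⟨h0, h1, h2⟩ := div_bounds hj
  rw [stepUnit, stepUnit, inner_smul_left, inner_smul_right, inner_stepVec_stepVec h0 h2]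
  simp only [conj_trivial]
  rw [← mul_assoc, Real.mul_self_sqrt hm.le]
  split_ifs with h
  · subst h
    rw [min_self, max_self, max_eq_left (by linarith)]
    field_simp
    ring
  · rw [max_eq_right, mul_zero]
    rcases lt_or_gt_of_ne h with h | h
    · have h3 : ((i : ℝ) + 1) / m ≤ (j : ℝ) / m := by gcongr; exact_mod_cast h
      have := min_le_right (((j : ℝ) + 1) / m) (((i : ℝ) + 1) / m)
      have := le_max_left ((j : ℝ) / m) ((i : ℝ) / m)
      linarith
    · have h3 : ((j : ℝ) + 1) / m ≤ (i : ℝ) / m := by gcongr; exact_mod_cast h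
      have := min_le_left (((j : ℝ) + 1) / m) (((i : ℝ) + 1) / m)
      have := le_max_right ((j : ℝ) / m) ((i : ℝ) / m)
      linarith

theorem hSharp_eq (e : HilbertBasis ℕ ℝ L2I) {β : ℝ} (hα : 1 / 2 < 1 - β) (m : ℕ) (j : Fin m) :
    hSharp e β m j = e.repr (rlOp (1 - β) hα (stepUnit m j)) := by
  obtain ⟨h0, h1, h2⟩ := div_bounds j.isLt
  have h : hSharpCoeff e β m j = e.repr (rlOp (1 - β) hα (stepUnit m j)) := by
    funext n
    rw [e.repr_apply_apply, stepUnit, map_smul, inner_smul_right, hSharpCoeff,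
      ← integral_rlRight_eq_inner hα h0 h1 h2]
    rfl
  have hm : Memℓp (hSharpCoeff e β m j) 2 := by rw [h]; exact lp.memℓp _
  rw [hSharp, ofCoeffs, dif_pos hm]
  exact lp.ext h

/-- The inner product of the indicator of (0, t] with a cell is the length of their overlap: whole
cells below ⌊mt⌋, the fraction mt - ⌊mt⌋ of the next one, nothing beyond. -/
theorem interpWalk_eq {m : ℕ} (hm : 0 < m) (x : ℕ → ℝ) {t : ℝ} (ht : t ∈ Set.Icc (0 : ℝ) 1) :
    interpWalk m x t = rlLeft 1 (∑ j ∈ Finset.range m, x j • stepUnit m j : L2I) t := by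
  have hm0 : (0 : ℝ) < m := by exact_mod_cast hm
  have hs : Real.sqrt m * Real.sqrt m = m := Real.mul_self_sqrt hm0.le
  have hs0 : 0 < Real.sqrt m := Real.sqrt_pos.2 hm0
  have hmt : 0 ≤ (m : ℝ) * t := mul_nonneg hm0.le ht.1
  rw [rlLeft_one_eq_inner ht, inner_sum, interpWalk]
  set k := ⌊(m : ℝ) * t⌋₊ with hk
  have hk1 : (k : ℝ) ≤ m * t := Nat.floor_le hmt
  have hk2 : (m : ℝ) * t < k + 1 := Nat.lt_floor_add_one _
  have hkm : k ≤ m := by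
    have : (k : ℝ) ≤ m := hk1.trans (by nlinarith [ht.2])
    exact_mod_cast this
  have hterm : ∀ j ∈ Finset.range m, ⟪stepVec 0 t, x j • stepUnit m j⟫_ℝ
      = (Real.sqrt m)⁻¹ * (x j * max (min ((j : ℝ) + 1) (m * t) - j) 0) := by
    intro j hj
    obtain ⟨h0, h1, h2⟩ := div_bounds (Finset.mem_range.1 hj)
    rw [inner_smul_right, stepUnit, inner_smul_right, inner_stepVec_stepVec h0 h2,
      max_eq_left h0]
    have : max (min ((j : ℝ) + 1) (m * t) - j) 0
        = m * max (min (((j : ℝ) + 1) / m) t - j / m) 0 := by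
      rw [mul_max_of_nonneg _ _ hm0.le, mul_sub, mul_min_of_nonneg _ _ hm0.le, mul_zero,
        mul_div_cancel₀ _ hm0.ne', mul_div_cancel₀ _ hm0.ne']
    rw [this]
    field_simp
    rw [sq, hs]
  rw [Finset.sum_congr rfl hterm, ← Finset.mul_sum]
  congr 1
  have hfull : ∀ j ∈ Finset.range k, x j * max (min ((j : ℝ) + 1) (m * t) - j) 0 = x j := by
    intro j hj
    have : (j : ℝ) + 1 ≤ k := by exact_mod_cast Finset.mem_range.1 hj
    rw [min_eq_left (by linarith), add_sub_cancel_left, max_eq_left zero_le_one, mul_one]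
  rcases hkm.lt_or_eq with h | h
  · have hsub : Finset.range (k + 1) ⊆ Finset.range m := by
      intro j; simp only [Finset.mem_range]; omega
    rw [← Finset.sum_subset hsub, Finset.sum_range_succ, Finset.sum_congr rfl hfull]
    · rw [min_eq_right hk2.le, max_eq_left (by linarith), mul_comm (x k)]
    · intro j _ hj
      have hj' : (k : ℝ) + 1 ≤ j := by
        have : k + 1 ≤ j := by simpa using hj
        exact_mod_cast this
      rw [max_eq_right, mul_zero]
      have := min_le_right ((j : ℝ) + 1) (m * t)
      linarith
  -- Here t = 1: the index ⌊mt⌋ = m falls outside the range, but its coefficient mt - m vanishes.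
  · have : (m : ℝ) * t = k := by
      refine le_antisymm ?_ hk1
      rw [h]
      nlinarith [ht.2]
    have hr : Finset.range m = Finset.range k := by rw [h]
    rw [hr, Finset.sum_congr rfl hfull, this, sub_self, zero_mul, add_zero]

/-- Since I^1 = I^β I^(1-β), the β-th derivative of a primitive I^1 f is I^(1-β) f. -/
theorem frakJ_rlLeft_one {β : ℝ} (hβ0 : 0 < β) (hα : 1 / 2 < 1 - β) (e : HilbertBasis ℕ ℝ L2I)
    {ω : ℝ → ℝ} {f : L2I} (h : ω =ᵐ[vol01] rlLeft 1 f) :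
    frakJ e β ω = e.repr (rlOp (1 - β) hα f) := by
  refine frakJ_eq hβ0 (by linarith) e (h.trans ?_)
  filter_upwards [ae_restrict_mem measurableSet_Icc] with x hx
  rw [rlLeft_congr (rlOp_coeFn hα f) hx,
    rlLeft_rlLeft hβ0 (by linarith) (by ring) (L2I_integrable f) hx]

theorem frakJ_interpWalk {β : ℝ} (hβ0 : 0 < β) (hβ : β < 1 / 2) (e : HilbertBasis ℕ ℝ L2I)
    {m : ℕ} (hm : 0 < m) (x : ℕ → ℝ) :
    frakJ e β (interpWalk m x) = ∑ j : Fin m, x j • hSharp e β m j := by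
  have hα : 1 / 2 < 1 - β := by linarith
  rw [frakJ_rlLeft_one hβ0 hα e (f := ∑ j ∈ Finset.range m, x j • stepUnit m j) (by
    filter_upwards [ae_restrict_mem measurableSet_Icc] with t ht using interpWalk_eq hm x ht)]
  rw [Finset.sum_range fun j => x j • stepUnit m j]
  simp only [map_sum, map_smul, hSharp_eq e hα]

end DonskerRate

end

/-! ### Size, increments and Hilbert-Schmidt mass of the vectors `hSharp`. -/

noncomputable section

namespace DonskerRate

/-! ### Fractional integrals of indicator functions -/

/-- The fractional integral (up to the factor `Γ(α)`) of the indicator function of `(0, δ]`. -/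
def rlBlock (α δ y : ℝ) : ℝ := ∫ u in Set.Ioc 0 δ, rlKernel α y u

theorem measurable_rlBlock (α δ : ℝ) : Measurable (rlBlock α δ) := by
  have : StronglyMeasurable (fun p : ℝ × ℝ => rlKernel α p.1 p.2) :=
    ((measurable_rlKernel α).comp measurable_swap).stronglyMeasurable
  exact (this.integral_prod_right (ν := volume.restrict (Set.Ioc 0 δ))).measurable

theorem rlBlock_nonneg (α δ y : ℝ) : 0 ≤ rlBlock α δ y :=
  integral_nonneg fun _ => rlKernel_nonneg _ _ _

theorem rlBlock_of_nonpos {α δ y : ℝ} (hy : y ≤ 0) : rlBlock α δ y = 0 := by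
  rw [rlBlock, setIntegral_congr_fun (g := fun _ => (0 : ℝ)) measurableSet_Ioc]
  · simp
  · intro u hu
    simp [rlKernel, not_lt.2 (hy.trans hu.1.le)]

theorem rlBlock_le_const {α δ y : ℝ} (hα : 0 < α) (hy : y ≤ 1) : rlBlock α δ y ≤ 1 / α :=
  (integrableOn_rlKernel' hα le_rfl hy).2

theorem rlBlock_of_le {α δ y : ℝ} (hα : 0 < α) (hy : 0 ≤ y) (hyδ : y ≤ δ) :
    rlBlock α δ y = y ^ α / α := by
  rw [rlBlock, setIntegral_eq_of_subset_of_forall_sdiff_eq_zero measurableSet_Ioc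
      (Set.Ioc_subset_Ioc_right hyδ) (fun t ht => ?_), (integrableOn_rlKernel hα hy).2, sub_zero]
  have : ¬ t < y := fun h => ht.2 ⟨ht.1.1, h.le⟩
  simp [rlKernel, this]

theorem rlBlock_of_ge {α δ y : ℝ} (hα : 0 < α) (hδ : 0 ≤ δ) (hyδ : δ ≤ y) :
    rlBlock α δ y = (y ^ α - (y - δ) ^ α) / α := by
  have h1 := integrableOn_rlKernel hα (hδ.trans hyδ)
  have h2 := integrableOn_rlKernel hα hyδ
  have h3 := setIntegral_union (f := fun u => rlKernel α y u) (μ := volume)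
    (Set.Ioc_disjoint_Ioc_of_le (le_refl δ) : Disjoint (Set.Ioc 0 δ) (Set.Ioc δ y))
    measurableSet_Ioc (h1.1.mono_set (Set.Ioc_subset_Ioc_right hyδ)) h2.1
  rw [Set.Ioc_union_Ioc_eq_Ioc hδ hyδ, h1.2, h2.2, sub_zero] at h3
  rw [rlBlock, eq_sub_of_add_eq h3.symm]
  ring

/-- Beyond δ, monotonicity of t ↦ t^(α-1) gives (y - δ)^α ≥ (y - δ) y^(α-1); below δ only y ≤ δ is
needed. -/
theorem rlBlock_le {α δ y : ℝ} (hα : 0 < α) (hα1 : α ≤ 1) (hδ : 0 ≤ δ) (hy : 0 < y) :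
    rlBlock α δ y ≤ δ / α * y ^ (α - 1) := by
  have hy1 : y ^ α = y * y ^ (α - 1) := by
    rw [Real.rpow_sub_one hy.ne']; field_simp
  have hp : 0 ≤ y ^ (α - 1) := Real.rpow_nonneg hy.le _
  rcases le_total y δ with h | h
  · rw [rlBlock_of_le hα hy.le h, hy1, div_mul_eq_mul_div]
    gcongr
  · rw [rlBlock_of_ge hα hδ h, div_mul_eq_mul_div]
    gcongr
    have h1 : (y - δ) * y ^ (α - 1) ≤ (y - δ) ^ α := by
      rcases h.eq_or_lt with h0 | h0
      · subst h0; simp [Real.zero_rpow hα.ne']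
      · have hp2 : 0 < y - δ := by linarith
        have : (y - δ) ^ α = (y - δ) * (y - δ) ^ (α - 1) := by
          rw [Real.rpow_sub_one hp2.ne']; field_simp
        rw [this]
        exact mul_le_mul_of_nonneg_left
          (Real.rpow_le_rpow_of_nonpos hp2 (by linarith) (by linarith)) hp2.le
    rw [hy1]
    linarith

theorem rlBlock_antitone {α δ y z : ℝ} (hα : 0 < α) (hα1 : α ≤ 1) (hy : δ < y) (hz : y ≤ z)
    (hz1 : z ≤ 1) : rlBlock α δ z ≤ rlBlock α δ y := by
  refine setIntegral_mono_on (integrableOn_rlKernel' hα le_rfl hz1).1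
    (integrableOn_rlKernel' hα le_rfl (hz.trans hz1)).1 measurableSet_Ioc fun u hu => ?_
  have h1 : u < y := hu.2.trans_lt hy
  simp only [rlKernel, h1, h1.trans_le hz, if_true]
  exact Real.rpow_le_rpow_of_nonpos (by linarith) (by linarith) (by linarith)

theorem le_rlBlock {α δ y : ℝ} (hα : 0 < α) (hα1 : α ≤ 1) (hδ : 0 ≤ δ) (hy : δ < y)
    (hy1 : y ≤ 1) : δ * y ^ (α - 1) ≤ rlBlock α δ y := by
  have h : ∫ _ in Set.Ioc 0 δ, y ^ (α - 1) ≤ rlBlock α δ y := by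
    refine setIntegral_mono_on (by simp) (integrableOn_rlKernel' hα le_rfl hy1).1
      measurableSet_Ioc fun u hu => ?_
    have h1 : u < y := hu.2.trans_lt hy
    simp only [rlKernel, h1, if_true]
    exact Real.rpow_le_rpow_of_nonpos (by linarith) (by linarith [hu.1]) (by linarith)
  simpa [hδ] using h

theorem integral_rlKernel_Ioc (α a δ x : ℝ) (hδ : 0 ≤ δ) :
    ∫ t in Set.Ioc a (a + δ), rlKernel α x t = rlBlock α δ (x - a) := by
  rw [rlBlock, ← intervalIntegral.integral_of_le (by linarith),
    ← intervalIntegral.integral_of_le hδ]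
  have := intervalIntegral.integral_comp_add_left (fun t => rlKernel α x t) (a := 0) (b := δ) a
  rw [add_zero] at this
  rw [← this]
  refine intervalIntegral.integral_congr fun u _ => ?_
  simp only [rlKernel, lt_sub_iff_add_lt', sub_sub]

theorem intervalIntegrable_rlBlock_sq {α δ : ℝ} (hα : 0 < α) {c d : ℝ} (hc : c ≤ 1) (hd : d ≤ 1) :
    IntervalIntegrable (fun y => rlBlock α δ y ^ 2) volume c d := by
  refine (intervalIntegrable_const (c := (1 / α) ^ 2)).mono_fun
    ((measurable_rlBlock α δ).pow_const 2).aestronglyMeasurable ?_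
  rw [EventuallyLE, ae_restrict_iff' measurableSet_uIoc]
  refine ae_of_all _ fun y hy => ?_
  have hy1 : y ≤ 1 := hy.2.trans (max_le hc hd)
  rw [Real.norm_of_nonneg (by positivity), Real.norm_of_nonneg (by positivity)]
  have := rlBlock_nonneg α δ y
  gcongr
  exact rlBlock_le_const hα hy1

/-- For fixed α this gives squared norms of order 1/m. The constant explodes as α tends to 1/2, so
the uniform bound on the sum of cubes relies on `integral_rlBlock_sq_le_log` instead. -/
theorem integral_rlBlock_sq_le {α δ : ℝ} (hα : 1 / 2 < α) (hα1 : α ≤ 1) (hδ : 0 ≤ δ) {L : ℝ}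
    (hL : 0 ≤ L) (hL1 : L ≤ 1) :
    ∫ y in (0 : ℝ)..L, rlBlock α δ y ^ 2 ≤ (δ / α) ^ 2 * (L ^ (2 * α - 1) / (2 * α - 1)) := by
  have h1 : IntervalIntegrable (fun y : ℝ => (δ / α) ^ 2 * y ^ (2 * α - 2)) volume 0 L :=
    (intervalIntegral.intervalIntegrable_rpow' (by linarith)).const_mul _
  have h2 : ∫ y in (0 : ℝ)..L, (δ / α) ^ 2 * y ^ (2 * α - 2)
      = (δ / α) ^ 2 * (L ^ (2 * α - 1) / (2 * α - 1)) := by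
    rw [intervalIntegral.integral_const_mul, integral_rpow (Or.inl (by linarith))]
    have : 2 * α - 2 + 1 = 2 * α - 1 := by ring
    rw [this, Real.zero_rpow (by linarith), sub_zero]
  rw [← h2]
  refine intervalIntegral.integral_mono_on_of_le_Ioo hL
    (intervalIntegrable_rlBlock_sq (by linarith) zero_le_one hL1) h1 fun y hy => ?_
  have h3 := rlBlock_le (α := α) (by linarith) hα1 hδ hy.1
  have h4 : y ^ (2 * α - 2) = (y ^ (α - 1)) ^ 2 := by
    rw [← Real.rpow_natCast, ← Real.rpow_mul hy.1.le]
    congr 1; push_cast; ring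
  rw [h4, ← mul_pow]
  exact pow_le_pow_left₀ (rlBlock_nonneg _ _ _) h3 2

/-- The contribution of (0, δ] is discarded; the resulting term δ^(2α-1) is what becomes the main
error in `hilbertSchmidt_sub_le`. -/
theorem le_integral_rlBlock_sq {α δ : ℝ} (hα : 1 / 2 < α) (hα1 : α ≤ 1) (hδ : 0 < δ) {L : ℝ}
    (hL : δ ≤ L) (hL1 : L ≤ 1) :
    δ ^ 2 * ((L ^ (2 * α - 1) - δ ^ (2 * α - 1)) / (2 * α - 1)) ≤
      ∫ y in (0 : ℝ)..L, rlBlock α δ y ^ 2 := by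
  have hα0 : 0 < α := by linarith
  have h1 : IntervalIntegrable (fun y : ℝ => δ ^ 2 * y ^ (2 * α - 2)) volume δ L :=
    (intervalIntegral.intervalIntegrable_rpow' (by linarith)).const_mul _
  have h2 : ∫ y in δ..L, δ ^ 2 * y ^ (2 * α - 2)
      = δ ^ 2 * ((L ^ (2 * α - 1) - δ ^ (2 * α - 1)) / (2 * α - 1)) := by
    rw [intervalIntegral.integral_const_mul, integral_rpow (Or.inl (by linarith))]
    have : 2 * α - 2 + 1 = 2 * α - 1 := by ring
    rw [this]
  have hδ1 := hL.trans hL1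
  rw [← h2, ← intervalIntegral.integral_add_adjacent_intervals
    (intervalIntegrable_rlBlock_sq (c := 0) (d := δ) hα0 zero_le_one hδ1)
    (intervalIntegrable_rlBlock_sq hα0 hδ1 hL1)]
  have h0 : 0 ≤ ∫ y in (0 : ℝ)..δ, rlBlock α δ y ^ 2 :=
    intervalIntegral.integral_nonneg hδ.le fun y _ => by positivity
  refine le_add_of_nonneg_of_le h0 ?_
  refine intervalIntegral.integral_mono_on_of_le_Ioo hL h1
    (intervalIntegrable_rlBlock_sq hα0 hδ1 hL1) fun y hy => ?_
  have hy0 := hδ.trans hy.1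
  have h4 : y ^ (2 * α - 2) = (y ^ (α - 1)) ^ 2 := by
    rw [← Real.rpow_natCast, ← Real.rpow_mul hy0.le]
    congr 1; push_cast; ring
  rw [h4, ← mul_pow]
  exact pow_le_pow_left₀ (by positivity) (le_rlBlock hα0 hα1 hδ.le hy.1 (hy.2.le.trans hL1)) 2

/-- A logarithmic upper bound, uniform in the order of integration. -/
theorem integral_rlBlock_sq_le_log {α δ : ℝ} (hα : 1 / 2 < α) (hα1 : α ≤ 1) (hδ : 0 < δ) {L : ℝ}
    (hL : δ ≤ L) (hL1 : L ≤ 1) :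
    ∫ y in (0 : ℝ)..L, rlBlock α δ y ^ 2 ≤ (δ / α) ^ 2 * (1 / 2 + Real.log (L / δ)) := by
  have hα0 : 0 < α := by linarith
  have hδ1 := hL.trans hL1
  rw [← intervalIntegral.integral_add_adjacent_intervals
    (intervalIntegrable_rlBlock_sq (c := 0) (d := δ) hα0 zero_le_one hδ1)
    (intervalIntegrable_rlBlock_sq hα0 hδ1 hL1), mul_add]
  refine add_le_add ?_ ?_
  · have h1 : IntervalIntegrable (fun y : ℝ => 1 / α ^ 2 * y) volume 0 δ :=
      (continuous_const.mul continuous_id).intervalIntegrable _ _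
    have h2 : ∫ y in (0 : ℝ)..δ, 1 / α ^ 2 * y = (δ / α) ^ 2 * (1 / 2) := by
      rw [intervalIntegral.integral_const_mul, integral_id]
      field_simp
      ring
    rw [← h2]
    refine intervalIntegral.integral_mono_on_of_le_Ioo hδ.le
      (intervalIntegrable_rlBlock_sq hα0 zero_le_one hδ1) h1 fun y hy => ?_
    rw [rlBlock_of_le hα0 hy.1.le hy.2.le, div_pow, div_mul_eq_mul_div, one_mul]
    gcongr
    -- For y ≤ 1, the inequalities 2α ≥ 1 and 2(α - 1) ≥ -1 replace the powers by y below δ and by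
    -- y⁻¹ beyond it, which removes α from the exponents.
    calc (y ^ α) ^ 2 = y ^ (2 * α) := by
          rw [← Real.rpow_natCast, ← Real.rpow_mul hy.1.le]
          congr 1; push_cast; ring
      _ ≤ y ^ (1 : ℝ) :=
          Real.rpow_le_rpow_of_exponent_ge hy.1 (hy.2.le.trans hδ1) (by linarith)
      _ = y := Real.rpow_one y
  · have h1 : IntervalIntegrable (fun y : ℝ => (δ / α) ^ 2 * y⁻¹) volume δ L := by
      refine (intervalIntegral.intervalIntegrable_inv (fun y hy => ?_) continuousOn_id).const_mul _
      rw [Set.uIcc_of_le hL] at hy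
      exact (hδ.trans_le hy.1).ne'
    have h2 : ∫ y in δ..L, (δ / α) ^ 2 * y⁻¹ = (δ / α) ^ 2 * Real.log (L / δ) := by
      rw [intervalIntegral.integral_const_mul, integral_inv_of_pos hδ (hδ.trans_le hL)]
    rw [← h2]
    refine intervalIntegral.integral_mono_on_of_le_Ioo hL
      (intervalIntegrable_rlBlock_sq hα0 hδ1 hL1) h1 fun y hy => ?_
    have hy0 := hδ.trans hy.1
    have h3 := pow_le_pow_left₀ (rlBlock_nonneg _ _ _) (rlBlock_le hα0 hα1 hδ.le hy0) 2
    refine h3.trans ?_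
    rw [mul_pow]
    gcongr
    calc (y ^ (α - 1)) ^ 2 = y ^ (2 * (α - 1)) := by
          rw [← Real.rpow_natCast, ← Real.rpow_mul hy0.le]
          congr 1; push_cast; ring
      _ ≤ y ^ (-1 : ℝ) :=
          Real.rpow_le_rpow_of_exponent_ge hy0 (hy.2.le.trans hL1) (by linarith)
      _ = y⁻¹ := Real.rpow_neg_one y

theorem integral_rlBlock_comp_sub {α δ a : ℝ} (ha : 0 ≤ a) (hα : 0 < α) :
    ∫ x in (0 : ℝ)..1, rlBlock α δ (x - a) ^ 2 = ∫ y in (0 : ℝ)..(1 - a), rlBlock α δ y ^ 2 := by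
  rw [intervalIntegral.integral_comp_sub_right (fun y => rlBlock α δ y ^ 2) a, zero_sub,
    ← intervalIntegral.integral_add_adjacent_intervals (b := 0)
    (intervalIntegrable_rlBlock_sq hα (by linarith) zero_le_one)
    (intervalIntegrable_rlBlock_sq hα zero_le_one (by linarith))]
  rw [intervalIntegral.integral_congr (a := -a) (b := 0) (g := fun _ => (0 : ℝ))]
  · simp
  · intro y hy
    rw [Set.uIcc_of_le (by linarith)] at hy
    simp [rlBlock_of_nonpos hy.2]

/-- The squared distance between two translates is controlled by the mass near the diagonal. -/
theorem integral_rlBlock_sub_sq_le {α δ a d : ℝ} (hα : 1 / 2 < α) (hα1 : α ≤ 1) (hδ : 0 < δ)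
    (ha : 0 ≤ a) (hd : 0 ≤ d) (hb : a + d + δ ≤ 1) :
    ∫ x in (0 : ℝ)..1, (rlBlock α δ (x - a) - rlBlock α δ (x - (a + d))) ^ 2 ≤
      3 * ∫ y in (0 : ℝ)..(d + δ), rlBlock α δ y ^ 2 := by
  have hα0 : 0 < α := by linarith
  set W := rlBlock α δ with hW
  have hI : ∀ {c e : ℝ}, c ≤ 1 → e ≤ 1 → IntervalIntegrable (fun y => W y ^ 2) volume c e :=
    fun hc he => intervalIntegrable_rlBlock_sq hα0 hc he
  have hIs : ∀ {s c e : ℝ}, 0 ≤ s → c ≤ 1 → e ≤ 1 →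
      IntervalIntegrable (fun x => W (x - s) ^ 2) volume c e := by
    intro s c e hs hc he
    have := (hI (c := c - s) (e := e - s) (by linarith) (by linarith)).comp_sub_right s
    simpa using this
  have hshift : ∀ s c e : ℝ, ∫ x in c..e, W (x - s) ^ 2 = ∫ y in (c - s)..(e - s), W y ^ 2 :=
    fun s c e => intervalIntegral.integral_comp_sub_right (fun y => W y ^ 2) s
  have hDm : Measurable fun x => (W (x - a) - W (x - (a + d))) ^ 2 :=
    (((measurable_rlBlock α δ).comp (measurable_id.sub_const _)).sub
      ((measurable_rlBlock α δ).comp (measurable_id.sub_const _))).pow_const 2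
  have hD : ∀ x, (W (x - a) - W (x - (a + d))) ^ 2 ≤ W (x - a) ^ 2 + W (x - (a + d)) ^ 2 := by
    intro x
    have := mul_nonneg (rlBlock_nonneg α δ (x - a)) (rlBlock_nonneg α δ (x - (a + d)))
    nlinarith
  have hDI : ∀ {c e : ℝ}, c ≤ 1 → e ≤ 1 →
      IntervalIntegrable (fun x => (W (x - a) - W (x - (a + d))) ^ 2) volume c e := by
    intro c e hc he
    refine ((hIs ha hc he).add (hIs (s := a + d) (by linarith) hc he)).mono_fun
      hDm.aestronglyMeasurable (ae_of_all _ fun x => ?_)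
    beta_reduce
    rw [Real.norm_of_nonneg (by positivity), Real.norm_of_nonneg (by positivity)]
    exact hD x
  have hb1 : a + d + δ ≤ 1 := hb
  -- The cut is at the end of the second block. Before it the two squares are simply added; after it
  -- both translates are in their decreasing range.
  rw [← intervalIntegral.integral_add_adjacent_intervals (b := a + d + δ)
    (hDI zero_le_one hb1) (hDI hb1 le_rfl)]
  have h1 : ∫ x in (0 : ℝ)..(a + d + δ), (W (x - a) - W (x - (a + d))) ^ 2 ≤
      (∫ y in (0 : ℝ)..(d + δ), W y ^ 2) + ∫ y in (0 : ℝ)..δ, W y ^ 2 := by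
    have hz : ∀ s, 0 ≤ s → ∫ y in (0 - s)..0, W y ^ 2 = 0 := by
      intro s hs
      rw [intervalIntegral.integral_congr (g := fun _ => (0 : ℝ))]
      · simp
      · intro y hy
        rw [Set.uIcc_of_le (by linarith)] at hy
        simp [hW, rlBlock_of_nonpos hy.2]
    have e1 : ∫ x in (0 : ℝ)..(a + d + δ), W (x - a) ^ 2 = ∫ y in (0 : ℝ)..(d + δ), W y ^ 2 := by
      rw [hshift, ← intervalIntegral.integral_add_adjacent_intervals (b := 0)
        (hI (by linarith) zero_le_one) (hI zero_le_one (by linarith)), hz a ha, zero_add]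
      congr 1; ring
    have e2 : ∫ x in (0 : ℝ)..(a + d + δ), W (x - (a + d)) ^ 2 = ∫ y in (0 : ℝ)..δ, W y ^ 2 := by
      rw [hshift, ← intervalIntegral.integral_add_adjacent_intervals (b := 0)
        (hI (by linarith) zero_le_one) (hI zero_le_one (by linarith)), hz (a + d) (by linarith),
        zero_add]
      congr 1; ring
    rw [← e1, ← e2, ← intervalIntegral.integral_add (hIs ha zero_le_one hb1)
      (hIs (by linarith) zero_le_one hb1)]
    exact intervalIntegral.integral_mono_on (by linarith) (hDI zero_le_one hb1)
      ((hIs ha zero_le_one hb1).add (hIs (by linarith) zero_le_one hb1)) fun x _ => hD x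
  have h2 : ∫ x in (a + d + δ)..1, (W (x - a) - W (x - (a + d))) ^ 2 ≤
      ∫ y in δ..(d + δ), W y ^ 2 := by
    -- For 0 ≤ u ≤ v one has (u - v)² ≤ v² - u². After translation the integral of this difference
    -- telescopes to a stretch of length d near the block.
    have hmono : ∫ x in (a + d + δ)..1, (W (x - a) - W (x - (a + d))) ^ 2 ≤
        ∫ x in (a + d + δ)..1, (W (x - (a + d)) ^ 2 - W (x - a) ^ 2) := by
      refine intervalIntegral.integral_mono_on_of_le_Ioo hb1 (hDI hb1 le_rfl)
        ((hIs (by linarith) hb1 le_rfl).sub (hIs ha hb1 le_rfl)) fun x hx => ?_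
      have h3 : W (x - a) ≤ W (x - (a + d)) :=
        rlBlock_antitone hα0 hα1 (by linarith [hx.1]) (by linarith) (by linarith [hx.2])
      have h4 := rlBlock_nonneg α δ (x - a)
      nlinarith
    refine hmono.trans ?_
    rw [intervalIntegral.integral_sub (hIs (by linarith) hb1 le_rfl) (hIs ha hb1 le_rfl),
      hshift, hshift]
    have e3 : a + d + δ - (a + d) = δ := by ring
    have e4 : a + d + δ - a = d + δ := by ring
    rw [e3, e4]
    have h5 := intervalIntegral.integral_add_adjacent_intervals
      (hI (c := δ) (e := d + δ) (by linarith) (by linarith))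
      (hI (c := d + δ) (e := 1 - a) (by linarith) (by linarith))
    have h6 := intervalIntegral.integral_add_adjacent_intervals
      (hI (c := δ) (e := 1 - (a + d)) (by linarith) (by linarith))
      (hI (c := 1 - (a + d)) (e := 1 - a) (by linarith) (by linarith))
    have h7 : 0 ≤ ∫ y in (1 - (a + d))..(1 - a), W y ^ 2 :=
      intervalIntegral.integral_nonneg (by linarith) fun y _ => by positivity
    linarith
  have h8 := intervalIntegral.integral_add_adjacent_intervals
    (hI (c := 0) (e := δ) zero_le_one (by linarith)) (hI (c := δ) (e := d + δ) (by linarith)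
      (by linarith))
  have h9 : 0 ≤ ∫ y in (0 : ℝ)..(d + δ), W y ^ 2 :=
    intervalIntegral.integral_nonneg (by linarith) fun y _ => by positivity
  linarith

/-! ### Estimates for the vectors `H_m^♯(j)` -/

theorem rlLeft_stepUnit {α x : ℝ} (hα : 1 / 2 < α) {m j : ℕ} (hj : j < m)
    (hx : x ∈ Set.Icc (0 : ℝ) 1) :
    rlLeft α (stepUnit m j) x
      = Real.sqrt m * ((Real.Gamma α)⁻¹ * rlBlock α (1 / m) (x - j / m)) := by
  obtain ⟨h0, h1, h2⟩ := div_bounds hj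
  rw [rlLeft_eq_inner hα hx, stepUnit, inner_smul_right, ← rlLeft_eq_inner hα hx,
    rlLeft_stepVec h0 h2 hx, add_div, integral_rlKernel_Ioc _ _ _ _ (by positivity)]

theorem norm_rlOp_stepUnit_sq {α : ℝ} (hα : 1 / 2 < α) {m j : ℕ} (hj : j < m) :
    ‖rlOp α hα (stepUnit m j)‖ ^ 2 =
      m / Real.Gamma α ^ 2 * ∫ y in (0 : ℝ)..(1 - j / m), rlBlock α (1 / m) y ^ 2 := by
  obtain ⟨h0, h1, h2⟩ := div_bounds hj
  rw [norm_rlOp_sq, ← integral_rlBlock_comp_sub h0 (by linarith),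
    intervalIntegral.integral_of_le zero_le_one, ← integral_Icc_eq_integral_Ioc,
    ← integral_const_mul]
  refine setIntegral_congr_fun measurableSet_Icc fun x hx => ?_
  rw [rlLeft_stepUnit hα hj hx, mul_pow, mul_pow, Real.sq_sqrt (Nat.cast_nonneg m)]
  ring

/-- Hölder regularity of j ↦ h_j, with exponent α - 1/2 in (j - i)/m and prefactor of order
m^(-1/2). It is what makes h_j close to the average of its predecessors. -/
theorem norm_rlOp_stepUnit_sub_sq_le {α : ℝ} (hα : 1 / 2 < α) (hα1 : α ≤ 1) {m i j : ℕ}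
    (hij : i < j) (hj : j < m) :
    ‖rlOp α hα (stepUnit m i) - rlOp α hα (stepUnit m j)‖ ^ 2 ≤
      6 / (α ^ 2 * (2 * α - 1) * Real.Gamma α ^ 2) / m *
        (((j : ℝ) - i) / m) ^ (2 * α - 1) := by
  have hm : (0 : ℝ) < m := by exact_mod_cast (Nat.zero_le j).trans_lt hj
  have hG := Real.Gamma_pos_of_pos (show 0 < α by linarith)
  have h2α : 0 < 2 * α - 1 := by linarith
  obtain ⟨h0, h1, h2⟩ := div_bounds hj
  obtain ⟨h0', h1', h2'⟩ := div_bounds (hij.trans hj)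
  have hij' : (i : ℝ) + 1 ≤ j := by exact_mod_cast hij
  set d : ℝ := ((j : ℝ) - i) / m with hd
  have hd1 : 1 / (m : ℝ) ≤ d := by rw [hd]; gcongr; linarith
  have hjd : (j : ℝ) / m = i / m + d := by rw [hd]; ring
  have hδ : (0 : ℝ) < 1 / m := by positivity
  have e1 : ‖rlOp α hα (stepUnit m i) - rlOp α hα (stepUnit m j)‖ ^ 2
      = m / Real.Gamma α ^ 2 * ∫ x in (0 : ℝ)..1,
        (rlBlock α (1 / m) (x - i / m) - rlBlock α (1 / m) (x - (i / m + d))) ^ 2 := by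
    rw [← map_sub, norm_rlOp_sq, intervalIntegral.integral_of_le zero_le_one,
      ← integral_Icc_eq_integral_Ioc, ← integral_const_mul]
    refine setIntegral_congr_fun measurableSet_Icc fun x hx => ?_
    rw [rlLeft_eq_inner hα hx, inner_sub_right, ← rlLeft_eq_inner hα hx,
      ← rlLeft_eq_inner hα hx, rlLeft_stepUnit hα (hij.trans hj) hx, rlLeft_stepUnit hα hj hx,
      ← mul_sub, ← mul_sub, mul_pow, mul_pow, Real.sq_sqrt (Nat.cast_nonneg m), hjd]
    ring
  have hle : i / m + d + 1 / m ≤ (1 : ℝ) := by rw [← hjd, ← add_div]; exact h2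
  have h3 := integral_rlBlock_sub_sq_le hα hα1 hδ h0' (hδ.le.trans hd1) hle
  have h4 := integral_rlBlock_sq_le hα hα1 hδ.le (L := d + 1 / m)
    (by linarith) (by linarith)
  have h5 : (d + 1 / m) ^ (2 * α - 1) ≤ 2 * d ^ (2 * α - 1) := by
    calc (d + 1 / m) ^ (2 * α - 1) ≤ (2 * d) ^ (2 * α - 1) :=
          Real.rpow_le_rpow (by linarith) (by linarith) h2α.le
      _ = 2 ^ (2 * α - 1) * d ^ (2 * α - 1) := Real.mul_rpow (by norm_num) (by linarith)
      _ ≤ 2 ^ (1 : ℝ) * d ^ (2 * α - 1) := by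
          have : 0 ≤ d ^ (2 * α - 1) := Real.rpow_nonneg (by linarith) _
          gcongr
          · norm_num
          · linarith
      _ = _ := by rw [Real.rpow_one]
  rw [e1]
  calc _ ≤ m / Real.Gamma α ^ 2 * (3 * ((1 / m / α) ^ 2 * (2 * d ^ (2 * α - 1) / (2 * α - 1)))) := by
        gcongr
        refine h3.trans ?_
        gcongr
        refine h4.trans ?_
        gcongr
    _ = _ := by
        field_simp
        ring

theorem norm_rlOp_stepUnit_sq_le {α : ℝ} (hα : 1 / 2 < α) (hα1 : α ≤ 1) {m j : ℕ} (hj : j < m) :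
    ‖rlOp α hα (stepUnit m j)‖ ^ 2 ≤ 1 / (α ^ 2 * (2 * α - 1) * Real.Gamma α ^ 2) / m := by
  have hm : (0 : ℝ) < m := by exact_mod_cast (Nat.zero_le j).trans_lt hj
  have hG := Real.Gamma_pos_of_pos (show 0 < α by linarith)
  have h2α : 0 < 2 * α - 1 := by linarith
  obtain ⟨h0, h1, h2⟩ := div_bounds hj
  rw [norm_rlOp_stepUnit_sq hα hj]
  have h4 := integral_rlBlock_sq_le hα hα1 (δ := 1 / m) (by positivity) (L := 1 - j / m)
    (by linarith) (by linarith)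
  have h5 : (1 - (j : ℝ) / m) ^ (2 * α - 1) ≤ 1 :=
    Real.rpow_le_one (by linarith) (by linarith) h2α.le
  calc _ ≤ m / Real.Gamma α ^ 2 * ((1 / m / α) ^ 2 * (1 / (2 * α - 1))) := by
        gcongr
        refine h4.trans ?_
        gcongr
    _ = _ := by
        field_simp

/-- The factor Γ(α + 1) is α Γ(α), absorbed so that the only dependence on α is through a quantity
with a uniform lower bound, `Gamma_ge_of_mem`. -/
theorem norm_rlOp_stepUnit_sq_le_log {α : ℝ} (hα : 1 / 2 < α) (hα1 : α ≤ 1) {m j : ℕ}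
    (hj : j < m) :
    ‖rlOp α hα (stepUnit m j)‖ ^ 2 ≤
      (1 / 2 + Real.log ((m - j : ℕ) : ℝ)) / (Real.Gamma (α + 1) ^ 2 * m) := by
  have hm : (0 : ℝ) < m := by exact_mod_cast (Nat.zero_le j).trans_lt hj
  have hG := Real.Gamma_pos_of_pos (show 0 < α by linarith)
  obtain ⟨h0, h1, h2⟩ := div_bounds hj
  have hL : (1 : ℝ) / m ≤ 1 - j / m := by rw [add_div] at h2; linarith
  rw [norm_rlOp_stepUnit_sq hα hj, Nat.cast_sub hj.le, Real.Gamma_add_one (by linarith)]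
  have h4 := integral_rlBlock_sq_le_log hα hα1 (δ := 1 / m) (by positivity) hL (by linarith)
  have h5 : (1 - (j : ℝ) / m) / (1 / m) = m - j := by field_simp
  rw [h5] at h4
  calc _ ≤ m / Real.Gamma α ^ 2 * ((1 / m / α) ^ 2 * (1 / 2 + Real.log (m - j))) := by
        gcongr
    _ = _ := by
        have : 0 < α := by linarith
        field_simp

theorem sum_rpow_ge {p : ℝ} (hp : 0 ≤ p) (m : ℕ) :
    (m : ℝ) ^ (p + 1) / (p + 1) ≤ ∑ i ∈ Finset.range m, ((i : ℝ) + 1) ^ p := by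
  have h := MonotoneOn.integral_le_sum (x₀ := 0) (a := m) (f := fun x : ℝ => x ^ p)
    (fun x hx y _ hxy => Real.rpow_le_rpow hx.1 hxy hp)
  rw [zero_add, integral_rpow (Or.inl (by linarith)), Real.zero_rpow (by linarith), sub_zero] at h
  simpa using h

/-- The lower bounds for ‖h_j‖² have main terms forming a right-endpoint Riemann sum of the
increasing function x^(2α-1). They therefore add up to at least the full Hilbert-Schmidt norm, and
only the terms with δ^(2α-1) = m^(1-2α) are lost. -/
theorem hilbertSchmidt_sub_le {α : ℝ} (hα : 1 / 2 < α) (hα1 : α ≤ 1) {m : ℕ} (hm : 0 < m) :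
    1 / ((2 * α - 1) * (2 * α) * Real.Gamma α ^ 2)
      - ∑ j ∈ Finset.range m, ‖rlOp α hα (stepUnit m j)‖ ^ 2
      ≤ (m : ℝ) ^ (1 - 2 * α) / ((2 * α - 1) * Real.Gamma α ^ 2) := by
  have hm0 : (0 : ℝ) < m := by exact_mod_cast hm
  have hG := Real.Gamma_pos_of_pos (show 0 < α by linarith)
  have h2α : 0 < 2 * α - 1 := by linarith
  have h1 : ∀ j ∈ Finset.range m,
      1 / ((2 * α - 1) * Real.Gamma α ^ 2 * m) *
        ((m : ℝ) ^ (1 - 2 * α) * ((((m - 1 - j : ℕ) : ℝ) + 1) ^ (2 * α - 1) - 1))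
      ≤ ‖rlOp α hα (stepUnit m j)‖ ^ 2 := by
    intro j hj
    have hj := Finset.mem_range.1 hj
    obtain ⟨h0, h1, h2⟩ := div_bounds hj
    have hL : (1 : ℝ) / m ≤ 1 - j / m := by rw [add_div] at h2; linarith
    have h3 := le_integral_rlBlock_sq hα hα1 (δ := 1 / m) (by positivity) hL (by linarith)
    rw [norm_rlOp_stepUnit_sq hα hj]
    have e1 : ((m - 1 - j : ℕ) : ℝ) + 1 = m - j := by
      have : m - 1 - j + 1 = m - j := by omega
      rw [← Nat.cast_add_one, this, Nat.cast_sub hj.le]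
    have hmj : (0 : ℝ) ≤ m - j := by rw [← e1]; positivity
    have e2 : (1 - (j : ℝ) / m) ^ (2 * α - 1)
        = (m : ℝ) ^ (1 - 2 * α) * ((m : ℝ) - j) ^ (2 * α - 1) := by
      have : 1 - (j : ℝ) / m = (m - j) / m := by field_simp
      rw [this, Real.div_rpow hmj hm0.le, div_eq_mul_inv, ← Real.rpow_neg hm0.le, mul_comm]
      congr 2; ring
    have e3 : (1 / (m : ℝ)) ^ (2 * α - 1) = (m : ℝ) ^ (1 - 2 * α) := by
      rw [one_div, Real.inv_rpow hm0.le, ← Real.rpow_neg hm0.le]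
      congr 1; ring
    rw [e2, e3] at h3
    rw [e1]
    calc _ = m / Real.Gamma α ^ 2 * ((1 / m) ^ 2 *
          (((m : ℝ) ^ (1 - 2 * α) * ((m : ℝ) - j) ^ (2 * α - 1) - (m : ℝ) ^ (1 - 2 * α)) /
            (2 * α - 1))) := by field_simp
      _ ≤ _ := by gcongr
  have h2 := Finset.sum_le_sum h1
  rw [← Finset.mul_sum, ← Finset.mul_sum, Finset.sum_sub_distrib,
    Finset.sum_range_reflect (fun j : ℕ => ((j : ℝ) + 1) ^ (2 * α - 1)) m] at h2
  simp only [Finset.sum_const, Finset.card_range, nsmul_eq_mul, mul_one] at h2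
  have h3 := sum_rpow_ge h2α.le m
  rw [show 2 * α - 1 + 1 = 2 * α by ring] at h3
  have hmp : 0 < (m : ℝ) ^ (1 - 2 * α) := Real.rpow_pos_of_pos hm0 _
  have e4 : (m : ℝ) ^ (1 - 2 * α) * (m : ℝ) ^ (2 * α) = m := by
    rw [← Real.rpow_add hm0]; simp
  have h4 : 1 / ((2 * α - 1) * Real.Gamma α ^ 2 * m) *
      ((m : ℝ) ^ (1 - 2 * α) * ((m : ℝ) ^ (2 * α) / (2 * α) - m)) ≤
      ∑ j ∈ Finset.range m, ‖rlOp α hα (stepUnit m j)‖ ^ 2 := by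
    refine le_trans ?_ h2
    gcongr
  have e5 : 1 / ((2 * α - 1) * Real.Gamma α ^ 2 * m) *
      ((m : ℝ) ^ (1 - 2 * α) * ((m : ℝ) ^ (2 * α) / (2 * α) - m))
      = 1 / ((2 * α - 1) * (2 * α) * Real.Gamma α ^ 2) -
        (m : ℝ) ^ (1 - 2 * α) / ((2 * α - 1) * Real.Gamma α ^ 2) := by
    rw [mul_sub, mul_div_assoc', e4]
    field_simp
  linarith

end DonskerRate

end

noncomputable section

namespace DonskerRate

/-! ### A uniform bound for the sum of cubes -/

/-- A convex function lies above its secants prolonged outside their interval. The secants over [1,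
3/2] and [2, 5/2], prolonged into (3/2, 2), cross slightly above 0.83. -/
theorem Gamma_ge_of_mem {s : ℝ} (h1 : 3 / 2 < s) (h2 : s < 2) : 0.82 ≤ Real.Gamma s := by
  have hc := Real.convexOn_Gamma
  have hmem : ∀ {x : ℝ}, 0 < x → x ∈ Set.Ioi (0 : ℝ) := fun h => h
  have hG : Real.Gamma (3 / 2) = Real.sqrt Real.pi / 2 := by
    rw [show (3 / 2 : ℝ) = 1 / 2 + 1 by norm_num, Real.Gamma_add_one (by norm_num),
      Real.Gamma_one_half_eq]
    ring
  have hG2 : Real.Gamma (5 / 2) = 3 / 2 * (Real.sqrt Real.pi / 2) := by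
    rw [show (5 / 2 : ℝ) = 3 / 2 + 1 by norm_num, Real.Gamma_add_one (by norm_num), hG]
  have hp1 : 1.772 ≤ Real.sqrt Real.pi :=
    Real.le_sqrt_of_sq_le (by nlinarith [Real.pi_gt_d2])
  have hp2 : Real.sqrt Real.pi ≤ 1.775 :=
    Real.sqrt_le_iff.2 ⟨by norm_num, by nlinarith [Real.pi_lt_d2]⟩
  have e1 := hc.slope_mono_adjacent (x := 1) (y := 3 / 2) (z := s) (hmem one_pos)
    (hmem (by linarith)) (by norm_num) h1
  have e2 := hc.slope_mono_adjacent (x := s) (y := 2) (z := 5 / 2) (hmem (by linarith))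
    (hmem (by norm_num)) h2 (by norm_num)
  rw [hG, Real.Gamma_one, le_div_iff₀ (by linarith)] at e1
  rw [hG2, Real.Gamma_two, div_le_iff₀ (by linarith)] at e2
  norm_num at e1 e2
  nlinarith

/-- The maximum of (1/2 + log k)³ / k is 27 e^(-5/2), reached at log k = 5/2. The tangent inequality
y ≤ e^(y-1) with y = (1/2 + log k)/3 gives exactly this, and 27/12.178 is just below 1.489². -/
theorem half_add_log_pow_le {k : ℝ} (hk : 1 ≤ k) : (1 / 2 + Real.log k) ^ 3 ≤ 1.489 ^ 2 * k := by
  have hl := Real.log_nonneg hk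
  set y := (1 / 2 + Real.log k) / 3 with hy
  have h1 : y ≤ Real.exp (y - 1) := by linarith [Real.add_one_le_exp (y - 1)]
  have h2 : y ^ 3 ≤ Real.exp (Real.log k - 5 / 2) := by
    have := pow_le_pow_left₀ (by positivity) h1 3
    rwa [← Real.exp_nat_mul, show ((3 : ℕ) : ℝ) * (y - 1) = Real.log k - 5 / 2 by
      rw [hy]; push_cast; ring] at this
  rw [Real.exp_sub, Real.exp_log (by linarith)] at h2
  have h3 : 12.178 ≤ Real.exp (5 / 2) := by
    refine le_of_sq_le_sq ?_ (Real.exp_pos _).le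
    rw [← Real.exp_nat_mul, show ((2 : ℕ) : ℝ) * (5 / 2) = (5 : ℕ) * 1 by norm_num,
      Real.exp_nat_mul]
    have := pow_le_pow_left₀ (by norm_num) Real.exp_one_gt_d9.le 5
    refine le_trans ?_ this
    norm_num
  have h4 : (1 / 2 + Real.log k) ^ 3 = 27 * y ^ 3 := by rw [hy]; ring
  rw [h4]
  calc 27 * y ^ 3 ≤ 27 * (k / Real.exp (5 / 2)) := by gcongr
    _ ≤ 27 * (k / 12.178) := by gcongr
    _ ≤ _ := by
        rw [mul_div_assoc', div_le_iff₀ (by norm_num)]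
        norm_num
        linarith

/-- The square root is concave, so its trapezoidal sums lie below its integrals; the terms ½√m and
-1/6 are the two half-weights of the endpoints combined with the integral from 1 to m. -/
theorem sum_sqrt_le {m : ℕ} (hm : 1 ≤ m) :
    ∑ i ∈ Finset.range m, Real.sqrt ((i : ℝ) + 1)
      ≤ 2 / 3 * Real.sqrt m ^ 3 + 1 / 2 * Real.sqrt m - 1 / 6 := by
  induction m, hm using Nat.le_induction with
  | base => norm_num
  | succ m hm ih =>
    rw [Finset.sum_range_succ]
    push_cast
    set p := Real.sqrt m
    set q := Real.sqrt ((m : ℝ) + 1)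
    have hp : p ^ 2 = m := Real.sq_sqrt (by positivity)
    have hq : q ^ 2 = m + 1 := Real.sq_sqrt (by positivity)
    have hp0 : 0 ≤ p := Real.sqrt_nonneg _
    have hq0 : 0 ≤ q := Real.sqrt_nonneg _
    have hpq : p < q := Real.sqrt_lt_sqrt (by positivity) (by linarith)
    have h1 : (q - p) * (q + p) = 1 := by ring_nf; linarith
    have h2 : (q ^ 3 - p ^ 3) = (q - p) * (q ^ 2 + p * q + p ^ 2) := by ring
    have h3 : 1 / 2 * (p + q) ≤ 2 / 3 * (q ^ 3 - p ^ 3) := by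
      have : 1 / 2 * (p + q) = (q - p) * (1 / 2 * (p + q) ^ 2) := by
        linear_combination (-(1 / 2) * (p + q)) * h1
      rw [this, h2]
      have : 0 ≤ (q - p) * (q - p) ^ 2 := by
        have : 0 ≤ q - p := by linarith
        positivity
      nlinarith
    linarith

theorem sum_cube_le {m : ℕ} (hm : 1 ≤ m) {g : ℝ} (hg : 0.82 ≤ g) (n : ℕ → ℝ)
    (hn : ∀ j < m, n j ^ 2 ≤ (1 / 2 + Real.log ((m - j : ℕ) : ℝ)) / (g ^ 2 * m)) :
    ∑ j ∈ Finset.range m, n j ^ 3 ≤ 2 := by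
  have hm0 : (0 : ℝ) < m := by exact_mod_cast hm
  have hg0 : 0 < g := by linarith
  set s := Real.sqrt m with hs
  have hs0 : 0 < s := Real.sqrt_pos.2 hm0
  have hs2 : s ^ 2 = m := Real.sq_sqrt hm0.le
  have hs1 : 1 ≤ s := Real.one_le_sqrt.2 (by exact_mod_cast hm)
  -- The term i = 0 corresponds to k = 1, where the cube is only 1/8 and 1.489 - 1.135 = 0.354
  -- already exceeds its square root. Without this correction the total could not be brought below
  -- 2.
  let b : ℕ → ℝ := fun i => 1.489 * Real.sqrt ((i : ℝ) + 1) - if i = 0 then 1.135 else 0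
  have hb0 : ∀ i, 0 ≤ b i := by
    intro i
    by_cases h : i = 0
    · simp [b, h]; norm_num
    · simp only [b, h, if_false, sub_zero]; positivity
  have hlog : ∀ i : ℕ, (1 / 2 + Real.log ((i : ℝ) + 1)) ^ 3 ≤ b i ^ 2 := by
    intro i
    by_cases h : i = 0
    · simp [b, h]; norm_num
    · simp only [b, h, if_false, sub_zero, mul_pow]
      rw [Real.sq_sqrt (by positivity)]
      exact half_add_log_pow_le (by linarith [Nat.cast_nonneg (α := ℝ) i])
  have h1 : ∀ j ∈ Finset.range m, n j ^ 3 ≤ 1 / (g ^ 3 * s ^ 3) * b (m - 1 - j) := by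
    intro j hj
    have hj := Finset.mem_range.1 hj
    have h2 := hn j hj
    have e1 : ((m - j : ℕ) : ℝ) = ((m - 1 - j : ℕ) : ℝ) + 1 := by
      rw [← Nat.cast_add_one]; congr 1; omega
    rw [e1] at h2
    refine le_of_sq_le_sq ?_ (mul_nonneg (by positivity) (hb0 _))
    calc (n j ^ 3) ^ 2 = (n j ^ 2) ^ 3 := by ring
      _ ≤ ((1 / 2 + Real.log (((m - 1 - j : ℕ) : ℝ) + 1)) / (g ^ 2 * m)) ^ 3 := by
          gcongr
      _ = (1 / (g ^ 3 * s ^ 3)) ^ 2 * (1 / 2 + Real.log (((m - 1 - j : ℕ) : ℝ) + 1)) ^ 3 := by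
          rw [← hs2]; field_simp
      _ ≤ _ := by
          rw [mul_pow]
          gcongr
          exact hlog _
  refine (Finset.sum_le_sum h1).trans ?_
  rw [← Finset.mul_sum, Finset.sum_range_reflect b m]
  have h3 : ∑ i ∈ Finset.range m, b i ≤ 1.1 * s ^ 3 := by
    simp only [b]
    rw [Finset.sum_sub_distrib, ← Finset.mul_sum, Finset.sum_ite_eq' (Finset.range m) 0]
    rw [if_pos (Finset.mem_range.2 hm)]
    have := sum_sqrt_le hm
    -- The hint expands to s³ ≥ 6.75 (s - 1), the tangent to the cube at s = 3/2, close to the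
    -- minimum of the cubic to be shown nonnegative.
    nlinarith [mul_nonneg (by linarith : 0 ≤ s + 3) (sq_nonneg (s - 1.5))]
  calc _ ≤ 1 / (g ^ 3 * s ^ 3) * (1.1 * s ^ 3) := by gcongr
    _ = 1.1 / g ^ 3 := by field_simp
    _ ≤ 1.1 / 0.82 ^ 3 := by gcongr
    _ ≤ 2 := by norm_num

theorem sum_norm_rlOp_stepUnit_cube_le {α : ℝ} (hα : 1 / 2 < α) (hα1 : α < 1) {m : ℕ}
    (hm : 1 ≤ m) : ∑ j ∈ Finset.range m, ‖rlOp α hα (stepUnit m j)‖ ^ 3 ≤ 2 :=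
  sum_cube_le hm (Gamma_ge_of_mem (s := α + 1) (by linarith) (by linarith)) _
    fun _ hj => norm_rlOp_stepUnit_sq_le_log hα hα1.le hj

end DonskerRate

end

/-! ### Test functions, and the bounds `Hyp` for Rademacher sums. -/

noncomputable section

namespace DonskerRate

/-! ### The tensor norm dominates the operator norm -/

section TestFunctions

variable {E : Type*} [NormedAddCommGroup E] [NormedSpace ℝ E]

theorem smul_xvec (c : ℝ) (n : ℕ) : c • xvec n = lp.single 2 n c := by
  rw [xvec, ← lp.single_smul, smul_eq_mul, mul_one]

theorem hasSum_smul_xvec (v : EllTwo) : HasSum (fun n => v n • xvec n) v := by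
  simp_rw [smul_xvec]
  exact lp.hasSum_single (by norm_num) v

theorem sum_sq_le_norm_sq (v : EllTwo) (N : ℕ) :
    ∑ n ∈ Finset.range N, v n ^ 2 ≤ ‖v‖ ^ 2 := by
  have h := lp.hasSum_inner (𝕜 := ℝ) v v
  rw [real_inner_self_eq_norm_sq] at h
  have := sum_le_hasSum (Finset.range N) (fun i _ => real_inner_self_nonneg) h
  simpa [sq] using this

/-- Cauchy-Schwarz over multi-indices for vectors with finitely many coordinates, then density and
continuity of the multilinear map. -/
theorem norm_le_hsNorm {j : ℕ} (T : ContinuousMultilinearMap ℝ (fun _ : Fin j => EllTwo) E)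
    (hT : hsNorm T ≠ ⊤) : ‖T‖ ≤ (hsNorm T).toReal := by
  set S : ℝ≥0∞ := ∑' i : Fin j → ℕ, ‖T (fun a => xvec (i a))‖ₑ ^ 2 with hS
  have hhs : hsNorm T = S ^ (1 / 2 : ℝ) := rfl
  have hS' : S ≠ ⊤ := by
    intro h
    rw [hhs, h] at hT
    simp at hT
  have hreal : (hsNorm T).toReal = Real.sqrt S.toReal := by
    rw [hhs, ← ENNReal.toReal_rpow, Real.sqrt_eq_rpow]
  have hfin : ∀ s : Finset (Fin j → ℕ), ∑ i ∈ s, ‖T (fun a => xvec (i a))‖ ^ 2 ≤ S.toReal := by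
    intro s
    have h1 : ∑ i ∈ s, ‖T (fun a => xvec (i a))‖ₑ ^ 2 ≤ S := ENNReal.sum_le_tsum s
    have h2 := ENNReal.toReal_mono hS' h1
    rw [ENNReal.toReal_sum (fun i _ => by simp)] at h2
    simpa using h2
  refine T.opNorm_le_bound ENNReal.toReal_nonneg fun v => ?_
  let w : ℕ → Fin j → EllTwo := fun N a => ∑ n ∈ Finset.range N, v a n • xvec n
  have hw : Tendsto w atTop (𝓝 v) :=
    tendsto_pi_nhds.2 fun a => (hasSum_smul_xvec (v a)).tendsto_sum_nat
  have hlim : Tendsto (fun N => ‖T (w N)‖) atTop (𝓝 ‖T v‖) :=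
    (T.cont.tendsto v).norm.comp hw |>.congr fun _ => rfl
  refine le_of_tendsto hlim (Eventually.of_forall fun N => ?_)
  have hexp : T (w N) = ∑ r ∈ Fintype.piFinset (fun _ : Fin j => Finset.range N),
      (∏ a, v a (r a)) • T (fun a => xvec (r a)) := by
    simp only [w]
    rw [T.map_sum_finset]
    refine Finset.sum_congr rfl fun r _ => ?_
    exact T.map_smul_univ (fun a => v a (r a)) (fun a => xvec (r a))
  rw [hexp]
  refine (norm_sum_le _ _).trans ?_
  simp_rw [norm_smul]
  refine (Real.sum_mul_le_sqrt_mul_sqrt _ _ _).trans ?_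
  rw [mul_comm, hreal]
  have hprod : ∑ r ∈ Fintype.piFinset (fun _ : Fin j => Finset.range N), ‖∏ a, v a (r a)‖ ^ 2
      ≤ (∏ a, ‖v a‖) ^ 2 := by
    have : ∀ r : Fin j → ℕ, ‖∏ a, v a (r a)‖ ^ 2 = ∏ a, v a (r a) ^ 2 := by
      intro r
      rw [norm_prod, ← Finset.prod_pow]
      simp
    simp_rw [this]
    rw [← Finset.prod_univ_sum (fun _ : Fin j => Finset.range N) (fun a n => v a n ^ 2),
      ← Finset.prod_pow]
    exact Finset.prod_le_prod (fun a _ => Finset.sum_nonneg fun n _ => sq_nonneg _)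
      fun a _ => sum_sq_le_norm_sq (v a) N
  exact mul_le_mul (Real.sqrt_le_sqrt (hfin _))
    (Real.sqrt_le_iff.2 ⟨Finset.prod_nonneg fun a _ => norm_nonneg _, hprod⟩)
    (Real.sqrt_nonneg _) (Real.sqrt_nonneg _)

theorem norm_iteratedFDeriv_le {k j : ℕ} {F : EllTwo → E} (hF : IsCb k F) (hj : 1 ≤ j)
    (hjk : j ≤ k) (x : EllTwo) : ‖iteratedFDeriv ℝ j F x‖ ≤ (supDeriv j F).toReal := by
  have h1 : supDeriv j F ≤ cbNorm k F :=
    le_iSup₂ (f := fun j (_ : j ∈ Finset.Icc 1 k) => supDeriv j F) j (Finset.mem_Icc.2 ⟨hj, hjk⟩)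
  have h2 : supDeriv j F ≠ ⊤ := (h1.trans_lt hF.2).ne
  have h3 : hsNorm (iteratedFDeriv ℝ j F x) ≤ supDeriv j F :=
    le_iSup (fun x => hsNorm (iteratedFDeriv ℝ j F x)) x
  exact (norm_le_hsNorm _ (ne_top_of_le_ne_top h2 h3)).trans (ENNReal.toReal_mono h2 h3)

theorem differentiable_of_isCb {k : ℕ} {F : EllTwo → E}
    (h : ∀ j < k + 1, Differentiable ℝ (iteratedFDeriv ℝ j F)) : Differentiable ℝ F := by
  have h0 := h 0 (Nat.succ_pos k)
  rw [iteratedFDeriv_zero_eq_comp] at h0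
  exact (LinearIsometryEquiv.comp_differentiable_iff _).1 h0

theorem differentiable_iteratedFDeriv_fderiv {k : ℕ} {F : EllTwo → E}
    (h : ∀ j < k + 1, Differentiable ℝ (iteratedFDeriv ℝ j F)) :
    ∀ j < k, Differentiable ℝ (iteratedFDeriv ℝ j (fderiv ℝ F)) := by
  intro j hj
  have h0 := h (j + 1) (by omega)
  have he : iteratedFDeriv ℝ (j + 1) F = (continuousMultilinearCurryRightEquiv' ℝ j EllTwo E).symm ∘
      iteratedFDeriv ℝ j (fderiv ℝ F) := funext fun x => iteratedFDeriv_succ_eq_comp_right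
  rw [he] at h0
  exact (LinearIsometryEquiv.comp_differentiable_iff _).1 h0

theorem norm_sub_le_of_fderiv_le {E₁ : Type*} [NormedAddCommGroup E₁] [NormedSpace ℝ E₁]
    {f : EllTwo → E₁} (hf : Differentiable ℝ f) {C : ℝ} (hC : ∀ x, ‖fderiv ℝ f x‖ ≤ C)
    (x y : EllTwo) : ‖f x - f y‖ ≤ C * ‖x - y‖ :=
  Convex.norm_image_sub_le_of_norm_fderiv_le (𝕜 := ℝ) (fun z _ => hf z) (fun z _ => hC z)
    convex_univ (Set.mem_univ y) (Set.mem_univ x)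

theorem norm_fderiv_eq (F : EllTwo → E) (x : EllTwo) :
    ‖fderiv ℝ F x‖ = ‖iteratedFDeriv ℝ 1 F x‖ := by
  rw [← norm_iteratedFDeriv_fderiv, norm_iteratedFDeriv_zero]

theorem norm_fderiv_fderiv_eq (F : EllTwo → E) (x : EllTwo) :
    ‖fderiv ℝ (fderiv ℝ F) x‖ = ‖iteratedFDeriv ℝ 2 F x‖ := by
  rw [norm_fderiv_eq, norm_iteratedFDeriv_fderiv]

/-- The properties of functions of class `𝒞²_b` used below. -/
theorem IsCb.two {G : EllTwo → E} (hG : IsCb 2 G) :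
    Differentiable ℝ G ∧ Differentiable ℝ (fderiv ℝ G) ∧
      (∀ x, ‖fderiv ℝ G x‖ ≤ (supDeriv 1 G).toReal) ∧
      ∀ x y, ‖fderiv ℝ G x - fderiv ℝ G y‖ ≤ (supDeriv 2 G).toReal * ‖x - y‖ := by
  have h1 := differentiable_of_isCb (k := 1) hG.1
  have h2 := differentiable_of_isCb (k := 0) (differentiable_iteratedFDeriv_fderiv (k := 1) hG.1)
  refine ⟨h1, h2, fun x => ?_, norm_sub_le_of_fderiv_le h2 fun x => ?_⟩
  · rw [norm_fderiv_eq]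
    exact norm_iteratedFDeriv_le hG le_rfl (by norm_num) x
  · rw [norm_fderiv_fderiv_eq]
    exact norm_iteratedFDeriv_le hG (by norm_num) le_rfl x

/-- Twice differentiable functions whose first two derivatives are bounded by `1` and whose second
derivative is `1`-Lipschitz. -/
def IsTest (F : EllTwo → ℝ) : Prop :=
  ∃ (F' : EllTwo → EllTwo →L[ℝ] ℝ) (F'' : EllTwo → EllTwo →L[ℝ] EllTwo →L[ℝ] ℝ),
    (∀ x, HasFDerivAt F (F' x) x) ∧ (∀ x, HasFDerivAt F' (F'' x) x) ∧ (∀ x, ‖F' x‖ ≤ 1) ∧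
      (∀ x, ‖F'' x‖ ≤ 1) ∧ ∀ x y, ‖F'' x - F'' y‖ ≤ ‖x - y‖

theorem IsCb.isTest {F : EllTwo → ℝ} (hF : IsCb 3 F) (hF1 : cbNorm 3 F ≤ 1) : IsTest F := by
  have hb : ∀ j, 1 ≤ j → j ≤ 3 → ∀ x, ‖iteratedFDeriv ℝ j F x‖ ≤ 1 := by
    intro j h1 h3 x
    refine (norm_iteratedFDeriv_le hF h1 h3 x).trans ?_
    have h : supDeriv j F ≤ cbNorm 3 F :=
      le_iSup₂ (f := fun j (_ : j ∈ Finset.Icc 1 3) => supDeriv j F) j (Finset.mem_Icc.2 ⟨h1, h3⟩)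
    simpa using ENNReal.toReal_mono ENNReal.one_ne_top (h.trans hF1)
  have d1 := differentiable_iteratedFDeriv_fderiv (k := 2) hF.1
  have d2 := differentiable_iteratedFDeriv_fderiv (k := 1) d1
  refine ⟨fderiv ℝ F, fderiv ℝ (fderiv ℝ F),
    fun x => (differentiable_of_isCb (k := 2) hF.1 x).hasFDerivAt,
    fun x => (differentiable_of_isCb (k := 1) d1 x).hasFDerivAt, fun x => ?_, fun x => ?_,
    fun x y => ?_⟩
  · rw [norm_fderiv_eq]; exact hb 1 le_rfl (by norm_num) x
  · rw [norm_fderiv_fderiv_eq]; exact hb 2 (by norm_num) (by norm_num) x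
  · have := norm_sub_le_of_fderiv_le (differentiable_of_isCb (k := 0) d2) (C := 1) (fun x => ?_) x y
    · simpa using this
    · rw [norm_fderiv_fderiv_eq, norm_iteratedFDeriv_fderiv]
      exact hb 3 (by norm_num) le_rfl x

end TestFunctions

end DonskerRate

end

noncomputable section

namespace DonskerRate

/-! ### Rademacher sums -/

/-- The uniform distribution on `{-1, 1}`. -/
def rad : Measure ℝ := (1 / 2 : ℝ≥0∞) • Measure.dirac 1 + (1 / 2 : ℝ≥0∞) • Measure.dirac (-1)

instance : IsProbabilityMeasure rad := ⟨by simp [rad, ENNReal.inv_two_add_inv_two]⟩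

theorem ae_rad : ∀ᵐ x ∂rad, x = 1 ∨ x = -1 := by
  rw [rad, ae_add_measure_iff]
  constructor <;> refine Measure.ae_smul_measure ?_ _ <;> rw [ae_dirac_eq] <;> simp

theorem integral_rad {E : Type*} [NormedAddCommGroup E] [NormedSpace ℝ E] [CompleteSpace E]
    (f : ℝ → E) : ∫ x, f x ∂rad = (1 / 2 : ℝ) • f 1 + (1 / 2 : ℝ) • f (-1) := by
  have hi : ∀ c : ℝ, Integrable f ((1 / 2 : ℝ≥0∞) • Measure.dirac c) := fun c =>
    (integrable_dirac (by simp)).smul_measure (by simp)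
  rw [rad, integral_add_measure (hi _) (hi _), integral_smul_measure, integral_smul_measure,
    integral_dirac, integral_dirac]
  simp

theorem measurePreserving_neg_rad : MeasurePreserving (fun x : ℝ => -x) rad rad := by
  refine ⟨measurable_neg, ?_⟩
  have hd : ∀ c : ℝ, Measure.map (fun x : ℝ => -x) (Measure.dirac c) = Measure.dirac (-c) :=
    fun c => Measure.map_dirac' measurable_neg c
  rw [rad, Measure.map_add _ _ measurable_neg, Measure.map_smul, Measure.map_smul, hd, hd,
    neg_neg, add_comm]

theorem map_eq_rad {Ω : Type*} [MeasurableSpace Ω] {P : Measure Ω} [IsProbabilityMeasure P]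
    {X : Ω → ℝ} (hX : Measurable X) (h1 : P {w | X w = 1} = 1 / 2)
    (h2 : P {w | X w = -1} = 1 / 2) : P.map X = rad := by
  have hA : MeasurableSet {w | X w = 1} := hX (measurableSet_singleton 1)
  have hB : MeasurableSet {w | X w = -1} := hX (measurableSet_singleton (-1))
  have hd : Disjoint {w | X w = 1} {w | X w = -1} := by
    rw [Set.disjoint_left]
    intro w hw hw'
    simp only [Set.mem_ofPred_eq] at hw hw'
    linarith
  have hu : P ({w | X w = 1} ∪ {w | X w = -1}) = 1 := by
    rw [measure_union hd hB, h1, h2, ENNReal.add_halves]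
  have hae : ∀ᵐ w ∂P, w ∈ {w | X w = 1} ∪ {w | X w = -1} :=
    (prob_compl_eq_zero_iff (hA.union hB)).2 hu
  ext s hs
  rw [Measure.map_apply hX hs]
  have h3 : P (X ⁻¹' s) = P (X ⁻¹' s ∩ {w | X w = 1}) + P (X ⁻¹' s ∩ {w | X w = -1}) := by
    rw [← measure_union (hd.mono Set.inter_subset_right Set.inter_subset_right)
      ((hX hs).inter hB), ← Set.inter_union_distrib_left]
    refine measure_congr ?_
    filter_upwards [hae] with w hw
    exact propext ⟨fun h => ⟨h, hw⟩, fun h => h.1⟩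
  have h4 : ∀ c : ℝ, P {w | X w = c} = 1 / 2 →
      P (X ⁻¹' s ∩ {w | X w = c}) = 1 / 2 * s.indicator 1 c := by
    intro c hc
    by_cases h : c ∈ s
    · have : X ⁻¹' s ∩ {w | X w = c} = {w | X w = c} := by
        refine Set.inter_eq_right.2 fun w hw => ?_
        rw [Set.mem_ofPred_eq] at hw
        rwa [Set.mem_preimage, hw]
      rw [this, hc]; simp [h]
    · have : X ⁻¹' s ∩ {w | X w = c} = ∅ := by
        ext w
        simp only [Set.mem_inter_iff, Set.mem_preimage, Set.mem_ofPred_eq, Set.mem_empty_iff_false,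
          iff_false, not_and]
        rintro hw rfl
        exact h hw
      rw [this]; simp [h]
  rw [h3, h4 1 h1, h4 (-1) h2, rad]
  simp [Measure.dirac_apply' _ hs]

/-- The linear combination of the first `m` vectors of a sequence. -/
def sumVec (h : ℕ → EllTwo) (m : ℕ) (y : Fin m → ℝ) : EllTwo := ∑ i, y i • h i

theorem continuous_sumVec (h : ℕ → EllTwo) (m : ℕ) : Continuous (sumVec h m) :=
  continuous_finsetSum _ fun i _ => (continuous_apply i).smul continuous_const

theorem measurable_sumVec (h : ℕ → EllTwo) (m : ℕ) : Measurable (sumVec h m) :=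
  (continuous_sumVec h m).measurable

theorem ae_pi_rad (m : ℕ) : ∀ᵐ y ∂(Measure.pi fun _ : Fin m => rad), ∀ i, y i = 1 ∨ y i = -1 :=
  ae_all_iff.2 fun i =>
    (measurePreserving_eval (fun _ : Fin m => rad) i).quasiMeasurePreserving.ae ae_rad

theorem integrable_pi_rad {E : Type*} [NormedAddCommGroup E] [SecondCountableTopology E] {m : ℕ}
    {f : (Fin m → ℝ) → E} (hf : Continuous f) : Integrable f (Measure.pi fun _ : Fin m => rad) := by
  obtain ⟨C, hC⟩ := (isCompact_closedBall (0 : Fin m → ℝ) 1).exists_bound_of_continuousOn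
    hf.continuousOn
  refine Integrable.of_bound hf.aestronglyMeasurable C ?_
  filter_upwards [ae_pi_rad m] with y hy
  refine hC y ?_
  rw [mem_closedBall_zero_iff, pi_norm_le_iff_of_nonneg zero_le_one]
  intro i
  rcases hy i with h | h <;> simp [h]

/-- This is the trapezoidal rule for f' on [-1, 1]. Splitting at 0 and comparing each half with its
own endpoint costs L/2 twice, and needs only that f' is Lipschitz. -/
theorem trapezoid_bound {f f' : ℝ → ℝ} {L : ℝ} (hL : 0 ≤ L) (hf : ∀ t, HasDerivAt f (f' t) t)
    (hf' : ∀ s t, |f' s - f' t| ≤ L * |s - t|) :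
    |f 1 - f (-1) - f' 1 - f' (-1)| ≤ L := by
  have hc : Continuous f' :=
    (LipschitzWith.of_dist_le_mul (K := L.toNNReal) fun s t => by
      simpa [Real.dist_eq, Real.coe_toNNReal _ hL] using hf' s t).continuous
  have hI : ∀ a b c : ℝ, ∫ t in a..b, (f' t - c) = f b - f a - c * (b - a) := by
    intro a b c
    rw [intervalIntegral.integral_sub (hc.intervalIntegrable _ _) intervalIntegrable_const,
      intervalIntegral.integral_eq_sub_of_hasDerivAt (fun t _ => hf t) (hc.intervalIntegrable _ _)]
    simp [mul_comm]
  have h1 : |f 1 - f 0 - f' 1| ≤ L / 2 := by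
    have := intervalIntegral.norm_integral_le_of_norm_le (μ := volume) (a := 0) (b := 1)
      (f := fun t => f' t - f' 1) (g := fun t => L * (1 - t)) zero_le_one
      (ae_of_all _ fun t ht => by
        have := hf' t 1
        rwa [abs_sub_comm t 1, abs_of_nonneg (by linarith [ht.2] : 0 ≤ 1 - t)] at this)
      ((continuous_const.mul (continuous_const.sub continuous_id)).intervalIntegrable _ _)
    rw [hI, intervalIntegral.integral_const_mul, intervalIntegral.integral_sub
      intervalIntegrable_const intervalIntegral.intervalIntegrable_id, integral_id] at this
    norm_num at this
    linarith
  have h2 : |f 0 - f (-1) - f' (-1)| ≤ L / 2 := by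
    have := intervalIntegral.norm_integral_le_of_norm_le (μ := volume) (a := -1) (b := 0)
      (f := fun t => f' t - f' (-1)) (g := fun t => L * (t + 1)) (by norm_num)
      (ae_of_all _ fun t ht => by
        have := hf' t (-1)
        rwa [abs_of_nonneg (by linarith [ht.1] : 0 ≤ t - -1), sub_neg_eq_add] at this)
      ((continuous_const.mul (continuous_id.add continuous_const)).intervalIntegrable _ _)
    rw [hI, intervalIntegral.integral_const_mul, intervalIntegral.integral_add
      intervalIntegral.intervalIntegrable_id intervalIntegrable_const, integral_id] at this
    norm_num at this
    linarith
  calc _ = |(f 1 - f 0 - f' 1) + (f 0 - f (-1) - f' (-1))| := by congr 1; ring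
    _ ≤ L / 2 + L / 2 := (abs_add_le _ _).trans (add_le_add h1 h2)
    _ = L := by ring

/-! ### The hypothesis `Hyp` for Rademacher sums -/

theorem inner_xvec_left (n : ℕ) (v : EllTwo) : ⟪xvec n, v⟫_ℝ = v n := by
  rw [xvec, lp.inner_single_left]
  simp

theorem inner_xvec_xvec (i j : ℕ) : ⟪xvec i, xvec j⟫_ℝ = if i = j then 1 else 0 := by
  rw [inner_xvec_left, xvec, lp.single_apply, Pi.single_apply]

/-- The operator `∑_j x_j ⊗ h_j`. -/
def tensorOp (h : ℕ → EllTwo) (m : ℕ) : EllTwo →L[ℝ] EllTwo :=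
  ∑ j : Fin m, (innerSL ℝ (xvec j)).smulRight (h j)

theorem tensorOp_apply (h : ℕ → EllTwo) (m : ℕ) (v : EllTwo) :
    tensorOp h m v = ∑ j : Fin m, ⟪xvec j, v⟫_ℝ • h j := by
  simp [tensorOp]

theorem adjoint_tensorOp_apply (h : ℕ → EllTwo) (m : ℕ) (u : EllTwo) :
    ContinuousLinearMap.adjoint (tensorOp h m) u = ∑ j : Fin m, ⟪h j, u⟫_ℝ • xvec j := by
  refine ext_inner_right ℝ fun v => ?_
  rw [ContinuousLinearMap.adjoint_inner_left, tensorOp_apply, inner_sum, sum_inner]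
  refine Finset.sum_congr rfl fun j _ => ?_
  rw [inner_smul_right, inner_smul_left, conj_trivial, real_inner_comm (h j) u, mul_comm]

theorem partialTrace_tensorOp_apply (h : ℕ → EllTwo) (m : ℕ) (u : EllTwo) :
    partialTrace (tensorOp h m) u = ∑ j : Fin m, ⟪h j, u⟫_ℝ • h j := by
  rw [partialTrace, ContinuousLinearMap.comp_apply, adjoint_tensorOp_apply, tensorOp_apply]
  refine Finset.sum_congr rfl fun j _ => ?_
  congr 1
  rw [inner_sum, Finset.sum_eq_single j]
  · rw [inner_smul_right, inner_xvec_xvec, if_pos rfl, mul_one]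
  · intro i _ hi
    rw [inner_smul_right, inner_xvec_xvec, if_neg (fun h => hi (Fin.ext h.symm)), mul_zero]
  · simp

/-- Summing over the canonical basis reassembles each h j inside T, by continuity of T. -/
theorem opTrace_partialTrace (h : ℕ → EllTwo) (m : ℕ) (T : EllTwo →L[ℝ] EllTwo) :
    opTrace (partialTrace (tensorOp h m) ∘L T) = ∑ j : Fin m, ⟪h j, T (h j)⟫_ℝ := by
  refine HasSum.tsum_eq ?_
  have h1 : ∀ n, ⟪(partialTrace (tensorOp h m) ∘L T) (xvec n), xvec n⟫_ℝ
      = ∑ j : Fin m, ⟪h j, T ((h j) n • xvec n)⟫_ℝ := by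
    intro n
    rw [ContinuousLinearMap.comp_apply, partialTrace_tensorOp_apply, sum_inner]
    refine Finset.sum_congr rfl fun j _ => ?_
    rw [inner_smul_left, conj_trivial, real_inner_comm (xvec n) (h j), inner_xvec_left, map_smul,
      inner_smul_right, mul_comm]
  simp_rw [h1]
  refine hasSum_sum fun j _ => ?_
  exact (hasSum_smul_xvec (h j)).mapL ((innerSL ℝ (h j)) ∘L T)

theorem summable_adjoint_tensorOp (h : ℕ → EllTwo) (m : ℕ) :
    Summable fun n : ℕ => ‖ContinuousLinearMap.adjoint (tensorOp h m) (xvec n)‖ ^ 2 := by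
  have h1 : ∀ n, ‖ContinuousLinearMap.adjoint (tensorOp h m) (xvec n)‖ ^ 2
      = ∑ j : Fin m, ⟪h j n, h j n⟫_ℝ := by
    intro n
    rw [← real_inner_self_eq_norm_sq, ContinuousLinearMap.adjoint_inner_left,
      ← ContinuousLinearMap.comp_apply, ← partialTrace, partialTrace_tensorOp_apply, inner_sum]
    refine Finset.sum_congr rfl fun j _ => ?_
    rw [inner_smul_right, real_inner_comm, inner_xvec_left]
    simp [sq]
  simp_rw [h1]
  exact summable_sum fun j _ => lp.summable_inner (h j) (h j)

/-- Flipping one sign preserves the product law, so the integral of φ is half that of φ plus its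
flip. -/
theorem abs_integral_flip_le {m : ℕ} {φ : (Fin m → ℝ) → ℝ} (hφ : Continuous φ) (j : Fin m) {C : ℝ}
    (hC : ∀ y : Fin m → ℝ, (y j = 1 ∨ y j = -1) →
      |φ y + φ (Function.update y j (-y j))| ≤ C) :
    |∫ y, φ y ∂(Measure.pi fun _ : Fin m => rad)| ≤ C / 2 := by
  set μ := Measure.pi fun _ : Fin m => rad with hμ
  have hcont : Continuous fun y : Fin m → ℝ => Function.update y j (-y j) :=
    continuous_id.update j (continuous_apply j).neg
  have hmp : MeasurePreserving (fun y : Fin m → ℝ => Function.update y j (-y j)) μ μ := by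
    have := measurePreserving_pi (fun _ : Fin m => rad) (fun _ => rad)
      (f := fun i => if i = j then fun x => -x else id) (fun i => by
        by_cases h : i = j
        · simpa [h] using measurePreserving_neg_rad
        · simpa [h] using MeasurePreserving.id rad)
    convert! this using 1
    funext y i
    by_cases h : i = j
    · subst h; simp
    · simp [h]
  have h1 : ∫ y, φ (Function.update y j (-y j)) ∂μ = ∫ y, φ y ∂μ := by
    rw [← hmp.map_eq, integral_map hmp.measurable.aemeasurable hφ.aestronglyMeasurable,
      hmp.map_eq]
  have h2 : ∫ y, φ y ∂μ = (∫ y, (φ y + φ (Function.update y j (-y j))) ∂μ) / 2 := by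
    rw [integral_add (integrable_pi_rad hφ) (integrable_pi_rad
      (f := fun y => φ (Function.update y j (-y j))) (hφ.comp hcont)), h1]
    ring
  rw [h2, abs_div, abs_two]
  gcongr
  have h3 := norm_integral_le_of_norm_le_const (μ := μ) (C := C)
    (f := fun y => φ y + φ (Function.update y j (-y j))) (by
      filter_upwards [ae_pi_rad m] with y hy using hC y (hy j))
  simpa using h3

theorem sumVec_update (h : ℕ → EllTwo) (m : ℕ) (y : Fin m → ℝ) (j : Fin m) (x : ℝ) :
    sumVec h m (Function.update y j x) = sumVec h m y + (x - y j) • h j := by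
  rw [sumVec, sumVec, ← Finset.add_sum_erase _ _ (Finset.mem_univ j),
    ← Finset.add_sum_erase _ _ (Finset.mem_univ j), Function.update_self, sub_smul,
    Finset.sum_congr rfl (g := fun i : Fin m => y i • h i)]
  · abel
  · intro i hi
    rw [Function.update_of_ne (Finset.ne_of_mem_erase hi)]

theorem hyp_map_sumVec (h : ℕ → EllTwo) (m : ℕ) {α : ℝ}
    (hα : (∑ j : Fin m, ‖h j‖ ^ 3) / 2 ≤ α) :
    Hyp (tensorOp h m) α ((Measure.pi fun _ : Fin m => rad).map (sumVec h m)) := by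
  have hS := continuous_sumVec h m
  have hSm := (measurable_sumVec h m).aemeasurable (μ := Measure.pi fun _ : Fin m => rad)
  refine ⟨summable_adjoint_tensorOp h m, Measure.isProbabilityMeasure_map hSm, fun G hG => ?_⟩
  obtain ⟨hG1, hG2, -, hG3⟩ := hG.two
  set M := (supDeriv 2 G).toReal
  have hM : 0 ≤ M := ENNReal.toReal_nonneg
  have hDc : Continuous (fderiv ℝ G) := hG2.continuous
  have hc1 : Continuous fun x : EllTwo => ⟪x, G x⟫_ℝ := continuous_id.inner hG1.continuous
  have hc2' : ∀ j : Fin m, Continuous fun x : EllTwo => ⟪h j, fderiv ℝ G x (h j)⟫_ℝ := fun j =>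
    continuous_const.inner (hDc.clm_apply continuous_const)
  simp_rw [opTrace_partialTrace]
  have hc2 : Continuous fun x : EllTwo => ∑ j : Fin m, ⟪h j, fderiv ℝ G x (h j)⟫_ℝ :=
    continuous_finsetSum _ fun j _ => hc2' j
  refine ⟨(integrable_map_measure hc1.aestronglyMeasurable hSm).2 (integrable_pi_rad (hc1.comp hS)),
    (integrable_map_measure hc2.aestronglyMeasurable hSm).2 (integrable_pi_rad (hc2.comp hS)), ?_⟩
  rw [integral_map hSm hc1.aestronglyMeasurable, integral_map hSm hc2.aestronglyMeasurable,
    ← integral_sub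
      (integrable_pi_rad (f := fun y => ⟪sumVec h m y, G (sumVec h m y)⟫_ℝ) (hc1.comp hS))
      (integrable_pi_rad (f := fun y => ∑ j : Fin m,
        ⟪h j, fderiv ℝ G (sumVec h m y) (h j)⟫_ℝ) (hc2.comp hS))]
  let φ : Fin m → (Fin m → ℝ) → ℝ := fun j y =>
    y j * ⟪h j, G (sumVec h m y)⟫_ℝ - ⟪h j, fderiv ℝ G (sumVec h m y) (h j)⟫_ℝ
  have hφc : ∀ j, Continuous (φ j) := fun j =>
    ((continuous_apply j).mul (continuous_const.inner (hG1.continuous.comp hS))).sub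
      ((hc2' j).comp hS)
  have hsum : ∀ y, ⟪sumVec h m y, G (sumVec h m y)⟫_ℝ
      - ∑ j : Fin m, ⟪h j, fderiv ℝ G (sumVec h m y) (h j)⟫_ℝ = ∑ j, φ j y := by
    intro y
    simp only [φ]
    rw [Finset.sum_sub_distrib]
    congr 1
    conv_lhs => rw [sumVec, sum_inner]
    refine Finset.sum_congr rfl fun j _ => ?_
    rw [inner_smul_left]; rfl
  simp_rw [hsum]
  rw [integral_finsetSum _ fun j _ => integrable_pi_rad (hφc j)]
  have hj : ∀ j, |∫ y, φ j y ∂(Measure.pi fun _ : Fin m => rad)| ≤ ‖h j‖ ^ 3 * M / 2 := by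
    intro j
    refine abs_integral_flip_le (hφc j) j fun y hy => ?_
    set ε := y j with hε
    have hε2 : ε * ε = 1 := by rcases hy with h | h <;> rw [h] <;> norm_num
    have hεa : |ε| = 1 := by rcases hy with h | h <;> rw [h] <;> norm_num
    -- The vector u is the sum without its j-th term. On the line below, t = 1 is the actual sign
    -- and t = -1 the flipped one; the factor ε in f cancels the ε of the chain rule since ε² = 1.
    set u := sumVec h m y - ε • h j with hu
    let f : ℝ → ℝ := fun t => ε * ⟪h j, G (u + (t * ε) • h j)⟫_ℝ
    let f' : ℝ → ℝ := fun t => ⟪h j, fderiv ℝ G (u + (t * ε) • h j) (h j)⟫_ℝ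
    have hf : ∀ t, HasDerivAt f (f' t) t := by
      intro t
      have h1 : HasDerivAt (fun t : ℝ => u + (t * ε) • h j) (ε • h j) t := by
        have := (((hasDerivAt_id t).mul_const ε).smul_const (h j)).const_add u
        simpa using this
      have h2 := (hG1 (u + (t * ε) • h j)).hasFDerivAt.comp_hasDerivAt t h1
      have h3 := ((innerSL ℝ (h j)).hasFDerivAt.comp_hasDerivAt t h2).const_mul ε
      convert! h3 using 1
      simp only [f', map_smul, innerSL_apply_apply, smul_eq_mul]
      rw [← mul_assoc, hε2, one_mul]
    have hf' : ∀ s t, |f' s - f' t| ≤ ‖h j‖ ^ 3 * M * |s - t| := by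
      intro s t
      simp only [f']
      rw [← inner_sub_right, ← _root_.sub_apply]
      refine (abs_real_inner_le_norm _ _).trans ?_
      calc _ ≤ ‖h j‖ * (M * ‖(u + (s * ε) • h j) - (u + (t * ε) • h j)‖ * ‖h j‖) := by
            gcongr
            exact (ContinuousLinearMap.le_opNorm _ _).trans (by gcongr; exact hG3 _ _)
        _ = _ := by
            rw [add_sub_add_left_eq_sub, ← sub_smul, ← sub_mul, norm_smul, norm_mul,
              Real.norm_eq_abs, Real.norm_eq_abs, hεa]
            ring
    have h4 := trapezoid_bound (by positivity) hf hf'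
    convert! h4 using 2
    have e1 : u + ((1 : ℝ) * ε) • h j = sumVec h m y := by rw [hu, one_mul, sub_add_cancel]
    have e2 : u + ((-1 : ℝ) * ε) • h j = sumVec h m (Function.update y j (-ε)) := by
      rw [sumVec_update, ← hε, hu]
      module
    simp only [f, f', φ]
    rw [e1, e2, Function.update_self, ← hε]
    ring
  calc |∑ j, ∫ y, φ j y ∂(Measure.pi fun _ : Fin m => rad)|
      ≤ ∑ j, |∫ y, φ j y ∂(Measure.pi fun _ : Fin m => rad)| := Finset.abs_sum_le_sum_abs _ _
    _ ≤ ∑ j : Fin m, ‖h j‖ ^ 3 * M / 2 := Finset.sum_le_sum fun j _ => hj j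
    _ = (∑ j : Fin m, ‖h j‖ ^ 3) / 2 * M := by
        rw [← Finset.sum_div, ← Finset.sum_mul]; ring
    _ ≤ α * M := by gcongr

theorem map_pi_eq_rad {Ω : Type*} [MeasurableSpace Ω] {P : Measure Ω} [IsProbabilityMeasure P]
    {X : ℕ → Ω → ℝ} (hXm : ∀ n, Measurable (X n)) (hXi : iIndepFun X P)
    (hX : ∀ n, P {w | X n w = 1} = 1 / 2 ∧ P {w | X n w = -1} = 1 / 2) (m : ℕ) :
    P.map (fun w (i : Fin m) => X i w) = Measure.pi fun _ : Fin m => rad := by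
  have h1 : iIndepFun (fun i : Fin m => X i) P := hXi.precomp Fin.val_injective
  rw [(iIndepFun_iff_map_fun_eq_pi_map fun i : Fin m => (hXm i).aemeasurable).1 h1]
  congr 1
  funext i
  exact map_eq_rad (hXm i) (hX i).1 (hX i).2

end DonskerRate

end

/-! ### Lindeberg comparison of Rademacher and Gaussian sums, with Gaussian smoothing. -/

noncomputable section

namespace DonskerRate

/-! ### Translations of the standard Gaussian measure -/

/-- The standard Gaussian measure on the line. -/
abbrev stdG : Measure ℝ := gaussianReal 0 1

/-- The standard Gaussian measure on `ℝ^n`. -/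
abbrev stdGpi (n : ℕ) : Measure (Fin n → ℝ) := Measure.pi fun _ => stdG

/-- The density of the Gaussian measure translated by `c`. -/
def shiftDensity (c x : ℝ) : ℝ := Real.exp (c * x - c ^ 2 / 2)

theorem measurable_shiftDensity (c : ℝ) : Measurable (shiftDensity c) := by
  unfold shiftDensity
  fun_prop

theorem integral_shiftDensity (c : ℝ) : ∫ x, shiftDensity c x ∂stdG = 1 := by
  have h := mgf_id_gaussianReal (μ := 0) (v := 1)
  have h1 := congrFun h c
  simp only [mgf, id] at h1
  have : ∀ x, shiftDensity c x = Real.exp (c * x) * Real.exp (-(c ^ 2 / 2)) := by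
    intro x; rw [shiftDensity, ← Real.exp_add, sub_eq_add_neg]
  simp_rw [this]
  rw [integral_mul_const, h1, ← Real.exp_add]
  simp

theorem integral_shiftDensity_sq (c : ℝ) :
    ∫ x, shiftDensity c x ^ 2 ∂stdG = Real.exp (c ^ 2) := by
  have : ∀ x, shiftDensity c x ^ 2 = shiftDensity (2 * c) x * Real.exp (c ^ 2) := by
    intro x
    rw [shiftDensity, shiftDensity, ← Real.exp_nat_mul, ← Real.exp_add]
    congr 1; push_cast; ring
  simp_rw [this]
  rw [integral_mul_const, integral_shiftDensity, one_mul]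

theorem integrable_shiftDensity (c : ℝ) : Integrable (shiftDensity c) stdG :=
  Integrable.of_integral_ne_zero (by rw [integral_shiftDensity]; exact one_ne_zero)

theorem integrable_shiftDensity_sq (c : ℝ) : Integrable (fun x => shiftDensity c x ^ 2) stdG :=
  Integrable.of_integral_ne_zero (by rw [integral_shiftDensity_sq]; exact (Real.exp_pos _).ne')

theorem stdG_map_add (c : ℝ) :
    stdG.map (fun x => x + c) = stdG.withDensity fun x => ENNReal.ofReal (shiftDensity c x) := by
  have h : stdG = volume.withDensity (gaussianPDF 0 1) := gaussianReal_of_var_ne_zero _ one_ne_zero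
  rw [gaussianReal_map_add_const, zero_add, gaussianReal_of_var_ne_zero _ one_ne_zero, h,
    ← withDensity_mul _ (measurable_gaussianPDF _ _)
    (measurable_shiftDensity c).ennreal_ofReal]
  congr 1
  funext x
  simp only [Pi.mul_apply, gaussianPDF]
  rw [← ENNReal.ofReal_mul (gaussianPDFReal_nonneg _ _ _)]
  congr 1
  simp only [gaussianPDFReal, shiftDensity]
  rw [mul_assoc _ (Real.exp _), ← Real.exp_add]
  congr 2
  push_cast
  ring

theorem stdGpi_map_add {n : ℕ} (c : Fin n → ℝ) :
    (stdGpi n).map (fun y => y + c)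
      = (stdGpi n).withDensity fun y => ENNReal.ofReal (∏ i, shiftDensity (c i) (y i)) := by
  have h1 : (stdGpi n).map (fun y => y + c) = Measure.pi fun i => stdG.map (fun x => x + c i) := by
    have := measurePreserving_pi (fun _ : Fin n => stdG) (fun i => stdG.map (fun x => x + c i))
      (f := fun i x => x + c i) fun i => ⟨measurable_id.add_const _, rfl⟩
    rw [← this.map_eq]
    rfl
  rw [h1]
  refine Measure.pi_eq fun s hs => ?_
  have hint : Integrable (fun y : Fin n → ℝ => ∏ i, shiftDensity (c i) (y i)) (stdGpi n) :=
    Integrable.fintype_prod fun i => integrable_shiftDensity (c i)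
  have hnn : ∀ y : Fin n → ℝ, 0 ≤ ∏ i, shiftDensity (c i) (y i) := fun y =>
    Finset.prod_nonneg fun i _ => (Real.exp_pos _).le
  have hS : MeasurableSet (Set.univ.pi s) := MeasurableSet.univ_pi hs
  rw [withDensity_apply _ hS, ← ofReal_integral_eq_lintegral_ofReal hint.restrict
    (ae_of_all _ hnn), ← integral_indicator hS]
  have h2 : ∀ y, (Set.univ.pi s).indicator (fun y => ∏ i, shiftDensity (c i) (y i)) y
      = ∏ i, (s i).indicator (shiftDensity (c i)) (y i) := by
    intro y
    by_cases hy : y ∈ Set.univ.pi s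
    · rw [Set.indicator_of_mem hy]
      exact Finset.prod_congr rfl fun i _ => by rw [Set.indicator_of_mem (hy i (Set.mem_univ i))]
    · rw [Set.indicator_of_notMem hy]
      simp only [Set.mem_univ_pi, not_forall] at hy
      obtain ⟨i, hi⟩ := hy
      exact (Finset.prod_eq_zero (Finset.mem_univ i) (Set.indicator_of_notMem hi _)).symm
  simp_rw [h2]
  have h3 : ∀ i ∈ Finset.univ, 0 ≤ ∫ x, (s i).indicator (shiftDensity (c i)) x ∂stdG := fun i _ =>
    integral_nonneg fun x => Set.indicator_nonneg (fun x _ => (Real.exp_pos _).le) x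
  rw [integral_fintype_prod_eq_prod, ENNReal.ofReal_prod_of_nonneg h3]
  refine Finset.prod_congr rfl fun i _ => ?_
  rw [stdG_map_add, withDensity_apply _ (hs i), integral_indicator (hs i),
    ofReal_integral_eq_lintegral_ofReal (integrable_shiftDensity _).restrict
      (ae_of_all _ fun x => (Real.exp_pos _).le)]

/-- The total variation distance between a Gaussian measure and its translate. -/
theorem abs_integral_shift_sub_le {n : ℕ} {φ : (Fin n → ℝ) → ℝ} (hφ : Measurable φ) {M : ℝ}
    (hM : ∀ y, |φ y| ≤ M) (c : Fin n → ℝ) :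
    |∫ y, φ (y + c) ∂stdGpi n - ∫ y, φ y ∂stdGpi n| ≤ 2 * M * Real.sqrt (∑ i, c i ^ 2) := by
  have hM0 : 0 ≤ M := (abs_nonneg _).trans (hM 0)
  set s := Real.sqrt (∑ i, c i ^ 2) with hs
  have hs0 : 0 ≤ s := Real.sqrt_nonneg _
  have hs2 : s ^ 2 = ∑ i, c i ^ 2 := Real.sq_sqrt (Finset.sum_nonneg fun i _ => sq_nonneg _)
  have hφi : Integrable φ (stdGpi n) :=
    Integrable.of_bound hφ.aestronglyMeasurable M (ae_of_all _ hM)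
  -- For s ≥ 1 the trivial bound 2M is enough. For s < 1 the total variation is controlled by the
  -- chi-square distance of the density D from 1, which is e^(s²) - 1 ≤ 2s².
  rcases le_or_gt 1 s with h | h
  · have h1 : ∀ ψ : (Fin n → ℝ) → ℝ, (∀ y, |ψ y| ≤ M) → |∫ y, ψ y ∂stdGpi n| ≤ M := by
      intro ψ hψ
      simpa using norm_integral_le_of_norm_le_const (μ := stdGpi n) (f := ψ) (ae_of_all _ hψ)
    have h2 := abs_sub (∫ y, φ (y + c) ∂stdGpi n) (∫ y, φ y ∂stdGpi n)
    have h3 := h1 φ hM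
    have h4 := h1 (fun y => φ (y + c)) fun y => hM _
    nlinarith
  · let D : (Fin n → ℝ) → ℝ := fun y => ∏ i, shiftDensity (c i) (y i)
    have hD0 : ∀ y, 0 ≤ D y := fun y => Finset.prod_nonneg fun i _ => (Real.exp_pos _).le
    have hDm : Measurable D := Finset.measurable_prod _ fun i _ =>
      (measurable_shiftDensity (c i)).comp (measurable_pi_apply i)
    have hDi : Integrable D (stdGpi n) :=
      Integrable.fintype_prod fun i => integrable_shiftDensity (c i)
    have hD1 : ∫ y, D y ∂stdGpi n = 1 := by
      simp only [D]
      rw [integral_fintype_prod_eq_prod]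
      simp [integral_shiftDensity]
    have hD2i : Integrable (fun y => D y ^ 2) (stdGpi n) := by
      simp only [D, ← Finset.prod_pow]
      exact Integrable.fintype_prod (f := fun i x => shiftDensity (c i) x ^ 2)
        fun i => integrable_shiftDensity_sq (c i)
    have hD2 : ∫ y, D y ^ 2 ∂stdGpi n = Real.exp (s ^ 2) := by
      simp only [D, ← Finset.prod_pow]
      rw [integral_fintype_prod_eq_prod (f := fun i x => shiftDensity (c i) x ^ 2)]
      simp_rw [integral_shiftDensity_sq]
      rw [← Real.exp_sum, hs2]
    have h1 : ∫ y, φ (y + c) ∂stdGpi n = ∫ y, D y * φ y ∂stdGpi n := by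
      rw [← integral_map (f := φ) (φ := fun y => y + c) (measurable_id.add_const c).aemeasurable
        hφ.aestronglyMeasurable, stdGpi_map_add,
        integral_withDensity_eq_integral_toReal_smul hDm.ennreal_ofReal
          (ae_of_all _ fun _ => ENNReal.ofReal_lt_top)]
      refine integral_congr_ae (ae_of_all _ fun y => ?_)
      simp only [smul_eq_mul]
      rw [ENNReal.toReal_ofReal (hD0 y)]
    have hDφ : Integrable (fun y => D y * φ y) (stdGpi n) :=
      hDi.mul_bdd hφ.aestronglyMeasurable (ae_of_all _ hM)
    have hDsub : Integrable (fun y => (D y - 1) ^ 2) (stdGpi n) := by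
      have := (hD2i.sub (hDi.const_mul 2)).add (integrable_const (1 : ℝ))
      refine this.congr (ae_of_all _ fun y => ?_)
      simp only [Pi.add_apply, Pi.sub_apply]; ring
    have h2 : ∫ y, (D y - 1) ^ 2 ∂stdGpi n = Real.exp (s ^ 2) - 1 := by
      have : ∀ y, (D y - 1) ^ 2 = D y ^ 2 - 2 * D y + 1 := fun y => by ring
      simp_rw [this]
      rw [integral_add (f := fun y => D y ^ 2 - 2 * D y) (hD2i.sub (hDi.const_mul 2)) (integrable_const _),
        integral_sub hD2i (hDi.const_mul 2), integral_const_mul, hD1, hD2]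
      simp; ring
    have h3 : (∫ y, |D y - 1| ∂stdGpi n) ^ 2 ≤ (2 * s) ^ 2 := by
      have hL : MemLp (fun y => |D y - 1|) 2 (stdGpi n) := by
        rw [memLp_two_iff_integrable_sq (hDm.sub_const 1).abs.aestronglyMeasurable]
        simpa using hDsub
      -- Nonnegativity of the variance is Cauchy-Schwarz between the first and second moments.
      have hv := variance_nonneg (fun y => |D y - 1|) (stdGpi n)
      rw [variance_eq_sub hL] at hv
      simp only [Pi.pow_apply, sq_abs] at hv
      rw [h2] at hv
      have h5 := Real.abs_exp_sub_one_le (x := s ^ 2) (by rw [abs_of_nonneg (sq_nonneg _)]; nlinarith)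
      rw [abs_of_nonneg (sq_nonneg s)] at h5
      have h6 := le_abs_self (Real.exp (s ^ 2) - 1)
      nlinarith
    have h4 : ∫ y, |D y - 1| ∂stdGpi n ≤ 2 * s := by
      exact le_of_sq_le_sq h3 (by positivity)
    rw [h1, ← integral_sub hDφ hφi]
    calc |∫ y, (D y * φ y - φ y) ∂stdGpi n| ≤ ∫ y, |D y * φ y - φ y| ∂stdGpi n :=
          abs_integral_le_integral_abs
      _ ≤ ∫ y, M * |D y - 1| ∂stdGpi n := by
          refine integral_mono_of_nonneg (ae_of_all _ fun y => abs_nonneg _)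
            ((hDi.sub (integrable_const 1)).abs.const_mul M) (ae_of_all _ fun y => ?_)
          beta_reduce
          have : D y * φ y - φ y = φ y * (D y - 1) := by ring
          rw [this, abs_mul]
          gcongr
          exact hM y
      _ = M * ∫ y, |D y - 1| ∂stdGpi n := integral_const_mul _ _
      _ ≤ M * (2 * s) := by gcongr
      _ = 2 * M * s := by ring

end DonskerRate

end

noncomputable section

namespace DonskerRate

/-! ### Gaussian smoothing of Lipschitz functions -/

theorem sumVec_add (h : ℕ → EllTwo) (n : ℕ) (y c : Fin n → ℝ) :
    sumVec h n (y + c) = sumVec h n y + sumVec h n c := by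
  simp only [sumVec, Pi.add_apply, add_smul, Finset.sum_add_distrib]

theorem sumVec_smul (h : ℕ → EllTwo) (n : ℕ) (x : ℝ) (c : Fin n → ℝ) :
    sumVec h n (x • c) = x • sumVec h n c := by
  simp only [sumVec, Pi.smul_apply, smul_eq_mul, mul_smul, Finset.smul_sum]

/-- The function `Ψ` averaged over Gaussian combinations of the first `n` vectors of `h`. -/
def smoothed (h : ℕ → EllTwo) (n : ℕ) (Ψ : EllTwo → ℝ) (v : EllTwo) : ℝ :=
  ∫ y, Ψ (sumVec h n y + v) ∂stdGpi n

section Smoothing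

variable {h : ℕ → EllTwo} {n : ℕ} {Ψ : EllTwo → ℝ} {L B : ℝ}

theorem continuous_of_abs_sub_le (hL : ∀ u v, |Ψ u - Ψ v| ≤ L * ‖u - v‖) : Continuous Ψ := by
  refine (LipschitzWith.of_dist_le_mul (K := L.toNNReal) fun u v => ?_).continuous
  rw [Real.dist_eq, dist_eq_norm]
  exact (hL u v).trans (by gcongr; exact Real.le_coe_toNNReal L)

theorem integrable_smoothed (hL : ∀ u v, |Ψ u - Ψ v| ≤ L * ‖u - v‖) (hB : ∀ u, |Ψ u| ≤ B)
    (v : EllTwo) : Integrable (fun y => Ψ (sumVec h n y + v)) (stdGpi n) :=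
  Integrable.of_bound ((continuous_of_abs_sub_le hL).comp
    ((continuous_sumVec h n).add continuous_const)).aestronglyMeasurable B (ae_of_all _ fun _ => hB _)

theorem abs_smoothed_sub_le (hL : ∀ u v, |Ψ u - Ψ v| ≤ L * ‖u - v‖) (hB : ∀ u, |Ψ u| ≤ B)
    (u v : EllTwo) : |smoothed h n Ψ u - smoothed h n Ψ v| ≤ L * ‖u - v‖ := by
  rw [smoothed, smoothed, ← integral_sub (integrable_smoothed hL hB u) (integrable_smoothed hL hB v)]
  have := norm_integral_le_of_norm_le_const (μ := stdGpi n) (C := L * ‖u - v‖)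
    (f := fun y => Ψ (sumVec h n y + u) - Ψ (sumVec h n y + v)) (ae_of_all _ fun y => by
      simpa using hL (sumVec h n y + u) (sumVec h n y + v))
  simpa using this

/-- Translating Ψ(· - w) - Ψ(· - u) by u + w gives Ψ(· + u) - Ψ(· + w). The symmetrized difference
is thus the effect of a translation on a function bounded by L‖u - w‖: the size of the increment and
the total variation cost multiply, a second order gain for a Ψ that is only Lipschitz. -/
theorem abs_smoothed_symm_sub_le (hL : ∀ u v, |Ψ u - Ψ v| ≤ L * ‖u - v‖) (hB : ∀ u, |Ψ u| ≤ B)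
    (c : Fin n → ℝ) (u w : EllTwo) (hc : sumVec h n c = u + w) :
    |smoothed h n Ψ u + smoothed h n Ψ (-u) - (smoothed h n Ψ w + smoothed h n Ψ (-w))|
      ≤ 2 * (L * ‖u - w‖) * Real.sqrt (∑ i, c i ^ 2) := by
  let φ : (Fin n → ℝ) → ℝ := fun y => Ψ (sumVec h n y - w) - Ψ (sumVec h n y - u)
  have hΨ := continuous_of_abs_sub_le hL
  have hφ : Continuous φ :=
    (hΨ.comp ((continuous_sumVec h n).sub continuous_const)).sub
      (hΨ.comp ((continuous_sumVec h n).sub continuous_const))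
  have hM : ∀ y, |φ y| ≤ L * ‖u - w‖ := by
    intro y
    have := hL (sumVec h n y - w) (sumVec h n y - u)
    rwa [sub_sub_sub_cancel_left] at this
  have hi := integrable_smoothed (h := h) (n := n) hL hB
  have h1 : ∫ y, φ y ∂stdGpi n = smoothed h n Ψ (-w) - smoothed h n Ψ (-u) := by
    simp only [φ, smoothed, sub_eq_add_neg (sumVec h n _)]
    exact integral_sub (hi _) (hi _)
  have h2 : ∫ y, φ (y + c) ∂stdGpi n = smoothed h n Ψ u - smoothed h n Ψ w := by
    simp only [φ, smoothed, sumVec_add, hc]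
    rw [← integral_sub (hi _) (hi _)]
    refine integral_congr_ae (ae_of_all _ fun y => ?_)
    beta_reduce
    congr 2 <;> abel
  have h3 := abs_integral_shift_sub_le hφ.measurable hM c
  rw [h1, h2] at h3
  convert! h3 using 2
  ring

end Smoothing

/-! ### Averages of consecutive vectors -/

/-- The average of the `n` vectors which precede the `j`-th one. -/
def backAvg (h : ℕ → EllTwo) (j n : ℕ) : EllTwo := (n : ℝ)⁻¹ • ∑ i ∈ Finset.range n, h (j - 1 - i)

/-- The weights of the average `backAvg`. -/
def backWeight (j n : ℕ) (i : Fin j) : ℝ := if j - 1 - i < n then (n : ℝ)⁻¹ else 0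

theorem sum_fin_ite_eq {M : Type*} [AddCommMonoid M] {j n : ℕ} (hn : n ≤ j) (f : ℕ → M) :
    (∑ i : Fin j, if j - 1 - i < n then f i else 0) = ∑ i ∈ Finset.range n, f (j - 1 - i) := by
  rw [Fin.sum_univ_eq_sum_range (fun i => if j - 1 - i < n then f i else 0) j,
    ← Finset.sum_range_reflect]
  symm
  refine Finset.sum_subset_zero_on_sdiff (Finset.range_mono hn) (fun i hi => ?_) fun i hi => ?_
  · simp only [Finset.mem_sdiff, Finset.mem_range] at hi
    exact if_neg (by omega)
  · rw [Finset.mem_range] at hi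
    exact (if_pos (by omega)).symm

theorem sumVec_backWeight (h : ℕ → EllTwo) {j n : ℕ} (hn : n ≤ j) :
    sumVec h j (backWeight j n) = backAvg h j n := by
  rw [backAvg, Finset.smul_sum, ← sum_fin_ite_eq hn fun i => (n : ℝ)⁻¹ • h i, sumVec]
  refine Finset.sum_congr rfl fun i _ => ?_
  rw [backWeight]
  split_ifs <;> simp

theorem sqrt_sum_backWeight_sq {j n : ℕ} (hn : n ≤ j) (hn0 : 0 < n) :
    Real.sqrt (∑ i, backWeight j n i ^ 2) = (Real.sqrt n)⁻¹ := by
  have h1 : ∀ i : Fin j, backWeight j n i ^ 2 = if j - 1 - i < n then ((n : ℝ)⁻¹) ^ 2 else 0 := by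
    intro i; rw [backWeight]; split_ifs <;> simp
  simp_rw [h1]
  rw [sum_fin_ite_eq hn fun _ => ((n : ℝ)⁻¹) ^ 2, Finset.sum_const, Finset.card_range,
    nsmul_eq_mul, ← Real.sqrt_inv]
  congr 1
  have : (n : ℝ) ≠ 0 := by positivity
  field_simp

theorem sqrt_sum_add_sq_le {n : ℕ} (a b : Fin n → ℝ) :
    Real.sqrt (∑ i, (a i + b i) ^ 2) ≤ Real.sqrt (∑ i, a i ^ 2) + Real.sqrt (∑ i, b i ^ 2) := by
  have := norm_add_le (WithLp.toLp 2 a : EuclideanSpace ℝ (Fin n)) (WithLp.toLp 2 b)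
  simpa [EuclideanSpace.norm_eq] using this

theorem sqrt_sum_smul_sq {n : ℕ} (x : ℝ) (a : Fin n → ℝ) :
    Real.sqrt (∑ i, (x * a i) ^ 2) = |x| * Real.sqrt (∑ i, a i ^ 2) := by
  simp_rw [mul_pow]
  rw [← Finset.mul_sum, Real.sqrt_mul (sq_nonneg x), Real.sqrt_sq_eq_abs]

theorem norm_backAvg_sub_le {h : ℕ → EllTwo} {j n : ℕ} (hn0 : 0 < n) {D : ℝ} (v : EllTwo)
    (hD : ∀ i < n, ‖h (j - 1 - i) - v‖ ≤ D) : ‖backAvg h j n - v‖ ≤ D := by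
  have hn : (0 : ℝ) < n := by exact_mod_cast hn0
  have : backAvg h j n - v = (n : ℝ)⁻¹ • ∑ i ∈ Finset.range n, (h (j - 1 - i) - v) := by
    rw [backAvg, Finset.sum_sub_distrib, smul_sub, Finset.sum_const, Finset.card_range,
      ← Nat.cast_smul_eq_nsmul ℝ, smul_smul, inv_mul_cancel₀ hn.ne', one_smul]
  rw [this, norm_smul, norm_inv, Real.norm_of_nonneg hn.le, inv_mul_le_iff₀ hn]
  refine (norm_sum_le _ _).trans ?_
  calc _ ≤ ∑ i ∈ Finset.range n, D := Finset.sum_le_sum fun i hi => hD i (Finset.mem_range.1 hi)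
    _ = n * D := by simp

theorem backAvg_sub_backAvg_succ (h : ℕ → EllTwo) (j : ℕ) {n : ℕ} (hn0 : 0 < n) :
    backAvg h j n - backAvg h j (n + 1)
      = ((n : ℝ) + 1)⁻¹ • (backAvg h j n - h (j - 1 - n)) := by
  have hn : (n : ℝ) ≠ 0 := by positivity
  have hn1 : (n : ℝ) + 1 ≠ 0 := by positivity
  rw [backAvg, backAvg, Finset.sum_range_succ]
  set S := ∑ i ∈ Finset.range n, h (j - 1 - i)
  push_cast
  rw [smul_sub, smul_smul, smul_add, ← sub_sub, ← sub_smul]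
  congr 2
  field_simp
  ring

section Telescope

variable {h : ℕ → EllTwo} {Ψ : EllTwo → ℝ} {L B b κ s : ℝ} {j : ℕ}

/-- Lengthening the average moves it by at most n⁻¹ · bκ n^s, and translating along it costs
n^(-1/2) because its weights have that ℓ² norm; the product is of order n^(s - 3/2). -/
theorem abs_smoothed_symm_step_le (hL0 : 0 ≤ L) (hL : ∀ u v, |Ψ u - Ψ v| ≤ L * ‖u - v‖)
    (hB : ∀ u, |Ψ u| ≤ B) (hbκ : 0 ≤ b * κ) (hs : 0 ≤ s)
    (hd : ∀ i k, i < k → k ≤ j → ‖h i - h k‖ ≤ b * κ * ((k : ℝ) - i) ^ s) (x : ℝ) {n : ℕ}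
    (hn0 : 0 < n) (hn : n < j) :
    |smoothed h j Ψ (x • backAvg h j n) + smoothed h j Ψ (-(x • backAvg h j n))
      - (smoothed h j Ψ (x • backAvg h j (n + 1)) + smoothed h j Ψ (-(x • backAvg h j (n + 1))))|
      ≤ 4 * L * x ^ 2 * (b * κ) * (n : ℝ) ^ (s - 3 / 2) := by
  have hnr : (0 : ℝ) < n := by exact_mod_cast hn0
  have h1 := abs_smoothed_symm_sub_le (h := h) hL hB (x • (backWeight j n + backWeight j (n + 1)))
    (x • backAvg h j n) (x • backAvg h j (n + 1)) (by
      rw [sumVec_smul, sumVec_add, sumVec_backWeight h hn.le, sumVec_backWeight h hn, smul_add])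
  refine h1.trans ?_
  have h2 : ‖x • backAvg h j n - x • backAvg h j (n + 1)‖
      ≤ |x| * (((n : ℝ))⁻¹ * (b * κ * (n : ℝ) ^ s)) := by
    rw [← smul_sub, norm_smul, Real.norm_eq_abs, backAvg_sub_backAvg_succ h j hn0, norm_smul,
      norm_inv, Real.norm_of_nonneg (by positivity : (0 : ℝ) ≤ n + 1)]
    have : ‖backAvg h j n - h (j - 1 - n)‖ ≤ b * κ * (n : ℝ) ^ s := by
      refine norm_backAvg_sub_le hn0 _ fun i hi => ?_
      rw [norm_sub_rev]
      refine (hd _ _ (by omega) (by omega)).trans ?_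
      have hk : ((j - 1 - i : ℕ) : ℝ) - ((j - 1 - n : ℕ) : ℝ) = n - i := by
        rw [show j - 1 - i = (j - 1 - n) + (n - i) by omega, Nat.cast_add, Nat.cast_sub hi.le]
        ring
      have hin : (i : ℝ) ≤ n := by exact_mod_cast hi.le
      rw [hk]
      gcongr
      · linarith
    gcongr
    linarith
  have h3 : Real.sqrt (∑ i, (x • (backWeight j n + backWeight j (n + 1))) i ^ 2)
      ≤ |x| * (2 * (Real.sqrt n)⁻¹) := by
    simp only [Pi.smul_apply, Pi.add_apply, smul_eq_mul]
    rw [sqrt_sum_smul_sq]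
    gcongr
    refine (sqrt_sum_add_sq_le _ _).trans ?_
    rw [sqrt_sum_backWeight_sq hn.le hn0, sqrt_sum_backWeight_sq hn (Nat.succ_pos n), two_mul]
    gcongr
    linarith
  have h4 : (n : ℝ) ^ (s - 3 / 2) = (n : ℝ)⁻¹ * (n : ℝ) ^ s * (Real.sqrt n)⁻¹ := by
    rw [Real.sqrt_eq_rpow, ← Real.rpow_neg_one, ← Real.rpow_neg hnr.le, ← Real.rpow_add hnr,
      ← Real.rpow_add hnr]
    congr 1; ring
  calc _ ≤ 2 * (L * (|x| * (((n : ℝ))⁻¹ * (b * κ * (n : ℝ) ^ s)))) * (|x| * (2 * (Real.sqrt n)⁻¹)) := by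
        gcongr
    _ = 4 * L * |x| ^ 2 * (b * κ) * ((n : ℝ)⁻¹ * (n : ℝ) ^ s * (Real.sqrt n)⁻¹) := by ring
    _ = _ := by rw [sq_abs, h4]

/-- A path from x h_j to 0: to the predecessor of h_j, at cost κ by the Lipschitz bound; through
averages of 1, …, j predecessors, at a cost summable because s < 1/2; from the last average to 0, at
cost j^(-1/2). -/
theorem abs_smoothed_second_difference_le (hL0 : 0 ≤ L)
    (hL : ∀ u v, |Ψ u - Ψ v| ≤ L * ‖u - v‖) (hB : ∀ u, |Ψ u| ≤ B) (hb0 : 0 ≤ b) (hκ : 0 ≤ κ)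
    (hs : 0 ≤ s) (hs1 : s < 1 / 2) (hb : ∀ i ≤ j, ‖h i‖ ≤ b)
    (hd : ∀ i k, i < k → k ≤ j → ‖h i - h k‖ ≤ b * κ * ((k : ℝ) - i) ^ s) (x : ℝ) :
    |smoothed h j Ψ (x • h j) + smoothed h j Ψ (-(x • h j)) - 2 * smoothed h j Ψ 0|
      ≤ L * b * ((2 + 4 * ∑' n : ℕ, (n : ℝ) ^ (s - 3 / 2)) * κ + 4 / Real.sqrt (j + 1))
        * (|x| + x ^ 2) := by
  set Z := ∑' n : ℕ, (n : ℝ) ^ (s - 3 / 2) with hZ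
  have hZs : Summable fun n : ℕ => (n : ℝ) ^ (s - 3 / 2) := Real.summable_nat_rpow.2 (by linarith)
  have hZ0 : 0 ≤ Z := tsum_nonneg fun n => by positivity
  let S : EllTwo → ℝ := fun v => smoothed h j Ψ v + smoothed h j Ψ (-v)
  have hS0 : S 0 = 2 * smoothed h j Ψ 0 := by simp only [S, neg_zero]; ring
  have hSL : ∀ u v, |S u - S v| ≤ 2 * L * ‖u - v‖ := by
    intro u v
    have h1 := abs_smoothed_sub_le (h := h) (n := j) hL hB u v
    have h2 := abs_smoothed_sub_le (h := h) (n := j) hL hB (-u) (-v)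
    rw [neg_sub_neg, norm_sub_rev] at h2
    have : S u - S v = (smoothed h j Ψ u - smoothed h j Ψ v)
        + (smoothed h j Ψ (-u) - smoothed h j Ψ (-v)) := by simp only [S]; ring
    rw [this]
    exact (abs_add_le _ _).trans (by linarith)
  change |S (x • h j) - _| ≤ _
  rw [← hS0]
  have hx2 : 0 ≤ x ^ 2 := sq_nonneg x
  have hx1 : 0 ≤ |x| := abs_nonneg x
  rcases Nat.eq_zero_or_pos j with hj0 | hj0
  -- Without predecessors only the Lipschitz bound is available; the term 4/√(j+1) = 4 covers it.
  · have h1 := hSL (x • h j) 0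
    rw [sub_zero, norm_smul, Real.norm_eq_abs] at h1
    refine h1.trans ?_
    have h2 : (4 : ℝ) / Real.sqrt (j + 1) = 4 := by simp [hj0]
    rw [h2]
    calc 2 * L * (|x| * ‖h j‖) ≤ 2 * L * (|x| * b) := by gcongr; exact hb j le_rfl
      _ ≤ L * b * ((2 + 4 * Z) * κ + 4) * (|x| + x ^ 2) := by
        have : 2 * L * (|x| * b) = L * b * 2 * |x| := by ring
        rw [this]
        have h3 : 0 ≤ (2 + 4 * Z) * κ := by positivity
        gcongr <;> linarith
  · have hjr : (0 : ℝ) < j := by exact_mod_cast hj0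
    have h1 : |S (x • h j) - S (x • backAvg h j 1)| ≤ 2 * L * (|x| * (b * κ)) := by
      refine (hSL _ _).trans ?_
      rw [← smul_sub, norm_smul, Real.norm_eq_abs]
      have : backAvg h j 1 = h (j - 1) := by simp [backAvg]
      rw [this, norm_sub_rev]
      have h2 := hd (j - 1) j (by omega) le_rfl
      rw [Nat.cast_sub hj0] at h2
      norm_num at h2
      gcongr
    have h2 : ∀ n, 1 ≤ n → n ≤ j → |S (x • backAvg h j 1) - S (x • backAvg h j n)|
        ≤ 4 * L * x ^ 2 * (b * κ) * ∑ i ∈ Finset.range n, (i : ℝ) ^ (s - 3 / 2) := by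
      intro n hn1
      induction n, hn1 using Nat.le_induction with
      | base =>
        intro _
        rw [sub_self, abs_zero]
        exact mul_nonneg (by positivity) (Finset.sum_nonneg fun i _ => by positivity)
      | succ n hn1 ih =>
        intro hnj
        have h3 := ih (by omega)
        have h4 := abs_smoothed_symm_step_le hL0 hL hB (by positivity) hs hd x
          (show 0 < n by omega) (show n < j by omega)
        rw [Finset.sum_range_succ, mul_add]
        exact (abs_sub_le _ (S (x • backAvg h j n)) _).trans (add_le_add h3 h4)
    have h3 := h2 j hj0 le_rfl
    have h4 : |S (x • backAvg h j j) - S 0| ≤ 2 * (L * (|x| * b)) * (|x| * (Real.sqrt j)⁻¹) := by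
      have h5 := abs_smoothed_symm_sub_le (h := h) hL hB (x • backWeight j j)
        (x • backAvg h j j) 0 (by rw [sumVec_smul, sumVec_backWeight h le_rfl, add_zero])
      refine h5.trans ?_
      simp only [Pi.smul_apply, smul_eq_mul]
      rw [sqrt_sum_smul_sq, sqrt_sum_backWeight_sq le_rfl hj0, sub_zero, norm_smul,
        Real.norm_eq_abs]
      have : ‖backAvg h j j‖ ≤ b := by
        have := norm_backAvg_sub_le (h := h) (j := j) hj0 (0 : EllTwo) (D := b) fun i hi => by
          rw [sub_zero]; exact hb _ (by omega)
        rwa [sub_zero] at this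
      gcongr
    have h5 : (Real.sqrt j)⁻¹ ≤ 2 / Real.sqrt (j + 1) := by
      rw [inv_eq_one_div, div_le_div_iff₀ (by positivity) (by positivity), one_mul,
        Real.sqrt_le_left (by positivity), mul_pow, Real.sq_sqrt hjr.le]
      have : (1 : ℝ) ≤ j := by exact_mod_cast hj0
      linarith
    have h6 : ∑ i ∈ Finset.range j, (i : ℝ) ^ (s - 3 / 2) ≤ Z :=
      hZs.sum_le_tsum _ fun i _ => by positivity
    calc |S (x • h j) - S 0| ≤ |S (x • h j) - S (x • backAvg h j 1)|
          + |S (x • backAvg h j 1) - S (x • backAvg h j j)| + |S (x • backAvg h j j) - S 0| := by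
          refine (abs_sub_le _ (S (x • backAvg h j j)) _).trans ?_
          gcongr
          exact abs_sub_le _ _ _
      _ ≤ 2 * L * (|x| * (b * κ)) + 4 * L * x ^ 2 * (b * κ) * Z
          + 2 * (L * (|x| * b)) * (|x| * (2 / Real.sqrt (j + 1))) := by
          gcongr
          · exact h3.trans (by gcongr)
          · exact h4.trans (by gcongr)
      _ = L * b * (2 * κ * |x| + (4 * Z * κ) * x ^ 2 + 4 / Real.sqrt (j + 1) * |x| ^ 2) := by ring
      _ ≤ L * b * (2 * κ * (|x| + x ^ 2) + (4 * Z * κ) * (|x| + x ^ 2)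
          + 4 / Real.sqrt (j + 1) * (|x| + x ^ 2)) := by
          rw [sq_abs]
          gcongr <;> linarith
      _ = _ := by ring

end Telescope

end DonskerRate

end

noncomputable section

namespace DonskerRate

/-! ### Fourth order expansion of smoothed test functions -/

section Smoothed

variable {μ : Measure ℝ} [IsProbabilityMeasure μ]

theorem integrable_sumVec_add (hμ : Integrable id μ) (h : ℕ → EllTwo) (n : ℕ) {f : EllTwo → ℝ}
    {C : ℝ} (hf : ∀ u v, |f u - f v| ≤ C * ‖u - v‖) (v : EllTwo) :
    Integrable (fun y => f (sumVec h n y + v)) (Measure.pi fun _ : Fin n => μ) := by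
  have hfc := continuous_of_abs_sub_le hf
  have h1 : Integrable (fun y : Fin n → ℝ => |f v| + |C| * ∑ i : Fin n, ‖y i‖ * ‖h i‖)
      (Measure.pi fun _ : Fin n => μ) := by
    refine (integrable_const _).add (Integrable.const_mul (integrable_finsetSum _ fun i _ => ?_) _)
    exact Integrable.mul_const (integrable_comp_eval (μ := fun _ : Fin n => μ) (i := i) hμ.norm) _
  refine h1.mono' (hfc.comp ((continuous_sumVec h n).add continuous_const)).aestronglyMeasurable
    (ae_of_all _ fun y => ?_)
  have h2 := hf (sumVec h n y + v) v
  rw [add_sub_cancel_right] at h2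
  have h3 : ‖sumVec h n y‖ ≤ ∑ i : Fin n, ‖y i‖ * ‖h i‖ :=
    (norm_sum_le _ _).trans (Finset.sum_le_sum fun i _ => (norm_smul _ _).le)
  have h4 : C * ‖sumVec h n y‖ ≤ |C| * ∑ i : Fin n, ‖y i‖ * ‖h i‖ :=
    mul_le_mul (le_abs_self C) h3 (norm_nonneg _) (abs_nonneg C)
  rw [Real.norm_eq_abs]
  have h5 := abs_sub_abs_le_abs_sub (f (sumVec h n y + v)) (f v)
  linarith

theorem integrable_id_stdG : Integrable id stdG :=
  memLp_one_iff_integrable.1 (by simpa using memLp_id_gaussianReal (μ := 0) (v := 1) 1)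

theorem lipschitz_of_hasFDerivAt {f : EllTwo → ℝ} {f' : EllTwo → EllTwo →L[ℝ] ℝ} {C : ℝ}
    (hf : ∀ u, HasFDerivAt f (f' u) u) (hC : ∀ u, ‖f' u‖ ≤ C) (u v : EllTwo) :
    |f u - f v| ≤ C * ‖u - v‖ :=
  Convex.norm_image_sub_le_of_norm_hasFDerivWithin_le (𝕜 := ℝ)
    (fun z _ => (hf z).hasFDerivWithinAt) (fun z _ => hC z) convex_univ (Set.mem_univ v)
    (Set.mem_univ u)

theorem hasDerivAt_smoothed (h : ℕ → EllTwo) (n : ℕ) {f : EllTwo → ℝ}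
    {f' : EllTwo → EllTwo →L[ℝ] ℝ} {C : ℝ} (hf : ∀ u, HasFDerivAt f (f' u) u)
    (hf' : Continuous f') (hC : ∀ u, ‖f' u‖ ≤ C) (v : EllTwo) (t : ℝ) :
    HasDerivAt (fun t => smoothed h n f (t • v)) (smoothed h n (fun u => f' u v) (t • v)) t := by
  have hfc : Continuous f := continuous_iff_continuousAt.2 fun u => (hf u).continuousAt
  have hS : ∀ t : ℝ, Continuous fun y => sumVec h n y + t • v := fun t =>
    (continuous_sumVec h n).add continuous_const
  have hm : ∀ t : ℝ, AEStronglyMeasurable (fun y => f (sumVec h n y + t • v)) (stdGpi n) :=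
    fun t => (hfc.comp (hS t)).aestronglyMeasurable
  refine (hasDerivAt_integral_of_dominated_loc_of_deriv_le (s := Set.univ)
    (F := fun t y => f (sumVec h n y + t • v)) (F' := fun t y => f' (sumVec h n y + t • v) v)
    (bound := fun _ => C * ‖v‖) univ_mem
    (Eventually.of_forall hm)
    (integrable_sumVec_add integrable_id_stdG h n (lipschitz_of_hasFDerivAt hf hC) _)
    ((hf'.comp (hS t)).clm_apply continuous_const).aestronglyMeasurable
    (ae_of_all _ fun y t _ => (ContinuousLinearMap.le_opNorm _ _).trans (by gcongr; exact hC _))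
    (integrable_const _) (ae_of_all _ fun y t _ => ?_)).2
  have h1 : HasDerivAt (fun t : ℝ => sumVec h n y + t • v) v t := by
    simpa using ((hasDerivAt_id t).smul_const v).const_add (sumVec h n y)
  exact (hf _).comp_hasDerivAt t h1

/-- The even part has no odd-order terms and its second derivative varies by at most K(|t| + t²).
Integrating twice from 0 gives a remainder of orders three and four, where smoothing replaces a
fourth derivative. -/
theorem abs_even_taylor_le {Q Q₁ Q₂ : ℝ → ℝ} {K : ℝ} (hQ : ∀ t, HasDerivAt Q (Q₁ t) t)
    (hQ₁ : ∀ t, HasDerivAt Q₁ (Q₂ t) t)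
    (hK : ∀ t, |Q₂ t + Q₂ (-t) - 2 * Q₂ 0| ≤ K * (|t| + t ^ 2)) (x : ℝ) :
    |Q x + Q (-x) - 2 * Q 0 - x ^ 2 * Q₂ 0| ≤ K * (|x| ^ 3 + x ^ 4) := by
  have hK0 : 0 ≤ K := by
    have := (abs_nonneg _).trans (hK 1)
    norm_num at this
    exact this
  have hneg : ∀ {f f' : ℝ → ℝ}, (∀ t, HasDerivAt f (f' t) t) →
      ∀ t, HasDerivAt (fun t => f (-t)) (-f' (-t)) t := by
    intro f f' hf t
    have := (hf (-t)).scomp t (hasDerivAt_neg t)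
    simpa [Function.comp_def] using this
  let R : ℝ → ℝ := fun t => Q t + Q (-t) - 2 * Q 0 - t ^ 2 * Q₂ 0
  let R₁ : ℝ → ℝ := fun t => Q₁ t - Q₁ (-t) - 2 * t * Q₂ 0
  have hR : ∀ t, HasDerivAt R (R₁ t) t := by
    intro t
    have := (((hQ t).add (hneg hQ t)).sub_const (2 * Q 0)).sub
      (((hasDerivAt_id t).pow 2).mul_const (Q₂ 0))
    convert! this using 1
    simp [R₁]; ring
  have hR₁ : ∀ t, HasDerivAt R₁ (Q₂ t + Q₂ (-t) - 2 * Q₂ 0) t := by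
    intro t
    have := ((hQ₁ t).sub (hneg hQ₁ t)).sub
      (((hasDerivAt_id t).const_mul 2).mul_const (Q₂ 0))
    convert! this using 1
    ring
  have hR0 : R 0 = 0 := by simp [R]; ring
  have hR₁0 : R₁ 0 = 0 := by simp [R₁]
  have hmem : ∀ t : ℝ, t ∈ Set.Icc (-|x|) |x| ↔ |t| ≤ |x| := fun t => abs_le.symm
  have h1 : ∀ t ∈ Set.Icc (-|x|) |x|, ‖R₁ t‖ ≤ K * (|x| + x ^ 2) * |x| := by
    intro t ht
    have := Convex.norm_image_sub_le_of_norm_hasDerivWithin_le (s := Set.Icc (-|x|) |x|) (x := 0)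
      (y := t) (C := K * (|x| + x ^ 2)) (fun z _ => (hR₁ z).hasDerivWithinAt) (fun z hz => by
        refine (hK z).trans ?_
        have hz' := (hmem z).1 hz
        have hz2 := sq_le_sq' (by linarith [neg_abs_le z, abs_nonneg z]) hz'
        rw [sq_abs] at hz2
        have : z ^ 2 ≤ x ^ 2 := sq_le_sq.2 hz'
        gcongr) (convex_Icc _ _) ((hmem 0).2 (by simp)) ht
    rw [hR₁0, sub_zero, sub_zero] at this
    refine this.trans ?_
    gcongr
    exact (hmem t).1 ht
  have h2 := Convex.norm_image_sub_le_of_norm_hasDerivWithin_le (s := Set.Icc (-|x|) |x|) (x := 0)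
      (y := x) (fun z _ => (hR z).hasDerivWithinAt) h1 (convex_Icc _ _) ((hmem 0).2 (by simp))
      ((hmem x).2 le_rfl)
  rw [hR0, sub_zero, sub_zero, Real.norm_eq_abs, Real.norm_eq_abs] at h2
  refine h2.trans (le_of_eq ?_)
  have h3 : |x| ^ 2 = x ^ 2 := sq_abs x
  have h4 : x ^ 4 = |x| ^ 4 := by rw [show (4 : ℕ) = 2 * 2 from rfl, pow_mul, pow_mul, sq_abs]
  rw [h4, ← h3]; ring

/-- A moment of the standard Gaussian measure. -/
def gaussMoment : ℝ := ∫ x, (|x| ^ 3 + x ^ 4) ∂stdG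

theorem integrable_pow_stdG (p : ℕ) (hp : p ≠ 0) : Integrable (fun x => |x| ^ p) stdG :=
  MemLp.integrable_norm_pow (by simpa using memLp_id_gaussianReal (μ := 0) (v := 1) p) hp

theorem integral_sq_stdG : ∫ x, x ^ 2 ∂stdG = 1 := by
  have h := variance_id_gaussianReal (μ := 0) (v := 1)
  rw [variance_eq_integral measurable_id.aemeasurable] at h
  simpa using h

/-- Both laws are symmetric with variance 1, so twice each mean is 2 Q(0) + q up to the remainder;
at x = 1 that remainder is 2K, which yields the 1 in the constant. -/
theorem abs_average_sub_integral_le {Q : ℝ → ℝ} {q K : ℝ} (hQi : Integrable Q stdG)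
    (hK : ∀ x, |Q x + Q (-x) - 2 * Q 0 - x ^ 2 * q| ≤ K * (|x| ^ 3 + x ^ 4)) :
    |(1 / 2 * Q 1 + 1 / 2 * Q (-1)) - ∫ x, Q x ∂stdG| ≤ K * (1 + gaussMoment / 2) := by
  have hmp : MeasurePreserving (fun x : ℝ => -x) stdG stdG :=
    ⟨measurable_neg, by rw [gaussianReal_map_neg, neg_zero]⟩
  have hQn : Integrable (fun x => Q (-x)) stdG := hmp.integrable_comp_of_integrable hQi
  have hneg : ∫ x, Q (-x) ∂stdG = ∫ x, Q x ∂stdG :=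
    hmp.integral_comp (MeasurableEquiv.neg ℝ).measurableEmbedding Q
  have hsq : Integrable (fun x : ℝ => x ^ 2) stdG := by
    simpa using integrable_pow_stdG 2 two_ne_zero
  have h4 : Integrable (fun x : ℝ => x ^ 4) stdG := by
    refine (integrable_pow_stdG 4 four_ne_zero).congr (ae_of_all _ fun x => ?_)
    beta_reduce
    rw [show (4 : ℕ) = 2 * 2 from rfl, pow_mul, pow_mul, sq_abs]
  have h1 : ∫ x, (Q x + Q (-x) - 2 * Q 0 - x ^ 2 * q) ∂stdG = 2 * ∫ x, Q x ∂stdG - 2 * Q 0 - q := by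
    rw [integral_sub (f := fun x => Q x + Q (-x) - 2 * Q 0)
        ((hQi.add hQn).sub (integrable_const _)) (hsq.mul_const q),
      integral_sub (f := fun x => Q x + Q (-x)) (hQi.add hQn) (integrable_const _),
      integral_add hQi hQn, hneg, integral_mul_const q fun x : ℝ => x ^ 2, integral_sq_stdG]
    simp
    ring
  have h2 : |2 * ∫ x, Q x ∂stdG - 2 * Q 0 - q| ≤ K * gaussMoment := by
    rw [← h1, gaussMoment, ← integral_const_mul]
    exact abs_integral_le_integral_abs.trans (integral_mono_of_nonneg
      (ae_of_all _ fun _ => abs_nonneg _)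
      (((integrable_pow_stdG 3 three_ne_zero).add h4).const_mul K) (ae_of_all _ hK))
  have h3 := hK 1
  norm_num at h3
  rw [abs_le] at *
  constructor <;> linarith [h2.1, h2.2, h3.1, h3.2]

end Smoothed

theorem IsTest.abs_sub_le {F : EllTwo → ℝ} (hF : IsTest F) (u v : EllTwo) :
    |F u - F v| ≤ 1 * ‖u - v‖ := by
  obtain ⟨F', F'', h1, -, h3, -⟩ := hF
  exact lipschitz_of_hasFDerivAt h1 h3 u v

/-- One step of the Lindeberg exchange. -/
theorem IsTest.abs_exchange_le {F : EllTwo → ℝ} (hF : IsTest F) (h : ℕ → EllTwo) (j : ℕ)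
    {b κ s : ℝ} (hb0 : 0 ≤ b) (hκ : 0 ≤ κ) (hs : 0 ≤ s) (hs1 : s < 1 / 2)
    (hb : ∀ i ≤ j, ‖h i‖ ≤ b)
    (hd : ∀ i k, i < k → k ≤ j → ‖h i - h k‖ ≤ b * κ * ((k : ℝ) - i) ^ s) :
    |(1 / 2 * smoothed h j F ((1 : ℝ) • h j) + 1 / 2 * smoothed h j F ((-1 : ℝ) • h j))
        - ∫ x, smoothed h j F (x • h j) ∂stdG|
      ≤ b ^ 3 * ((2 + 4 * ∑' n : ℕ, (n : ℝ) ^ (s - 3 / 2)) * κ + 4 / Real.sqrt (j + 1))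
        * (1 + gaussMoment / 2) := by
  have hFL := hF.abs_sub_le
  obtain ⟨F', F'', h1, h2, h3, h4, h5⟩ := hF
  set Z := ∑' n : ℕ, (n : ℝ) ^ (s - 3 / 2) with hZ
  have hZ0 : 0 ≤ Z := tsum_nonneg fun n => by positivity
  have hg0 : 0 ≤ gaussMoment := integral_nonneg fun x => by positivity
  set v := h j
  have hF'c : Continuous F' := continuous_iff_continuousAt.2 fun u => (h2 u).continuousAt
  have hF''L : LipschitzWith 1 F'' := LipschitzWith.of_dist_le_mul fun u w => by
    simpa [dist_eq_norm] using h5 u w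
  -- The function to be smoothed is Ψ(u) = F''(u)(v, v), the second derivative along v = h_j, with
  -- Lipschitz constant ‖v‖².
  let f' : EllTwo → EllTwo →L[ℝ] ℝ := fun u => (ContinuousLinearMap.apply ℝ ℝ v) ∘L F'' u
  have hf : ∀ u, HasFDerivAt (fun u => F' u v) (f' u) u := fun u =>
    (ContinuousLinearMap.apply ℝ ℝ v).hasFDerivAt.comp u (h2 u)
  have hf'v : ∀ u w, f' u w = F'' u w v := fun u w => rfl
  have hf'c : Continuous f' := continuous_const.clm_comp hF''L.continuous
  have hf'C : ∀ u, ‖f' u‖ ≤ ‖v‖ := by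
    intro u
    refine ContinuousLinearMap.opNorm_le_bound _ (norm_nonneg _) fun w => ?_
    rw [hf'v]
    calc ‖F'' u w v‖ ≤ ‖F'' u‖ * ‖w‖ * ‖v‖ := ContinuousLinearMap.le_opNorm₂ _ _ _
      _ ≤ 1 * ‖w‖ * ‖v‖ := by gcongr; exact h4 u
      _ = ‖v‖ * ‖w‖ := by ring
  have hΨL : ∀ u w, |f' u v - f' w v| ≤ ‖v‖ ^ 2 * ‖u - w‖ := by
    intro u w
    have he : f' u v - f' w v = (F'' u - F'' w) v v := rfl
    rw [he]
    calc ‖(F'' u - F'' w) v v‖ ≤ ‖F'' u - F'' w‖ * ‖v‖ * ‖v‖ := ContinuousLinearMap.le_opNorm₂ _ _ _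
      _ ≤ ‖u - w‖ * ‖v‖ * ‖v‖ := by gcongr; exact h5 u w
      _ = _ := by ring
  have hΨB : ∀ u, |f' u v| ≤ ‖v‖ * ‖v‖ := fun u =>
    (ContinuousLinearMap.le_opNorm _ _).trans (mul_le_mul_of_nonneg_right (hf'C u) (norm_nonneg _))
  have hQ := hasDerivAt_smoothed h j h1 hF'c h3 v
  have hQ₁ := hasDerivAt_smoothed h j hf hf'c hf'C v
  have hV := abs_smoothed_second_difference_le (h := h) (j := j) (sq_nonneg ‖v‖) hΨL hΨB hb0 hκ hs
    hs1 hb hd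
  have hT := abs_even_taylor_le hQ hQ₁ (K := ‖v‖ ^ 2 * b * ((2 + 4 * Z) * κ + 4 / Real.sqrt (j + 1)))
    (fun t => by rw [neg_smul, zero_smul]; exact hV t)
  have hQL : ∀ s t : ℝ, |smoothed h j F (s • v) - smoothed h j F (t • v)| ≤ ‖v‖ * |s - t| := by
    intro s t
    rw [smoothed, smoothed, ← integral_sub
      (integrable_sumVec_add integrable_id_stdG h j hFL _)
      (integrable_sumVec_add integrable_id_stdG h j hFL _)]
    have := norm_integral_le_of_norm_le_const (μ := stdGpi j) (C := ‖v‖ * |s - t|)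
      (f := fun y => F (sumVec h j y + s • v) - F (sumVec h j y + t • v)) (ae_of_all _ fun y => by
        refine (hFL _ _).trans (le_of_eq ?_)
        rw [add_sub_add_left_eq_sub, ← sub_smul, norm_smul, Real.norm_eq_abs]; ring)
    simpa using this
  have hQi : Integrable (fun x : ℝ => smoothed h j F (x • v)) stdG := by
    have hc : Continuous fun x : ℝ => smoothed h j F (x • v) :=
      continuous_iff_continuousAt.2 fun x => (hQ x).continuousAt
    refine (((integrable_id_stdG.norm).const_mul ‖v‖).add
      (integrable_const |smoothed h j F ((0 : ℝ) • v)|)).mono' hc.aestronglyMeasurable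
      (ae_of_all _ fun x => ?_)
    have h6 := hQL x 0
    have h7 := abs_sub_abs_le_abs_sub (smoothed h j F (x • v)) (smoothed h j F ((0 : ℝ) • v))
    rw [sub_zero] at h6
    simp only [Pi.add_apply, Real.norm_eq_abs, id]
    linarith
  refine (abs_average_sub_integral_le hQi hT).trans ?_
  have hv : ‖v‖ ≤ b := hb j le_rfl
  calc _ ≤ b ^ 2 * b * ((2 + 4 * Z) * κ + 4 / Real.sqrt (j + 1)) * (1 + gaussMoment / 2) := by gcongr
    _ = _ := by ring

/-! ### The Lindeberg exchange -/

section Fubini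

variable {μ : Measure ℝ} [IsProbabilityMeasure μ]

theorem sumVec_succ (h : ℕ → EllTwo) (m : ℕ) (y : Fin (m + 1) → ℝ) :
    sumVec h (m + 1) y = sumVec h m (fun i => y ((Fin.last m).succAbove i)) + y (Fin.last m) • h m := by
  simp [sumVec, Fin.sum_univ_castSucc]

theorem integrable_prod_sumVec (hμ : Integrable id μ) (h : ℕ → EllTwo) (m : ℕ) {f : EllTwo → ℝ}
    {C : ℝ} (hf : ∀ u v, |f u - f v| ≤ C * ‖u - v‖) :
    Integrable (fun z : ℝ × (Fin m → ℝ) => f (sumVec h m z.2 + z.1 • h m))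
        (μ.prod (Measure.pi fun _ : Fin m => μ)) ∧
      ∫ y, f (sumVec h (m + 1) y) ∂(Measure.pi fun _ : Fin (m + 1) => μ)
        = ∫ z, f (sumVec h m z.2 + z.1 • h m) ∂(μ.prod (Measure.pi fun _ : Fin m => μ)) := by
  have hmp := measurePreserving_piFinSuccAbove (fun _ : Fin (m + 1) => μ) (Fin.last m)
  have he : (fun y => f (sumVec h (m + 1) y))
      = (fun z : ℝ × (Fin m → ℝ) => f (sumVec h m z.2 + z.1 • h m)) ∘
        MeasurableEquiv.piFinSuccAbove (fun _ => ℝ) (Fin.last m) := by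
    funext y
    simp only [Function.comp_apply, sumVec_succ]
    rfl
  refine ⟨?_, ?_⟩
  · rw [← hmp.integrable_comp_emb (MeasurableEquiv.measurableEmbedding _), ← he]
    simpa using integrable_sumVec_add hμ h (m + 1) hf 0
  · rw [he]
    exact hmp.integral_comp' fun z : ℝ × (Fin m → ℝ) => f (sumVec h m z.2 + z.1 • h m)

theorem norm_half_add_half_le {E : Type*} [NormedAddCommGroup E] [NormedSpace ℝ E] {a b : E} {c : ℝ}
    (ha : ‖a‖ ≤ c) (hb : ‖b‖ ≤ c) : ‖(1 / 2 : ℝ) • a + (1 / 2 : ℝ) • b‖ ≤ c := by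
  refine (norm_add_le _ _).trans ?_
  rw [norm_smul, norm_smul, Real.norm_of_nonneg (by norm_num)]
  linarith

/-- Stability under averaging over a sign lets the induction of `abs_integral_rad_sub_stdG_le`
absorb the last Rademacher variable into the test function. -/
theorem IsTest.average {F : EllTwo → ℝ} (hF : IsTest F) (v : EllTwo) :
    IsTest fun u => 1 / 2 * F (u + (1 : ℝ) • v) + 1 / 2 * F (u + (-1 : ℝ) • v) := by
  obtain ⟨F', F'', h1, h2, h3, h4, h5⟩ := hF
  have hsh : ∀ {E : Type} [NormedAddCommGroup E] [NormedSpace ℝ E] {f : EllTwo → E}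
      {f' : EllTwo → EllTwo →L[ℝ] E}, (∀ x, HasFDerivAt f (f' x) x) → ∀ (c : ℝ) (u : EllTwo),
      HasFDerivAt (fun u => f (u + c • v)) (f' (u + c • v)) u := by
    intro E _ _ f f' hf c u
    have := (hf (u + c • v)).comp u ((hasFDerivAt_id u).add_const (c • v))
    rw [ContinuousLinearMap.comp_id] at this
    exact this
  refine ⟨fun u => (1 / 2 : ℝ) • F' (u + (1 : ℝ) • v) + (1 / 2 : ℝ) • F' (u + (-1 : ℝ) • v),
    fun u => (1 / 2 : ℝ) • F'' (u + (1 : ℝ) • v) + (1 / 2 : ℝ) • F'' (u + (-1 : ℝ) • v),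
    fun u => ?_, fun u => ?_, fun u => ?_, fun u => ?_, fun u w => ?_⟩
  · exact ((hsh h1 1 u).const_mul (1 / 2)).add ((hsh h1 (-1) u).const_mul (1 / 2))
  · exact ((hsh h2 1 u).const_smul (1 / 2 : ℝ)).add ((hsh h2 (-1) u).const_smul (1 / 2 : ℝ))
  · exact norm_half_add_half_le (h3 _) (h3 _)
  · exact norm_half_add_half_le (E := EllTwo →L[ℝ] EllTwo →L[ℝ] ℝ) (h4 _) (h4 _)
  · have hsub : ∀ c : ℝ, ‖F'' (u + c • v) - F'' (w + c • v)‖ ≤ ‖u - w‖ := fun c =>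
      (h5 _ _).trans (by rw [add_sub_add_right_eq_sub])
    have := norm_half_add_half_le (E := EllTwo →L[ℝ] EllTwo →L[ℝ] ℝ) (hsub 1) (hsub (-1))
    convert! this using 2
    module

theorem integrable_id_rad : Integrable id rad := by
  refine Integrable.of_bound measurable_id.aestronglyMeasurable 1 ?_
  filter_upwards [ae_rad] with x hx
  rcases hx with h | h <;> simp [h]

/-- The induction peels off the last variable: the hypothesis for the averaged function makes the
first m variables Gaussian, then the last one is exchanged. So when variable j is exchanged all
those before it are Gaussian, whence the smoothing by exactly j vectors in `herr`. -/
theorem abs_integral_rad_sub_stdG_le (h : ℕ → EllTwo) (err : ℕ → ℝ) (m : ℕ)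
    (herr : ∀ F, IsTest F → ∀ j < m,
      |(1 / 2 * smoothed h j F ((1 : ℝ) • h j) + 1 / 2 * smoothed h j F ((-1 : ℝ) • h j))
        - ∫ x, smoothed h j F (x • h j) ∂stdG| ≤ err j) {F : EllTwo → ℝ} (hF : IsTest F) :
    |∫ y, F (sumVec h m y) ∂(Measure.pi fun _ : Fin m => rad) - ∫ y, F (sumVec h m y) ∂stdGpi m|
      ≤ ∑ j ∈ Finset.range m, err j := by
  induction m generalizing F with
  | zero => simp [sumVec]
  | succ m ih =>
    have hL := hF.abs_sub_le
    obtain ⟨hi1, he1⟩ := integrable_prod_sumVec integrable_id_rad h m hL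
    obtain ⟨hi2, he2⟩ := integrable_prod_sumVec integrable_id_stdG h m hL
    rw [he1, he2, integral_prod_symm _ hi1, integral_prod _ hi2]
    have h1 := ih (fun F hF j hj => herr F hF j (by omega)) (hF.average (h m))
    have h2 := herr F hF m (Nat.lt_succ_self m)
    have hi := integrable_sumVec_add integrable_id_stdG h m hL
    rw [integral_add ((hi _).const_mul _) ((hi _).const_mul _), integral_const_mul,
      integral_const_mul] at h1
    simp only [integral_rad, smul_eq_mul]
    rw [Finset.sum_range_succ]
    exact (abs_sub_le _ _ _).trans (add_le_add h1 h2)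

end Fubini

end DonskerRate

end

noncomputable section

namespace DonskerRate

/-! ### Comparison of the Rademacher and Gaussian sums -/

theorem sum_one_div_sqrt_le (m : ℕ) :
    ∑ j ∈ Finset.range m, 1 / Real.sqrt (j + 1) ≤ 2 * Real.sqrt m := by
  induction m with
  | zero => simp
  | succ m ih =>
    rw [Finset.sum_range_succ]
    have h1 : 0 < Real.sqrt ((m : ℝ) + 1) := Real.sqrt_pos.2 (by positivity)
    have h2 := Real.sq_sqrt (show (0 : ℝ) ≤ m + 1 by positivity)
    have h3 := Real.sq_sqrt (show (0 : ℝ) ≤ m by positivity)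
    have h4 : 1 / Real.sqrt ((m : ℝ) + 1) ≤ 2 * Real.sqrt ((m : ℝ) + 1) - 2 * Real.sqrt m := by
      rw [div_le_iff₀ h1]
      nlinarith [sq_nonneg (Real.sqrt ((m : ℝ) + 1) - Real.sqrt m)]
    push_cast
    linarith

/-- With b of order m^(-1/2), κ of order m^(-s) and s = α - 1/2, the sum over j < m of b³ (κ +
(j+1)^(-1/2)) is of order m^(-1/2-s) + m^(-1) = m^(-α) + m^(-1). -/
theorem exists_abs_integral_rad_sub_stdG_le {α : ℝ} (hα : 1 / 2 < α) (hα1 : α < 1)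
    (e : HilbertBasis ℕ ℝ L2I) : ∃ C : ℝ, ∀ m : ℕ, 1 ≤ m → ∀ F, IsTest F →
      |∫ y, F (sumVec (fun i => e.repr (rlOp α hα (stepUnit m i))) m y)
          ∂(Measure.pi fun _ : Fin m => rad)
        - ∫ y, F (sumVec (fun i => e.repr (rlOp α hα (stepUnit m i))) m y) ∂stdGpi m|
      ≤ C * ((m : ℝ) ^ (-α) + (m : ℝ) ^ (-1 : ℝ)) := by
  set C₀ := 1 / (α ^ 2 * (2 * α - 1) * Real.Gamma α ^ 2) with hC₀
  have hΓ : 0 < Real.Gamma α := Real.Gamma_pos_of_pos (by linarith)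
  have hC₀0 : 0 ≤ C₀ := by
    have : 0 < 2 * α - 1 := by linarith
    positivity
  set s := α - 1 / 2 with hs
  set Z := ∑' n : ℕ, (n : ℝ) ^ (s - 3 / 2) with hZ
  have hZ0 : 0 ≤ Z := tsum_nonneg fun n => by positivity
  set g := 1 + gaussMoment / 2
  have hg : 0 ≤ g := by
    have : 0 ≤ gaussMoment := integral_nonneg fun x => by positivity
    positivity
  refine ⟨Real.sqrt C₀ ^ 3 * g * ((2 + 4 * Z) * Real.sqrt 6 + 8), fun m hm F hF => ?_⟩
  have hm0 : (0 : ℝ) < m := by exact_mod_cast hm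
  set h : ℕ → EllTwo := fun i => e.repr (rlOp α hα (stepUnit m i)) with hh
  set b := Real.sqrt C₀ * (m : ℝ) ^ (-(1 / 2) : ℝ) with hb
  set κ := Real.sqrt 6 * (m : ℝ) ^ (-s) with hκ
  have hb0 : 0 ≤ b := by positivity
  have hκ0 : 0 ≤ κ := by positivity
  have e1 : ((m : ℝ) ^ (-(1 / 2) : ℝ)) ^ 2 = (m : ℝ)⁻¹ := by
    rw [← Real.rpow_natCast, ← Real.rpow_mul hm0.le]
    norm_num
    rw [Real.rpow_neg_one]
  have hbb : ∀ i < m, ‖h i‖ ≤ b := by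
    intro i hi
    have h1 := norm_rlOp_stepUnit_sq_le hα hα1.le hi
    rw [hh, LinearIsometryEquiv.norm_map]
    refine abs_le_of_sq_le_sq' (h1.trans (le_of_eq ?_)) hb0 |>.2
    rw [hb, mul_pow, Real.sq_sqrt hC₀0, e1, hC₀, div_eq_mul_inv]
  have hd : ∀ i k, i < k → k < m → ‖h i - h k‖ ≤ b * κ * ((k : ℝ) - i) ^ s := by
    intro i k hik hk
    have h1 := norm_rlOp_stepUnit_sub_sq_le hα hα1.le hik hk
    have hki : (0 : ℝ) < (k : ℝ) - i := sub_pos.2 (by exact_mod_cast hik)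
    simp only [hh]
    rw [← map_sub, LinearIsometryEquiv.norm_map]
    refine abs_le_of_sq_le_sq' (h1.trans (le_of_eq ?_)) (by positivity) |>.2
    rw [hb, hκ, mul_pow, mul_pow, mul_pow, mul_pow, Real.sq_sqrt hC₀0, Real.sq_sqrt (by norm_num),
      Real.div_rpow hki.le hm0.le]
    have e2 : ((m : ℝ) ^ (-s)) ^ 2 = ((m : ℝ) ^ (2 * α - 1))⁻¹ := by
      rw [← Real.rpow_natCast, ← Real.rpow_mul hm0.le, ← Real.rpow_neg hm0.le]
      congr 1; push_cast; rw [hs]; ring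
    have e3 : (((k : ℝ) - i) ^ s) ^ 2 = ((k : ℝ) - i) ^ (2 * α - 1) := by
      rw [← Real.rpow_natCast, ← Real.rpow_mul hki.le]
      congr 1; push_cast; rw [hs]; ring
    rw [e1, e2, e3, hC₀]
    ring
  have hmain := abs_integral_rad_sub_stdG_le h
    (fun j => b ^ 3 * ((2 + 4 * Z) * κ + 4 / Real.sqrt (j + 1)) * g) m
    (fun F hF j hj => hF.abs_exchange_le h j hb0 hκ0 (by linarith) (by linarith)
      (fun i hi => hbb i (by omega)) fun i k hik hk => hd i k hik (by omega)) hF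
  refine hmain.trans ?_
  rw [← Finset.sum_mul, ← Finset.mul_sum, Finset.sum_add_distrib, Finset.sum_const,
    Finset.card_range, nsmul_eq_mul]
  have h1 : ∑ j ∈ Finset.range m, 4 / Real.sqrt ((j : ℝ) + 1) ≤ 8 * Real.sqrt m := by
    have := sum_one_div_sqrt_le m
    calc _ = 4 * ∑ j ∈ Finset.range m, 1 / Real.sqrt ((j : ℝ) + 1) := by
          rw [Finset.mul_sum]; exact Finset.sum_congr rfl fun _ _ => by ring
      _ ≤ _ := by linarith
  have hb3 : b ^ 3 = Real.sqrt C₀ ^ 3 * (m : ℝ) ^ (-(3 / 2) : ℝ) := by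
    rw [hb, mul_pow, ← Real.rpow_natCast ((m : ℝ) ^ _), ← Real.rpow_mul hm0.le]
    norm_num
  have e4 : (m : ℝ) ^ (-(3 / 2) : ℝ) * (m * κ) = Real.sqrt 6 * (m : ℝ) ^ (-α) := by
    rw [hκ]
    have : (m : ℝ) ^ (-α) = (m : ℝ) ^ (-(3 / 2) : ℝ) * (m : ℝ) ^ (1 : ℝ) * (m : ℝ) ^ (-s) := by
      rw [← Real.rpow_add hm0, ← Real.rpow_add hm0]
      congr 1; rw [hs]; ring
    rw [this, Real.rpow_one]; ring
  have e5 : (m : ℝ) ^ (-(3 / 2) : ℝ) * Real.sqrt m = (m : ℝ) ^ (-1 : ℝ) := by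
    rw [Real.sqrt_eq_rpow, ← Real.rpow_add hm0]
    norm_num
  have hp1 : 0 ≤ (m : ℝ) ^ (-α) := by positivity
  have hp2 : 0 ≤ (m : ℝ) ^ (-1 : ℝ) := by positivity
  calc b ^ 3 * (m * ((2 + 4 * Z) * κ) + ∑ j ∈ Finset.range m, 4 / Real.sqrt ((j : ℝ) + 1)) * g
      ≤ b ^ 3 * (m * ((2 + 4 * Z) * κ) + 8 * Real.sqrt m) * g := by gcongr
    _ = Real.sqrt C₀ ^ 3 * g * ((2 + 4 * Z) * ((m : ℝ) ^ (-(3 / 2) : ℝ) * (m * κ))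
          + 8 * ((m : ℝ) ^ (-(3 / 2) : ℝ) * Real.sqrt m)) := by rw [hb3]; ring
    _ = Real.sqrt C₀ ^ 3 * g * ((2 + 4 * Z) * Real.sqrt 6 * (m : ℝ) ^ (-α)
          + 8 * (m : ℝ) ^ (-1 : ℝ)) := by rw [e4, e5]; ring
    _ ≤ Real.sqrt C₀ ^ 3 * g * (((2 + 4 * Z) * Real.sqrt 6 + 8) * (m : ℝ) ^ (-α)
          + ((2 + 4 * Z) * Real.sqrt 6 + 8) * (m : ℝ) ^ (-1 : ℝ)) := by
        have : 0 ≤ (2 + 4 * Z) * Real.sqrt 6 := by positivity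
        gcongr <;> linarith
    _ = _ := by ring

end DonskerRate

end

/-! ### From the finite Gaussian sum to the Gaussian series, and its identification with `mBeta`. -/

noncomputable section

namespace DonskerRate

/-! ### Gaussian series in `ℓ²` -/

instance : SecondCountableTopology EllTwo := by
  have h1 : TopologicalSpace.IsSeparable (closure (Submodule.span ℝ (Set.range xvec) : Set EllTwo)) :=
    ((Set.countable_range xvec).isSeparable.span).closure
  have h2 : closure (Submodule.span ℝ (Set.range xvec) : Set EllTwo) = Set.univ := by
    refine Set.eq_univ_of_forall fun v => ?_
    refine mem_closure_of_tendsto (hasSum_smul_xvec v).tendsto_sum_nat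
      (Eventually.of_forall fun N => ?_)
    exact Submodule.sum_mem _ fun n _ => Submodule.smul_mem _ _ (Submodule.subset_span ⟨n, rfl⟩)
  rw [h2] at h1
  have : TopologicalSpace.SeparableSpace EllTwo := TopologicalSpace.isSeparable_univ_iff.1 h1
  exact UniformSpace.secondCountable_of_separable EllTwo

/-- The law of a sequence of independent standard Gaussian variables. -/
abbrev gaussSeq : Measure (ℕ → ℝ) := Measure.infinitePi fun _ : ℕ => gaussianReal 0 1

theorem measurePreserving_eval_gaussSeq (n : ℕ) :
    MeasurePreserving (fun x : ℕ → ℝ => x n) gaussSeq stdG :=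
  measurePreserving_eval_infinitePi (fun _ : ℕ => gaussianReal 0 1) n

theorem iIndepFun_gaussSeq : iIndepFun (fun (n : ℕ) (x : ℕ → ℝ) => x n) gaussSeq :=
  iIndepFun_infinitePi (P := fun _ : ℕ => gaussianReal 0 1) (X := fun _ x => x)
    fun _ => measurable_id

theorem gaussSeq_map_fin (N : ℕ) :
    gaussSeq.map (fun x (i : Fin N) => x i) = stdGpi N := by
  have h1 : iIndepFun (fun (i : Fin N) (x : ℕ → ℝ) => x i) gaussSeq :=
    iIndepFun_gaussSeq.precomp Fin.val_injective
  rw [(iIndepFun_iff_map_fun_eq_pi_map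
    fun i : Fin N => (measurable_pi_apply (i : ℕ)).aemeasurable).1 h1]
  congr 1
  funext i
  exact (measurePreserving_eval_gaussSeq i).map_eq

theorem memLp_coord (n : ℕ) : MemLp (fun x : ℕ → ℝ => x n) 2 gaussSeq := by
  have h : MemLp id 2 stdG := by simpa using memLp_id_gaussianReal (μ := 0) (v := 1) 2
  exact h.comp_measurePreserving (measurePreserving_eval_gaussSeq n)

theorem integral_coord (n : ℕ) : ∫ x, x n ∂gaussSeq = 0 := by
  have h := (measurePreserving_eval_gaussSeq n).map_eq
  have h1 := integral_map (μ := gaussSeq) (φ := fun x : ℕ → ℝ => x n) (f := fun y : ℝ => y)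
    (measurable_pi_apply n).aemeasurable measurable_id.aestronglyMeasurable
  rw [h, integral_id_gaussianReal] at h1
  exact h1.symm

theorem integral_coord_mul_coord (i j : ℕ) :
    ∫ x, x i * x j ∂gaussSeq = if i = j then 1 else 0 := by
  split_ifs with h
  · subst h
    have h := (measurePreserving_eval_gaussSeq i).map_eq
    have h1 := integral_map (μ := gaussSeq) (φ := fun x : ℕ → ℝ => x i) (f := fun y : ℝ => y ^ 2)
      (measurable_pi_apply i).aemeasurable (by fun_prop)
    rw [h, integral_sq_stdG] at h1
    simp_rw [← sq]
    exact h1.symm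
  · have := (iIndepFun_gaussSeq.indepFun h).integral_fun_mul_eq_mul_integral
      (memLp_coord i).aestronglyMeasurable (memLp_coord j).aestronglyMeasurable
    rw [this, integral_coord, zero_mul]

theorem memLp_coord_smul (n : ℕ) (a : EllTwo) :
    MemLp (fun x : ℕ → ℝ => x n • a) 2 gaussSeq := by
  have h := (memLp_coord n)
  refine MemLp.of_le_mul (c := ‖a‖) h (h.aestronglyMeasurable.smul_const a) (ae_of_all _ fun x => ?_)
  rw [norm_smul, mul_comm]

theorem inner_coord_smul (i j : ℕ) (a b : EllTwo) :
    ⟪(memLp_coord_smul i a).toLp, (memLp_coord_smul j b).toLp⟫_ℝ = if i = j then ⟪a, b⟫_ℝ else 0 := by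
  rw [L2.inner_def]
  have : ∫ x, ⟪(memLp_coord_smul i a).toLp _ x, (memLp_coord_smul j b).toLp _ x⟫_ℝ ∂gaussSeq
      = ∫ x : ℕ → ℝ, (x i * x j) * ⟪a, b⟫_ℝ ∂gaussSeq := by
    refine integral_congr_ae ?_
    filter_upwards [(memLp_coord_smul i a).coeFn_toLp, (memLp_coord_smul j b).coeFn_toLp]
      with x h1 h2
    rw [h1, h2, inner_smul_left, inner_smul_right, conj_trivial]
    ring
  rw [this, integral_mul_const, integral_coord_mul_coord]
  split_ifs <;> simp

/-- The random vectors `x_n • a` as elements of `L²`. -/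
def gaussTerm (n : ℕ) : EllTwo →ₗᵢ[ℝ] Lp EllTwo 2 gaussSeq where
  toFun a := (memLp_coord_smul n a).toLp
  map_add' a b := by
    rw [← MemLp.toLp_add]
    exact MemLp.toLp_congr _ _ (ae_of_all _ fun x => smul_add _ _ _)
  map_smul' c a := by
    rw [RingHom.id_apply, ← MemLp.toLp_const_smul]
    exact MemLp.toLp_congr _ _ (ae_of_all _ fun x => smul_comm _ _ _)
  norm_map' a := by
    have h := inner_coord_smul n n a a
    rw [if_pos rfl, real_inner_self_eq_norm_sq, real_inner_self_eq_norm_sq] at h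
    exact (pow_left_inj₀ (norm_nonneg _) (norm_nonneg _) two_ne_zero).1 h

theorem gaussTerm_coeFn (n : ℕ) (a : EllTwo) : gaussTerm n a =ᵐ[gaussSeq] fun x => x n • a :=
  (memLp_coord_smul n a).coeFn_toLp

theorem orthogonalFamily_gaussTerm : OrthogonalFamily ℝ (fun _ : ℕ => EllTwo) gaussTerm := by
  intro i j hij a b
  exact (inner_coord_smul i j a b).trans (if_neg hij)

/-- The Gaussian series `∑ xₙ aₙ`. -/
def gaussSeries (a : ℕ → EllTwo) : Lp EllTwo 2 gaussSeq := ∑' n, gaussTerm n (a n)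

/-- The law of the Gaussian series `∑ xₙ aₙ`. -/
def gaussLaw (a : ℕ → EllTwo) : Measure EllTwo := gaussSeq.map (gaussSeries a)

theorem aemeasurable_gaussSeries (a : ℕ → EllTwo) : AEMeasurable (gaussSeries a) gaussSeq :=
  (Lp.aestronglyMeasurable _).aemeasurable

instance (a : ℕ → EllTwo) : IsProbabilityMeasure (gaussLaw a) :=
  Measure.isProbabilityMeasure_map (aemeasurable_gaussSeries a)

section Series

variable {a : ℕ → EllTwo} (ha : Summable fun n => ‖a n‖ ^ 2)
include ha

theorem hasSum_gaussSeries : HasSum (fun n => gaussTerm n (a n)) (gaussSeries a) :=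
  ((orthogonalFamily_gaussTerm.summable_iff_norm_sq_summable a).2 ha).hasSum

/-- Convergence in L² implies convergence in measure, hence almost surely along a subsequence; this
is enough to pass to the limit in characteristic functions and in paths. -/
theorem exists_subseq_tendsto_gaussSeries : ∃ ns : ℕ → ℕ, StrictMono ns ∧
    ∀ᵐ x ∂gaussSeq, Tendsto (fun k => sumVec a (ns k) (fun i => x i)) atTop (𝓝 (gaussSeries a x)) := by
  obtain ⟨ns, hns, h⟩ :=
    (tendstoInMeasure_of_tendsto_Lp (hasSum_gaussSeries ha).tendsto_sum_nat).exists_seq_tendsto_ae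
  refine ⟨ns, hns, ?_⟩
  have h1 : ∀ᵐ x ∂gaussSeq, ∀ N, (∑ n ∈ Finset.range N, gaussTerm n (a n) : Lp EllTwo 2 gaussSeq) x
      = sumVec a N fun i => x i := by
    refine ae_all_iff.2 fun N => ?_
    have h2 : ∀ᵐ x ∂gaussSeq, ∀ n, gaussTerm n (a n) x = x n • a n :=
      ae_all_iff.2 fun n => gaussTerm_coeFn n (a n)
    filter_upwards [h2, Lp.coeFn_finsetSum (Finset.range N) fun n => gaussTerm n (a n)] with x h2 h3
    rw [h3, Finset.sum_apply, sumVec, Fin.sum_univ_eq_sum_range (fun i => x i • a i)]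
    exact Finset.sum_congr rfl fun n _ => h2 n
  filter_upwards [h, h1] with x h h1
  simpa only [h1] using h

theorem integral_inner_gaussLaw (v : EllTwo) : ∫ r, ⟪v, r⟫_ℝ ∂gaussLaw a = 0 := by
  rw [gaussLaw, integral_map (aemeasurable_gaussSeries a) (by fun_prop)]
  have hc : MemLp (fun _ : ℕ → ℝ => v) 2 gaussSeq := memLp_const v
  have h1 : ∀ T : Lp EllTwo 2 gaussSeq, ⟪hc.toLp, T⟫_ℝ = ∫ x, ⟪v, T x⟫_ℝ ∂gaussSeq := by
    intro T
    rw [L2.inner_def]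
    refine integral_congr_ae ?_
    filter_upwards [hc.coeFn_toLp] with x hx
    rw [hx]
  have h2 := (hasSum_gaussSeries ha).mapL (innerSL ℝ hc.toLp)
  simp only [innerSL_apply_apply] at h2
  rw [← h1]
  refine h2.unique ?_
  convert! (hasSum_zero : HasSum (fun _ : ℕ => (0 : ℝ)) 0) using 2 with n
  rw [h1]
  have : ∫ x, ⟪v, gaussTerm n (a n) x⟫_ℝ ∂gaussSeq = ∫ x : ℕ → ℝ, x n * ⟪v, a n⟫_ℝ ∂gaussSeq := by
    refine integral_congr_ae ?_
    filter_upwards [gaussTerm_coeFn n (a n)] with x hx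
    rw [hx, inner_smul_right]
  rw [this, integral_mul_const, integral_coord, zero_mul]

theorem integral_norm_sq_gaussLaw_le : Integrable (fun r => ‖r‖ ^ 2) (gaussLaw a) ∧
    ∫ r, ‖r‖ ^ 2 ∂gaussLaw a ≤ ∑' n, ‖a n‖ ^ 2 := by
  have hm := aemeasurable_gaussSeries a
  have hi : Integrable (fun x => ‖gaussSeries a x‖ ^ 2) gaussSeq :=
    (Lp.memLp (gaussSeries a)).integrable_norm_pow two_ne_zero
  refine ⟨(integrable_map_measure (by fun_prop) hm).2 hi, ?_⟩
  rw [gaussLaw, integral_map hm (by fun_prop)]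
  have h1 : ∫ x, ‖gaussSeries a x‖ ^ 2 ∂gaussSeq = ‖gaussSeries a‖ ^ 2 := by
    rw [← real_inner_self_eq_norm_sq, L2.inner_def]
    simp_rw [real_inner_self_eq_norm_sq]
  rw [h1]
  refine le_of_tendsto ((hasSum_gaussSeries ha).tendsto_sum_nat.norm.pow 2)
    (Eventually.of_forall fun N => ?_)
  rw [orthogonalFamily_gaussTerm.norm_sum]
  exact ha.sum_le_tsum _ fun n _ => sq_nonneg _

end Series

theorem charFun_map_sumVec (h : ℕ → EllTwo) (m : ℕ) (ξ : EllTwo) :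
    charFun ((stdGpi m).map (sumVec h m)) ξ
      = Complex.exp (-((∑ j ∈ Finset.range m, ⟪h j, ξ⟫_ℝ ^ 2 : ℝ) : ℂ) / 2) := by
  rw [charFun_apply, integral_map (measurable_sumVec h m).aemeasurable (by fun_prop)]
  have h1 : ∀ y : Fin m → ℝ, Complex.exp ((⟪sumVec h m y, ξ⟫_ℝ : ℂ) * Complex.I)
      = ∏ j : Fin m, Complex.exp ((⟪h j, ξ⟫_ℝ : ℂ) * (y j : ℂ) * Complex.I) := by
    intro y
    rw [← Complex.exp_sum, ← Finset.sum_mul, sumVec, sum_inner]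
    push_cast
    congr 2
    refine Finset.sum_congr rfl fun j _ => ?_
    rw [inner_smul_left, conj_trivial]
    push_cast; ring
  simp_rw [h1]
  rw [integral_fintype_prod_eq_prod (μ := fun _ : Fin m => stdG)
    (f := fun (j : Fin m) (y : ℝ) => Complex.exp ((⟪h j, ξ⟫_ℝ : ℂ) * (y : ℂ) * Complex.I))]
  simp_rw [← charFun_apply_real, charFun_gaussianReal]
  rw [← Complex.exp_sum, ← Fin.sum_univ_eq_sum_range (fun j => ⟪h j, ξ⟫_ℝ ^ 2)]
  congr 1
  push_cast
  rw [← Finset.sum_neg_distrib, Finset.sum_div]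
  refine Finset.sum_congr rfl fun j _ => ?_
  simp; ring

theorem charFun_gaussLaw {a : ℕ → EllTwo} (ha : Summable fun n => ‖a n‖ ^ 2) {ξ : EllTwo} {σ : ℝ}
    (hσ : HasSum (fun n => ⟪a n, ξ⟫_ℝ ^ 2) σ) :
    charFun (gaussLaw a) ξ = Complex.exp (-(σ : ℂ) / 2) := by
  obtain ⟨ns, hns, h⟩ := exists_subseq_tendsto_gaussSeries ha
  have hS : ∀ N, Measurable fun x : ℕ → ℝ => sumVec a N (fun i => x i) := fun N =>
    (measurable_sumVec a N).comp (measurable_pi_lambda _ fun i => measurable_pi_apply _)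
  have h1 : Tendsto (fun k => charFun ((stdGpi (ns k)).map (sumVec a (ns k))) ξ) atTop
      (𝓝 (Complex.exp (-(σ : ℂ) / 2))) := by
    simp_rw [charFun_map_sumVec]
    have h2 : Tendsto (fun k => ∑ j ∈ Finset.range (ns k), ⟪a j, ξ⟫_ℝ ^ 2) atTop (𝓝 σ) :=
      hσ.tendsto_sum_nat.comp hns.tendsto_atTop
    have h3 : Continuous fun s : ℝ => Complex.exp (-(s : ℂ) / 2) := by fun_prop
    exact (h3.tendsto σ).comp h2
  refine tendsto_nhds_unique ?_ h1
  have h2 : ∀ N, (stdGpi N).map (sumVec a N) = gaussSeq.map fun x => sumVec a N (fun i => x i) := by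
    intro N
    rw [← gaussSeq_map_fin, Measure.map_map (measurable_sumVec a N)
      (measurable_pi_lambda _ fun i => measurable_pi_apply _)]
    rfl
  simp_rw [h2, charFun_apply]
  rw [gaussLaw, integral_map (aemeasurable_gaussSeries a) (by fun_prop)]
  simp_rw [fun N => integral_map (μ := gaussSeq) (hS N).aemeasurable
    (f := fun v : EllTwo => Complex.exp ((⟪v, ξ⟫_ℝ : ℂ) * Complex.I)) (by fun_prop)]
  refine tendsto_integral_of_dominated_convergence (fun _ => 1) (fun k => ?_) (integrable_const _)
    (fun k => ae_of_all _ fun x => ?_) ?_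
  · have : Continuous fun v : EllTwo => Complex.exp ((⟪v, ξ⟫_ℝ : ℂ) * Complex.I) := by fun_prop
    exact (this.measurable.comp (hS _)).aestronglyMeasurable
  · rw [Complex.norm_exp_ofReal_mul_I]
  · filter_upwards [h] with x hx
    have : Continuous fun v : EllTwo => Complex.exp ((⟪v, ξ⟫_ℝ : ℂ) * Complex.I) := by fun_prop
    exact (this.tendsto _).comp hx

end DonskerRate

end

noncomputable section

namespace DonskerRate

/-! ### Projection of a Gaussian series on finitely many directions -/

section Projection

variable (e : HilbertBasis ℕ ℝ L2I) {f : ℕ → L2I} {m : ℕ}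
  (hf : ∀ i < m, ∀ j < m, ⟪f i, f j⟫_ℝ = if i = j then 1 else 0)

theorem hasSum_inner_sq (v : L2I) : HasSum (fun n => ⟪e n, v⟫_ℝ ^ 2) (‖v‖ ^ 2) := by
  have h := e.hasSum_inner_mul_inner v v
  rw [real_inner_self_eq_norm_sq] at h
  convert! h using 2 with n
  rw [real_inner_comm (e n) v, sq]

/-- The component of `v` orthogonal to `f 0, …, f (m - 1)`. -/
def orthPart (f : ℕ → L2I) (m : ℕ) (v : L2I) : L2I :=
  v - ∑ j ∈ Finset.range m, ⟪f j, v⟫_ℝ • f j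

theorem inner_orthPart_left (u v : L2I) : ⟪orthPart f m u, v⟫_ℝ = ⟪u, orthPart f m v⟫_ℝ := by
  rw [orthPart, orthPart, inner_sub_left, inner_sub_right, sum_inner, inner_sum]
  congr 1
  refine Finset.sum_congr rfl fun j _ => ?_
  rw [inner_smul_left, inner_smul_right, conj_trivial, real_inner_comm u (f j), mul_comm]

include hf

theorem norm_orthPart_sq (v : L2I) :
    ‖orthPart f m v‖ ^ 2 = ‖v‖ ^ 2 - ∑ j ∈ Finset.range m, ⟪f j, v⟫_ℝ ^ 2 := by
  have h1 : orthPart f m (orthPart f m v) = orthPart f m v := by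
    rw [orthPart, sub_eq_self]
    refine Finset.sum_eq_zero fun i hi => ?_
    have : ⟪f i, orthPart f m v⟫_ℝ = 0 := by
      rw [orthPart, inner_sub_right, inner_sum, Finset.sum_eq_single_of_mem i hi, inner_smul_right,
        hf i (Finset.mem_range.1 hi) i (Finset.mem_range.1 hi), if_pos rfl, mul_one, sub_self]
      intro j hj hji
      rw [inner_smul_right, hf i (Finset.mem_range.1 hi) j (Finset.mem_range.1 hj),
        if_neg hji.symm, mul_zero]
    rw [this, zero_smul]
  rw [← real_inner_self_eq_norm_sq, inner_orthPart_left, h1, orthPart, inner_sub_right,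
    real_inner_self_eq_norm_sq, inner_sum]
  congr 1
  refine Finset.sum_congr rfl fun j _ => ?_
  rw [inner_smul_right, real_inner_comm v (f j), sq]

variable (D : L2I →L[ℝ] EllTwo)

/-- Expand the square and sum each term by Parseval: the cross terms give -2 ∑ ‖D f_j‖² and, by
orthonormality, the double sum gives back ∑ ‖D f_j‖². -/
theorem hasSum_norm_orthPart_sq {S : ℝ} (hS : HasSum (fun n => ‖D (e n)‖ ^ 2) S) :
    HasSum (fun n => ‖D (orthPart f m (e n))‖ ^ 2)
      (S - ∑ j ∈ Finset.range m, ‖D (f j)‖ ^ 2) := by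
  have hadj : ∀ u v, ⟪D u, D v⟫_ℝ = ⟪u, ContinuousLinearMap.adjoint D (D v)⟫_ℝ := fun u v =>
    (ContinuousLinearMap.adjoint_inner_right D u (D v)).symm
  have h1 : ∀ n, ‖D (orthPart f m (e n))‖ ^ 2 = ‖D (e n)‖ ^ 2
      - 2 * (∑ j ∈ Finset.range m, ⟪f j, e n⟫_ℝ * ⟪e n, ContinuousLinearMap.adjoint D (D (f j))⟫_ℝ)
      + ∑ i ∈ Finset.range m, ∑ j ∈ Finset.range m,
        (⟪f i, e n⟫_ℝ * ⟪e n, f j⟫_ℝ) * ⟪D (f i), D (f j)⟫_ℝ := by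
    intro n
    rw [orthPart, map_sub, map_sum, norm_sub_sq_real, ← real_inner_self_eq_norm_sq (∑ j ∈ _, _),
      inner_sum, sum_inner]
    simp only [map_smul, inner_smul_right, inner_smul_left, conj_trivial, inner_sum]
    simp_rw [hadj (e n)]
    congr 1
    refine Finset.sum_congr rfl fun i _ => ?_
    refine Finset.sum_congr rfl fun j _ => ?_
    rw [real_inner_comm (f j) (e n)]
    ring
  simp_rw [h1]
  have h2 : HasSum (fun n => ∑ j ∈ Finset.range m,
      ⟪f j, e n⟫_ℝ * ⟪e n, ContinuousLinearMap.adjoint D (D (f j))⟫_ℝ)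
      (∑ j ∈ Finset.range m, ‖D (f j)‖ ^ 2) := by
    refine hasSum_sum fun j _ => ?_
    have := e.hasSum_inner_mul_inner (f j) (ContinuousLinearMap.adjoint D (D (f j)))
    rwa [← hadj, real_inner_self_eq_norm_sq] at this
  have h3 : HasSum (fun n => ∑ i ∈ Finset.range m, ∑ j ∈ Finset.range m,
      (⟪f i, e n⟫_ℝ * ⟪e n, f j⟫_ℝ) * ⟪D (f i), D (f j)⟫_ℝ)
      (∑ j ∈ Finset.range m, ‖D (f j)‖ ^ 2) := by
    refine hasSum_sum fun i hi => ?_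
    have : ‖D (f i)‖ ^ 2 = ∑ j ∈ Finset.range m, ⟪f i, f j⟫_ℝ * ⟪D (f i), D (f j)⟫_ℝ := by
      rw [Finset.sum_eq_single_of_mem i hi, hf i (Finset.mem_range.1 hi) i (Finset.mem_range.1 hi),
        if_pos rfl, one_mul, real_inner_self_eq_norm_sq]
      intro j hj hji
      rw [hf i (Finset.mem_range.1 hi) j (Finset.mem_range.1 hj), if_neg hji.symm, zero_mul]
    rw [this]
    exact hasSum_sum fun j _ => (e.hasSum_inner_mul_inner (f i) (f j)).mul_right _
  convert! (hS.sub (h2.mul_left 2)).add h3 using 1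
  ring

/-- Compare characteristic functions: the exponent of the left side is -‖D*ξ‖²/2, and Pythagoras
splits ‖D*ξ‖² into the part along the f_j and the orthogonal part. No independent copies need be
constructed. -/
theorem gaussLaw_eq_conv (hS : Summable fun n => ‖D (e n)‖ ^ 2) :
    gaussLaw (fun n => D (e n))
      = ((stdGpi m).map (sumVec (fun j => D (f j)) m)) ∗ gaussLaw (fun n => D (orthPart f m (e n))) := by
  have hW : IsProbabilityMeasure ((stdGpi m).map (sumVec (fun j => D (f j)) m)) :=
    Measure.isProbabilityMeasure_map (measurable_sumVec _ m).aemeasurable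
  refine Measure.ext_of_charFun (funext fun ξ => ?_)
  set ζ := ContinuousLinearMap.adjoint D ξ
  have hζ : ∀ u, ⟪D u, ξ⟫_ℝ = ⟪u, ζ⟫_ℝ := fun u => (ContinuousLinearMap.adjoint_inner_right D u ξ).symm
  have h1 : HasSum (fun n => ⟪D (e n), ξ⟫_ℝ ^ 2) (‖ζ‖ ^ 2) := by
    simp_rw [hζ]
    exact hasSum_inner_sq e ζ
  have h2 : HasSum (fun n => ⟪D (orthPart f m (e n)), ξ⟫_ℝ ^ 2) (‖orthPart f m ζ‖ ^ 2) := by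
    simp_rw [hζ, inner_orthPart_left]
    exact hasSum_inner_sq e _
  rw [charFun_conv, charFun_gaussLaw hS h1,
    charFun_gaussLaw (hasSum_norm_orthPart_sq e hf D hS.hasSum).summable h2, charFun_map_sumVec,
    ← Complex.exp_add, norm_orthPart_sq hf]
  simp_rw [hζ]
  congr 1
  push_cast
  ring

end Projection

/-! ### Adding a centred remainder -/

theorem IsTest.abs_taylor_le {F : EllTwo → ℝ} {F' : EllTwo → EllTwo →L[ℝ] ℝ}
    (hF : ∀ x, HasFDerivAt F (F' x) x) (hF' : ∀ x y, ‖F' x - F' y‖ ≤ ‖x - y‖) (w r : EllTwo) :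
    |F (w + r) - F w - F' w r| ≤ ‖r‖ ^ 2 / 2 := by
  have hc : Continuous F' := (LipschitzWith.of_dist_le_mul (K := 1) fun x y => by
    simpa [dist_eq_norm] using hF' x y).continuous
  have hd : ∀ t : ℝ, HasDerivAt (fun t : ℝ => F (w + t • r)) (F' (w + t • r) r) t := by
    intro t
    have h1 : HasDerivAt (fun t : ℝ => w + t • r) r t := by
      simpa using ((hasDerivAt_id t).smul_const r).const_add w
    exact (hF _).comp_hasDerivAt t h1
  have hc1 : Continuous fun t : ℝ => F' (w + t • r) r :=
    (hc.comp (by fun_prop)).clm_apply continuous_const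
  have h1 : ∫ t in (0 : ℝ)..1, (F' (w + t • r) r - F' w r) = F (w + r) - F w - F' w r := by
    rw [intervalIntegral.integral_sub (hc1.intervalIntegrable _ _) intervalIntegrable_const,
      intervalIntegral.integral_eq_sub_of_hasDerivAt (fun t _ => hd t) (hc1.intervalIntegrable _ _)]
    simp
  have h2 := intervalIntegral.norm_integral_le_of_norm_le (μ := volume) (a := 0) (b := 1)
    (f := fun t => F' (w + t • r) r - F' w r) (g := fun t => ‖r‖ ^ 2 * t) zero_le_one
    (ae_of_all _ fun t ht => by
      rw [← _root_.sub_apply]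
      refine (ContinuousLinearMap.le_opNorm _ _).trans ?_
      calc _ ≤ ‖w + t • r - w‖ * ‖r‖ := by gcongr; exact hF' _ _
        _ = _ := by
          rw [add_sub_cancel_left, norm_smul, Real.norm_of_nonneg ht.1.le]; ring)
    ((continuous_const.mul continuous_id).intervalIntegrable _ _)
  rw [h1, intervalIntegral.integral_const_mul, integral_id] at h2
  norm_num at h2
  linarith

theorem IsTest.integrable {F : EllTwo → ℝ} (hF : IsTest F) {μ : Measure EllTwo}
    [IsFiniteMeasure μ] (hμ : Integrable (fun r => ‖r‖) μ) : Integrable F μ := by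
  have h1 := hF.abs_sub_le
  refine (hμ.add (integrable_const |F 0|)).mono'
    (continuous_of_abs_sub_le h1).aestronglyMeasurable (ae_of_all _ fun r => ?_)
  have h2 := h1 r 0
  have h3 := abs_sub_abs_le_abs_sub (F r) (F 0)
  rw [sub_zero, one_mul] at h2
  simp only [Pi.add_apply, Real.norm_eq_abs]
  linarith

theorem integrable_norm_of_sq {μ : Measure EllTwo} [IsFiniteMeasure μ]
    (h : Integrable (fun r => ‖r‖ ^ 2) μ) : Integrable (fun r => ‖r‖) μ := by
  refine (h.add (integrable_const 1)).mono' (by fun_prop) (ae_of_all _ fun r => ?_)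
  simp only [Pi.add_apply, norm_norm]
  nlinarith [sq_nonneg (‖r‖ - 1), norm_nonneg r]

/-- The added variable is independent and centred, so the first order term integrates to zero and
the second order one is at most ‖r‖²/2. -/
theorem IsTest.abs_integral_conv_sub_le {F : EllTwo → ℝ} (hF : IsTest F) {μ ρ : Measure EllTwo}
    [IsProbabilityMeasure μ] [IsProbabilityMeasure ρ] (hμ : Integrable (fun r => ‖r‖) μ)
    (hρ : Integrable (fun r => ‖r‖ ^ 2) ρ) (hρ0 : ∀ v, ∫ r, ⟪v, r⟫_ℝ ∂ρ = 0) :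
    |∫ x, F x ∂μ - ∫ x, F x ∂(μ ∗ ρ)| ≤ (∫ r, ‖r‖ ^ 2 ∂ρ) / 2 := by
  have hFc := continuous_of_abs_sub_le hF.abs_sub_le
  have hρ1 := integrable_norm_of_sq hρ
  have hFi := hF.integrable hμ
  have hshift : ∀ w, Integrable (fun r => F (w + r)) ρ := by
    intro w
    refine ((hρ1.add (integrable_const ‖w‖)).add (integrable_const |F 0|)).mono'
      (hFc.comp (by fun_prop)).aestronglyMeasurable (ae_of_all _ fun r => ?_)
    have h2 := hF.abs_sub_le (w + r) 0
    have h3 := abs_sub_abs_le_abs_sub (F (w + r)) (F 0)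
    have h4 := norm_add_le w r
    rw [sub_zero, one_mul] at h2
    simp only [Pi.add_apply, Real.norm_eq_abs]
    linarith
  have hprod : Integrable (fun p : EllTwo × EllTwo => F (p.1 + p.2)) (μ.prod ρ) := by
    refine (((hμ.comp_fst ρ).add (hρ1.comp_snd μ)).add (integrable_const |F 0|)).mono'
      (hFc.comp (by fun_prop)).aestronglyMeasurable (ae_of_all _ fun p => ?_)
    have h2 := hF.abs_sub_le (p.1 + p.2) 0
    have h3 := abs_sub_abs_le_abs_sub (F (p.1 + p.2)) (F 0)
    have h4 := norm_add_le p.1 p.2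
    rw [sub_zero, one_mul] at h2
    simp only [Pi.add_apply, Real.norm_eq_abs]
    linarith
  have h1 : ∫ x, F x ∂(μ ∗ ρ) = ∫ w, ∫ r, F (w + r) ∂ρ ∂μ := by
    rw [Measure.conv, integral_map (by fun_prop) hFc.aestronglyMeasurable, integral_prod _ hprod]
  rw [h1, ← integral_sub hFi hprod.integral_prod_left]
  obtain ⟨F', F'', d1, d2, b1, b2, -⟩ := hF
  have hL : ∀ x y, ‖F' x - F' y‖ ≤ ‖x - y‖ := by
    intro x y
    have := Convex.norm_image_sub_le_of_norm_hasFDerivWithin_le (𝕜 := ℝ)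
      (fun z _ => (d2 z).hasFDerivWithinAt) (fun z _ => b2 z) convex_univ (Set.mem_univ y)
      (Set.mem_univ x)
    simpa using this
  have h2 : ∀ w, ‖F w - ∫ r, F (w + r) ∂ρ‖ ≤ (∫ r, ‖r‖ ^ 2 ∂ρ) / 2 := by
    intro w
    have hlin : ∫ r, F' w r ∂ρ = 0 := by
      rw [← hρ0 ((InnerProductSpace.toDual ℝ EllTwo).symm (F' w))]
      simp_rw [InnerProductSpace.toDual_symm_apply]
    have hlini : Integrable (fun r => F' w r) ρ := by
      refine (hρ1.const_mul ‖F' w‖).mono' (by fun_prop)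
        (ae_of_all _ fun r => ContinuousLinearMap.le_opNorm _ _)
    have h3 : ∫ r, (F (w + r) - F w - F' w r) ∂ρ = ∫ r, F (w + r) ∂ρ - F w := by
      rw [integral_sub (f := fun r => F (w + r) - F w) ((hshift w).sub (integrable_const _)) hlini,
        integral_sub (hshift w) (integrable_const _), hlin]
      simp
    rw [norm_sub_rev, ← h3, ← integral_div]
    exact norm_integral_le_of_norm_le (hρ.div_const 2)
      (ae_of_all _ fun r => IsTest.abs_taylor_le d1 hL w r)
  have := norm_integral_le_of_norm_le_const (μ := μ) (ae_of_all _ h2)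
  simpa using this

theorem abs_integral_sumVec_sub_gaussLaw_le (e : HilbertBasis ℕ ℝ L2I) {f : ℕ → L2I} {m : ℕ}
    (hf : ∀ i < m, ∀ j < m, ⟪f i, f j⟫_ℝ = if i = j then 1 else 0) (D : L2I →L[ℝ] EllTwo) {S : ℝ}
    (hS : HasSum (fun n => ‖D (e n)‖ ^ 2) S) {F : EllTwo → ℝ} (hF : IsTest F) :
    |∫ y, F (sumVec (fun j => D (f j)) m y) ∂stdGpi m - ∫ x, F x ∂gaussLaw (fun n => D (e n))|
      ≤ (S - ∑ j ∈ Finset.range m, ‖D (f j)‖ ^ 2) / 2 := by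
  have hm := (measurable_sumVec (fun j => D (f j)) m).aemeasurable (μ := stdGpi m)
  have hW : IsProbabilityMeasure ((stdGpi m).map (sumVec (fun j => D (f j)) m)) :=
    Measure.isProbabilityMeasure_map hm
  have hr := hasSum_norm_orthPart_sq e hf D hS
  obtain ⟨h1, h2⟩ := integral_norm_sq_gaussLaw_le hr.summable
  have hi : Integrable (fun r => ‖r‖) ((stdGpi m).map (sumVec (fun j => D (f j)) m)) := by
    refine (integrable_map_measure (by fun_prop) hm).2 ?_
    have := integrable_sumVec_add integrable_id_stdG (fun j => D (f j)) m (f := fun v => ‖v‖)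
      (C := 1) (fun u v => by rw [one_mul]; exact abs_norm_sub_norm_le u v) 0
    simpa [Function.comp_def] using this
  have h3 := hF.abs_integral_conv_sub_le hi h1 (integral_inner_gaussLaw hr.summable)
  rw [← gaussLaw_eq_conv e hf D hS.summable, integral_map hm
    (continuous_of_abs_sub_le hF.abs_sub_le).aestronglyMeasurable] at h3
  rw [hr.tsum_eq] at h2
  linarith

end DonskerRate

end

/-! ### Identification of `mBeta` with the law of a Gaussian series. -/

noncomputable section

namespace DonskerRate

/-! ### Continuity in mean of the fractional integral -/

theorem integral_rlKernel_left {β s : ℝ} (hβ : 0 < β) (hs : s ∈ Set.Icc (0 : ℝ) 1) :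
    Integrable (fun t => rlKernel β t s) vol01 ∧ ∫ t, rlKernel β t s ∂vol01 ≤ 1 / β := by
  have h1 : IntervalIntegrable (fun t : ℝ => (t - s) ^ (β - 1)) volume s 1 := by
    have := (intervalIntegral.intervalIntegrable_rpow' (a := 0) (b := 1 - s) (r := β - 1)
      (by linarith)).comp_sub_right s
    simpa using this
  have h2 : IntegrableOn (fun t => rlKernel β t s) (Set.Ioc s 1) :=
    ((intervalIntegrable_iff_integrableOn_Ioc_of_le hs.2).1 h1).congr_fun
      (fun t ht => by simp [rlKernel, ht.1]) measurableSet_Ioc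
  have hz : ∀ t ∈ Set.Icc (0 : ℝ) 1 \ Set.Ioc s 1, rlKernel β t s = 0 := by
    intro t ht
    have : ¬ s < t := fun h => ht.2 ⟨h, ht.1.2⟩
    simp [rlKernel, this]
  refine ⟨h2.of_forall_sdiff_eq_zero measurableSet_Icc hz, ?_⟩
  have hsub : Set.Ioc s 1 ⊆ Set.Icc (0 : ℝ) 1 := fun t ht => ⟨hs.1.trans ht.1.le, ht.2⟩
  change ∫ t in Set.Icc (0 : ℝ) 1, rlKernel β t s ≤ _
  rw [setIntegral_eq_of_subset_of_forall_sdiff_eq_zero measurableSet_Icc hsub hz,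
    setIntegral_congr_fun (g := fun t => (t - s) ^ (β - 1)) measurableSet_Ioc
      (fun t ht => by simp [rlKernel, ht.1]),
    ← intervalIntegral.integral_of_le hs.2,
    intervalIntegral.integral_comp_sub_right (fun u : ℝ => u ^ (β - 1)) s,
    integral_rpow (Or.inl (by linarith))]
  simp only [sub_self, sub_add_cancel, Real.zero_rpow hβ.ne', sub_zero]
  gcongr
  exact Real.rpow_le_one (by linarith [hs.2]) (by linarith [hs.1]) hβ.le

theorem integrable_mul_rlKernel {β : ℝ} (hβ : 0 < β) (u : L2I) :
    Integrable (fun p : ℝ × ℝ => u p.2 * rlKernel β p.1 p.2) (vol01.prod vol01) ∧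
      ∫ t, ∫ s, ‖u s * rlKernel β t s‖ ∂vol01 ∂vol01 ≤ 1 / β * ∫ s, ‖u s‖ ∂vol01 := by
  have hu := L2I_integrable u
  have hm : AEStronglyMeasurable (fun p : ℝ × ℝ => u p.2 * rlKernel β p.1 p.2)
      (vol01.prod vol01) :=
    hu.aestronglyMeasurable.comp_snd.mul
      ((measurable_rlKernel β).comp measurable_swap).aestronglyMeasurable
  have hle : ∀ᵐ s ∂vol01, ∫ t, ‖u s * rlKernel β t s‖ ∂vol01 ≤ ‖u s‖ * (1 / β) := by
    filter_upwards [ae_restrict_mem measurableSet_Icc] with s hs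
    simp only [norm_mul, Real.norm_of_nonneg (rlKernel_nonneg _ _ _)]
    rw [integral_const_mul]
    gcongr
    exact (integral_rlKernel_left hβ hs).2
  have hi : Integrable (fun p : ℝ × ℝ => u p.2 * rlKernel β p.1 p.2) (vol01.prod vol01) := by
    refine (integrable_prod_iff' hm).2 ⟨?_, ?_⟩
    · filter_upwards [ae_restrict_mem measurableSet_Icc] with s hs
      exact (integral_rlKernel_left hβ hs).1.const_mul _
    · refine (hu.norm.mul_const (1 / β)).mono' hm.norm.prod_swap.integral_prod_right' ?_
      filter_upwards [hle] with s hs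
      rwa [Real.norm_of_nonneg (integral_nonneg fun t => norm_nonneg _)]
  refine ⟨hi, ?_⟩
  rw [integral_integral_swap (f := fun t s => ‖u s * rlKernel β t s‖) hi.norm, mul_comm,
    ← integral_mul_const]
  exact integral_mono_of_nonneg (ae_of_all _ fun s => integral_nonneg fun t => norm_nonneg _)
    (hu.norm.mul_const _) hle

theorem rlLeft_sub_ae {β : ℝ} (hβ : 0 < β) (u v : L2I) :
    rlLeft β (u - v : L2I) =ᵐ[vol01] rlLeft β u - rlLeft β v := by
  filter_upwards [(integrable_mul_rlKernel hβ u).1.prod_right_ae,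
    (integrable_mul_rlKernel hβ v).1.prod_right_ae, ae_restrict_mem measurableSet_Icc]
    with t h1 h2 ht
  rw [rlLeft_congr (Lp.coeFn_sub u v) ht, Pi.sub_apply, rlLeft_eq_integral_vol01 _ _ ht,
    rlLeft_eq_integral_vol01 _ _ ht, rlLeft_eq_integral_vol01 _ _ ht, ← mul_sub,
    ← integral_sub h1 h2]
  simp only [Pi.sub_apply, sub_mul]

theorem integral_norm_le_norm (u : L2I) : ∫ s, ‖u s‖ ∂vol01 ≤ ‖u‖ := by
  have h1 : (∫ s, ‖u s‖ ∂vol01) ^ 2 ≤ ‖u‖ ^ 2 := by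
    have hL : MemLp (fun s => ‖u s‖) 2 vol01 := (Lp.memLp u).norm
    have hv := variance_nonneg (fun s => ‖u s‖) vol01
    rw [variance_eq_sub hL] at hv
    simp only [Pi.pow_apply, Real.norm_eq_abs, sq_abs] at hv
    rw [norm_sq_eq_integral]
    simpa using hv
  exact le_of_sq_le_sq h1 (norm_nonneg _)

/-- Here the order β is below 1/2 in the application, out of reach of `rlOp` and of the pointwise
bound. An L¹ estimate is enough to extract almost everywhere convergent subsequences. -/
theorem eLpNorm_rlLeft_le {β : ℝ} (hβ : 0 < β) (u : L2I) :
    eLpNorm (rlLeft β u) 1 vol01 ≤ ENNReal.ofReal ((Real.Gamma β)⁻¹ * (1 / β) * ‖u‖) := by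
  have hG := Real.Gamma_pos_of_pos hβ
  obtain ⟨hi, hle⟩ := integrable_mul_rlKernel hβ u
  have hb : ∀ᵐ t ∂vol01, ‖rlLeft β u t‖
      ≤ (Real.Gamma β)⁻¹ * ∫ s, ‖u s * rlKernel β t s‖ ∂vol01 := by
    filter_upwards [ae_restrict_mem measurableSet_Icc] with t ht
    rw [rlLeft_eq_integral_vol01 _ _ ht, norm_mul, Real.norm_of_nonneg (inv_pos.2 hG).le]
    gcongr
    exact norm_integral_le_integral_norm _
  have hbi : Integrable (fun t => (Real.Gamma β)⁻¹ * ∫ s, ‖u s * rlKernel β t s‖ ∂vol01) vol01 :=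
    hi.norm.integral_prod_left.const_mul _
  have hr : Integrable (rlLeft β u) vol01 := hbi.mono' (aestronglyMeasurable_rlLeft β u) hb
  rw [eLpNorm_one_eq_lintegral_enorm, ← ofReal_integral_norm_eq_lintegral_enorm hr]
  refine ENNReal.ofReal_le_ofReal ((integral_mono_ae hr.norm hbi hb).trans ?_)
  rw [integral_const_mul, mul_assoc]
  gcongr
  exact hle.trans (by gcongr; exact integral_norm_le_norm u)

theorem exists_subseq_tendsto_rlLeft {β : ℝ} (hβ : 0 < β) {G : ℕ → L2I} {g : L2I}
    (h : Tendsto G atTop (𝓝 g)) : ∃ ns : ℕ → ℕ, StrictMono ns ∧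
      ∀ᵐ t ∂vol01, Tendsto (fun k => rlLeft β (G (ns k)) t) atTop (𝓝 (rlLeft β g t)) := by
  refine (tendstoInMeasure_of_tendsto_eLpNorm one_ne_zero
    (fun k => aestronglyMeasurable_rlLeft β (G k)) (aestronglyMeasurable_rlLeft β g)
    ?_).exists_seq_tendsto_ae
  have h1 : ∀ k, eLpNorm (rlLeft β (G k) - rlLeft β g) 1 vol01
      ≤ ENNReal.ofReal ((Real.Gamma β)⁻¹ * (1 / β) * ‖G k - g‖) := fun k => by
    rw [← eLpNorm_congr_ae (rlLeft_sub_ae hβ (G k) g)]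
    exact eLpNorm_rlLeft_le hβ _
  refine tendsto_of_tendsto_of_tendsto_of_le_of_le tendsto_const_nhds ?_ (fun _ => zero_le) h1
  have h2 : Tendsto (fun k => (Real.Gamma β)⁻¹ * (1 / β) * ‖G k - g‖) atTop (𝓝 0) := by
    have := ((tendsto_iff_norm_sub_tendsto_zero.1 h).const_mul ((Real.Gamma β)⁻¹ * (1 / β)))
    rwa [mul_zero] at this
  have := (ENNReal.continuous_ofReal.tendsto 0).comp h2
  rwa [ENNReal.ofReal_zero] at this

/-! ### Almost sure convergence of the Brownian series -/

/-- The partial sums form a martingale bounded in L², hence in L¹ by |M| ≤ 1 + M², so Doob's theorem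
applies. -/
theorem ae_exists_tendsto_gaussSeq {v : ℕ → ℝ} (hv : Summable fun n => v n ^ 2) :
    ∀ᵐ x ∂gaussSeq, ∃ c, Tendsto (fun N => ∑ n ∈ Finset.range N, x n * v n) atTop (𝓝 c) := by
  let f : ℕ → (ℕ → ℝ) → ℝ := fun n x => x n * v n
  have hfm : ∀ n, StronglyMeasurable (f n) := fun n =>
    ((measurable_pi_apply n).mul_const _).stronglyMeasurable
  have hfL : ∀ n, MemLp (f n) 2 gaussSeq := fun n => by
    simpa only [f, mul_comm] using (memLp_coord n).const_mul (v n)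
  have hfi : iIndepFun f gaussSeq :=
    iIndepFun_gaussSeq.comp (fun n y => y * v n) fun n => measurable_id.mul_const _
  let M : ℕ → (ℕ → ℝ) → ℝ := fun N x => ∑ n ∈ Finset.range (N + 1), f n x
  have hML : ∀ N, MemLp (M N) 2 gaussSeq := fun N => memLp_finsetSum _ fun n _ => hfL n
  have hMi : ∀ N, Integrable (M N) gaussSeq := fun N => (hML N).integrable (by norm_num)
  have hM : Martingale M (Filtration.natural f hfm) gaussSeq := by
    refine martingale_of_condExp_sub_eq_zero_nat (fun N => ?_) hMi fun N => ?_
    · refine Finset.stronglyMeasurable_fun_sum _ fun n hn => ?_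
      exact (Filtration.stronglyAdapted_natural hfm n).mono
        ((Filtration.natural f hfm).mono (Nat.lt_succ_iff.1 (Finset.mem_range.1 hn)))
    · have h1 : M (N + 1) - M N = f (N + 1) := by
        funext x
        simp only [M, Pi.sub_apply]
        rw [Finset.sum_range_succ _ (N + 1), add_sub_cancel_left]
      rw [h1]
      refine (hfi.condExp_natural_ae_eq_of_lt hfm (Nat.lt_succ_self N)).trans ?_
      refine ae_of_all _ fun x => ?_
      simp only [f, Pi.zero_apply]
      rw [integral_mul_const, integral_coord, zero_mul]
  have hsq : ∀ N, ∫ x, M N x ^ 2 ∂gaussSeq = ∑ n ∈ Finset.range (N + 1), v n ^ 2 := by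
    intro N
    have h1 : ∀ x, M N x ^ 2 = ∑ i ∈ Finset.range (N + 1), ∑ j ∈ Finset.range (N + 1),
        (x i * x j) * (v i * v j) := by
      intro x
      simp only [M, f]
      rw [sq, Finset.sum_mul_sum]
      exact Finset.sum_congr rfl fun i _ => Finset.sum_congr rfl fun j _ => by ring
    have hij : ∀ i j, Integrable (fun x : ℕ → ℝ => (x i * x j) * (v i * v j)) gaussSeq :=
      fun i j => ((memLp_coord i).integrable_mul (memLp_coord j)).mul_const _
    simp_rw [h1]
    rw [integral_finsetSum _ fun i _ => integrable_finsetSum _ fun j _ => hij i j]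
    refine Finset.sum_congr rfl fun i hi => ?_
    rw [integral_finsetSum _ fun j _ => hij i j, Finset.sum_eq_single_of_mem i hi]
    · rw [integral_mul_const, integral_coord_mul_coord, if_pos rfl, one_mul, sq]
    · intro j _ hji
      rw [integral_mul_const, integral_coord_mul_coord, if_neg hji.symm, zero_mul]
  have hbdd : ∀ N, eLpNorm (M N) 1 gaussSeq ≤ ((1 + ∑' n, v n ^ 2).toNNReal : ℝ≥0∞) := by
    intro N
    rw [eLpNorm_one_eq_lintegral_enorm, ← ofReal_integral_norm_eq_lintegral_enorm (hMi N)]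
    refine ENNReal.ofReal_le_ofReal ?_
    calc ∫ x, ‖M N x‖ ∂gaussSeq ≤ ∫ x, (1 + M N x ^ 2) ∂gaussSeq := by
          refine integral_mono (hMi N).norm ((integrable_const _).add (hML N).integrable_sq)
            fun x => ?_
          beta_reduce
          rw [Real.norm_eq_abs]
          nlinarith [sq_abs (M N x), sq_nonneg (|M N x| - 1), abs_nonneg (M N x)]
      _ = 1 + ∑ n ∈ Finset.range (N + 1), v n ^ 2 := by
          rw [integral_add (integrable_const _) (hML N).integrable_sq, hsq]
          simp
      _ ≤ 1 + ∑' n, v n ^ 2 := by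
          gcongr
          exact hv.sum_le_tsum _ fun n _ => sq_nonneg _
  filter_upwards [hM.submartingale.exists_ae_tendsto_of_bdd hbdd] with x hx
  obtain ⟨c, hc⟩ := hx
  exact ⟨c, (tendsto_add_atTop_iff_nat 1).1 hc⟩

/-- At fixed t the coefficients are those of the indicator of (0, t] in the basis, hence square
summable. Fubini exchanges the two almost everywhere quantifiers; measurable versions of the
functions make the convergence set measurable. -/
theorem ae_ae_exists_tendsto_brownianSeries (e : HilbertBasis ℕ ℝ L2I) :
    ∀ᵐ x ∂gaussSeq, ∀ᵐ t ∂vol01,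
      ∃ c, Tendsto (fun N => ∑ n ∈ Finset.range N, x n * rlLeft 1 (e n) t) atTop (𝓝 c) := by
  have hm : ∀ n, AEStronglyMeasurable (rlLeft 1 (e n)) vol01 := fun n =>
    aestronglyMeasurable_rlLeft 1 (e n)
  have hae : ∀ᵐ t ∂vol01, ∀ n, rlLeft 1 (e n) t = (hm n).mk _ t :=
    ae_all_iff.2 fun n => (hm n).ae_eq_mk
  have hset : MeasurableSet {p : (ℕ → ℝ) × ℝ | ∃ c,
      Tendsto (fun N => ∑ n ∈ Finset.range N, p.1 n * (hm n).mk _ p.2) atTop (𝓝 c)} := by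
    refine measurableSet_exists_tendsto fun N => Finset.measurable_sum _ fun n _ => ?_
    exact ((measurable_pi_apply n).comp measurable_fst).mul
      ((hm n).stronglyMeasurable_mk.measurable.comp measurable_snd)
  have h1 : ∀ᵐ t ∂vol01, ∀ᵐ x ∂gaussSeq, ∃ c,
      Tendsto (fun N => ∑ n ∈ Finset.range N, x n * (hm n).mk _ t) atTop (𝓝 c) := by
    filter_upwards [hae, ae_restrict_mem measurableSet_Icc] with t ht ht1
    simp only [← ht]
    refine ae_exists_tendsto_gaussSeq (v := fun n => rlLeft 1 (e n) t) ?_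
    simp_rw [rlLeft_one_eq_inner ht1, real_inner_comm (e _)]
    exact (hasSum_inner_sq e _).summable
  filter_upwards [(Measure.ae_ae_comm (p := fun (x : ℕ → ℝ) t => ∃ c,
    Tendsto (fun N => ∑ n ∈ Finset.range N, x n * (hm n).mk _ t) atTop (𝓝 c)) hset).2 h1] with x hx
  filter_upwards [hx, hae] with t ht ht1
  simpa only [ht1] using ht

/-! ### The Wiener measure is the law of a Gaussian series -/

theorem hasSum_norm_repr_rlOp_sq {α : ℝ} (hα : 1 / 2 < α) (e : HilbertBasis ℕ ℝ L2I) :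
    HasSum (fun n => ‖e.repr (rlOp α hα (e n))‖ ^ 2)
      (1 / ((2 * α - 1) * (2 * α) * Real.Gamma α ^ 2)) := by
  simp_rw [LinearIsometryEquiv.norm_map]
  exact hasSum_norm_rlOp_sq hα e

/-- The partial sums of the Brownian series are I^β applied to the partial sums of ∑ x_n I^(1-β)
e_n. Along a common subsequence the former converge at almost every t to `brownianSeries`, the
latter in L² to g, so the Brownian path is I^β g. -/
theorem mBeta_eq_gaussLaw {β : ℝ} (hβ0 : 0 < β) (hα : 1 / 2 < 1 - β) (e : HilbertBasis ℕ ℝ L2I) :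
    mBeta e β = gaussLaw fun n => e.repr (rlOp (1 - β) hα (e n)) := by
  set a : ℕ → EllTwo := fun n => e.repr (rlOp (1 - β) hα (e n)) with ha
  obtain ⟨ns, hns, hT⟩ := exists_subseq_tendsto_gaussSeries (hasSum_norm_repr_rlOp_sq hα e).summable
  refine Measure.map_congr ?_
  filter_upwards [hT, ae_ae_exists_tendsto_brownianSeries e] with x hx hB
  set g : L2I := e.repr.symm (gaussSeries a x) with hg
  let u : ℕ → L2I := fun N => ∑ n ∈ Finset.range N, x n • e n
  have hu : ∀ N, e.repr.symm (sumVec a N fun i => x i) = rlOp (1 - β) hα (u N) := by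
    intro N
    rw [LinearIsometryEquiv.symm_apply_eq, sumVec, Fin.sum_univ_eq_sum_range (fun i => x i • a i)]
    simp only [u, map_sum, map_smul, ha]
  have hG : Tendsto (fun k => rlOp (1 - β) hα (u (ns k))) atTop (𝓝 g) := by
    simp_rw [← hu]
    exact (e.repr.symm.continuous.tendsto _).comp hx
  have hrl : ∀ N, ∀ t ∈ Set.Icc (0 : ℝ) 1, rlLeft β (rlOp (1 - β) hα (u N)) t
      = ∑ n ∈ Finset.range N, x n * rlLeft 1 (e n) t := by
    intro N t ht
    rw [rlLeft_congr (rlOp_coeFn hα (u N)) ht,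
      rlLeft_rlLeft hβ0 (by linarith) (by ring) (L2I_integrable (u N)) ht, rlLeft_one_eq_inner ht]
    simp only [u, inner_sum, inner_smul_right, rlLeft_one_eq_inner ht]
  obtain ⟨ms, hms, hlim⟩ := exists_subseq_tendsto_rlLeft hβ0 hG
  rw [frakJ_eq hβ0 (by linarith) e (f := g), hg, LinearIsometryEquiv.apply_symm_apply]
  filter_upwards [hlim, hB, ae_restrict_mem measurableSet_Icc] with t h1 h2 ht
  obtain ⟨c, hc⟩ := h2
  simp only [hrl _ t ht] at h1
  rw [brownianSeries, hc.limUnder_eq]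
  exact tendsto_nhds_unique (hc.comp (hns.comp hms).tendsto_atTop) h1

end DonskerRate

end

/-! ### Assembly of the theorem. -/

noncomputable section

namespace DonskerRate

/-! ### The laws of the interpolated random walks -/

theorem nuSharp_eq {β : ℝ} (hβ0 : 0 < β) (hβ : β < 1 / 2) (hα : 1 / 2 < 1 - β)
    (e : HilbertBasis ℕ ℝ L2I) {Ω : Type*} [MeasurableSpace Ω] {P : Measure Ω}
    [IsProbabilityMeasure P] {X : ℕ → Ω → ℝ} (hXm : ∀ n, Measurable (X n)) (hXi : iIndepFun X P)
    (hX : ∀ n, P {w | X n w = 1} = 1 / 2 ∧ P {w | X n w = -1} = 1 / 2) {m : ℕ} (hm : 0 < m) :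
    nuSharp P X e β m = (Measure.pi fun _ : Fin m => rad).map
      (sumVec (fun j => e.repr (rlOp (1 - β) hα (stepUnit m j))) m) := by
  rw [← map_pi_eq_rad hXm hXi hX m, Measure.map_map (measurable_sumVec _ m)
    (measurable_pi_lambda _ fun i => hXm i), nuSharp]
  congr 1
  funext w
  rw [frakJ_interpWalk hβ0 hβ e hm, Function.comp_apply, sumVec]
  simp_rw [hSharp_eq e hα]

theorem HSharp_eq {β : ℝ} (hα : 1 / 2 < 1 - β) (e : HilbertBasis ℕ ℝ L2I) (m : ℕ) :
    HSharp e β m = tensorOp (fun j => e.repr (rlOp (1 - β) hα (stepUnit m j))) m := by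
  rw [HSharp, tensorOp]
  simp_rw [hSharp_eq e hα]

theorem sum_norm_hSharp_cube_le {β : ℝ} (hβ0 : 0 < β) (hα : 1 / 2 < 1 - β)
    (e : HilbertBasis ℕ ℝ L2I) {m : ℕ} (hm : 1 ≤ m) :
    ∑ j : Fin m, ‖e.repr (rlOp (1 - β) hα (stepUnit m j))‖ ^ 3 ≤ 2 := by
  simp_rw [LinearIsometryEquiv.norm_map]
  rw [Fin.sum_univ_eq_sum_range fun j => ‖rlOp (1 - β) hα (stepUnit m j)‖ ^ 3]
  exact sum_norm_rlOp_stepUnit_cube_le hα (by linarith) hm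

theorem exists_abs_integral_nuSharp_sub_mBeta_le {β : ℝ} (hβ0 : 0 < β) (hβ : β < 1 / 2)
    (e : HilbertBasis ℕ ℝ L2I) {Ω : Type*} [MeasurableSpace Ω] {P : Measure Ω}
    [IsProbabilityMeasure P] {X : ℕ → Ω → ℝ} (hXm : ∀ n, Measurable (X n)) (hXi : iIndepFun X P)
    (hX : ∀ n, P {w | X n w = 1} = 1 / 2 ∧ P {w | X n w = -1} = 1 / 2) :
    ∃ C : ℝ, ∀ m : ℕ, 1 ≤ m → ∀ F, IsTest F →
      Integrable F (nuSharp P X e β m) ∧ Integrable F (mBeta e β) ∧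
      |∫ x, F x ∂nuSharp P X e β m - ∫ x, F x ∂mBeta e β|
        ≤ C * ((m : ℝ) ^ (β - 1) + (m : ℝ) ^ (-1 : ℝ))
          + (m : ℝ) ^ (2 * β - 1) / (2 * (1 - 2 * β) * Real.Gamma (1 - β) ^ 2) := by
  have hα : 1 / 2 < 1 - β := by linarith
  obtain ⟨C, hC⟩ := exists_abs_integral_rad_sub_stdG_le hα (by linarith) e
  refine ⟨C, fun m hm F hF => ?_⟩
  set h : ℕ → EllTwo := fun j => e.repr (rlOp (1 - β) hα (stepUnit m j)) with hh
  have hFc := continuous_of_abs_sub_le hF.abs_sub_le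
  have hmeas := (measurable_sumVec h m).aemeasurable (μ := Measure.pi fun _ : Fin m => rad)
  have hS := hasSum_norm_repr_rlOp_sq hα e
  rw [nuSharp_eq hβ0 hβ hα e hXm hXi hX hm, mBeta_eq_gaussLaw hβ0 hα e]
  refine ⟨(integrable_map_measure hFc.aestronglyMeasurable hmeas).2
    (integrable_pi_rad (hFc.comp (continuous_sumVec h m))),
    hF.integrable (integrable_norm_of_sq (integral_norm_sq_gaussLaw_le hS.summable).1), ?_⟩
  rw [integral_map hmeas hFc.aestronglyMeasurable]
  have h1 := hC m hm F hF
  have h2 := abs_integral_sumVec_sub_gaussLaw_le e (f := stepUnit m) (m := m)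
    (fun i _ j hj => inner_stepUnit hj)
    ((e.repr.toContinuousLinearEquiv : L2I →L[ℝ] EllTwo) ∘L rlOp (1 - β) hα) hS hF
  have h3 := hilbertSchmidt_sub_le hα (by linarith) (show 0 < m from hm)
  have h4 : ∀ v, ((e.repr.toContinuousLinearEquiv : L2I →L[ℝ] EllTwo) ∘L rlOp (1 - β) hα) v
      = e.repr (rlOp (1 - β) hα v) := fun v => rfl
  simp only [h4] at h2
  simp only [LinearIsometryEquiv.norm_map] at h2
  have h5 : (m : ℝ) ^ (1 - 2 * (1 - β)) / ((2 * (1 - β) - 1) * Real.Gamma (1 - β) ^ 2) / 2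
      = (m : ℝ) ^ (2 * β - 1) / (2 * (1 - 2 * β) * Real.Gamma (1 - β) ^ 2) := by
    rw [div_div, show 1 - 2 * (1 - β) = 2 * β - 1 by ring]
    congr 1; ring
  rw [← h5]
  rw [show -(1 - β) = β - 1 by ring] at h1
  refine (abs_sub_le _ _ _).trans (add_le_add h1 (h2.trans ?_))
  linarith

/-- Relative to m^(2β-1) the two error terms are m^(-β) and m^(-2β), both tending to zero. -/
theorem exists_forall_error_le {β : ℝ} (hβ0 : 0 < β) (C : ℝ) {K : ℝ} (hK : 0 < K) :
    ∃ m₀ : ℕ, 1 ≤ m₀ ∧ ∀ m : ℕ, m₀ ≤ m →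
      C * ((m : ℝ) ^ (β - 1) + (m : ℝ) ^ (-1 : ℝ)) ≤ K * (m : ℝ) ^ (2 * β - 1) := by
  have h1 : ∀ y : ℝ, 0 < y → Tendsto (fun m : ℕ => (m : ℝ) ^ (-y)) atTop (𝓝 0) := fun y hy =>
    (tendsto_rpow_neg_atTop hy).comp tendsto_natCast_atTop_atTop
  have h2 : Tendsto (fun m : ℕ => C * ((m : ℝ) ^ (-β) + (m : ℝ) ^ (-(2 * β)))) atTop (𝓝 0) := by
    have := ((h1 β hβ0).add (h1 (2 * β) (by linarith))).const_mul C
    simpa using this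
  obtain ⟨N, hN⟩ := eventually_atTop.1 (h2.eventually (gt_mem_nhds hK))
  refine ⟨max N 1, le_max_right _ _, fun m hm => ?_⟩
  have hm0 : (0 : ℝ) < m := by
    have : 1 ≤ m := (le_max_right _ _).trans hm
    exact_mod_cast this
  have h3 := hN m ((le_max_left _ _).trans hm)
  have e1 : (m : ℝ) ^ (β - 1) = (m : ℝ) ^ (-β) * (m : ℝ) ^ (2 * β - 1) := by
    rw [← Real.rpow_add hm0]; congr 1; ring
  have e2 : (m : ℝ) ^ (-1 : ℝ) = (m : ℝ) ^ (-(2 * β)) * (m : ℝ) ^ (2 * β - 1) := by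
    rw [← Real.rpow_add hm0]; congr 1; ring
  rw [e1, e2, ← add_mul, ← mul_assoc]
  gcongr

end DonskerRate

end

theorem mainTheorem3 (β : ℝ) (hβ0 : 0 < β) (hβ : β < 1 / 2)
    (e : HilbertBasis ℕ ℝ DonskerRate.L2I)
    {Ω : Type*} [MeasurableSpace Ω] (P : Measure Ω) [IsProbabilityMeasure P]
    (X : ℕ → Ω → ℝ) (hXm : ∀ n, Measurable (X n)) (hXi : iIndepFun X P)
    (hX : ∀ n, P {w | X n w = 1} = 1 / 2 ∧ P {w | X n w = -1} = 1 / 2) :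
    (∀ m : ℕ, 1 ≤ m →
      DonskerRate.Hyp (DonskerRate.HSharp e β m) 1 (DonskerRate.nuSharp P X e β m) ∧
      DonskerRate.Hyp (DonskerRate.HSharp e β m)
        (∑ j : Fin m, ‖DonskerRate.hSharp e β m j‖ ^ 3) (DonskerRate.nuSharp P X e β m)) ∧
    ∀ ε : ℝ, 0 < ε → ∃ m₀ : ℕ, ∀ m : ℕ, m₀ ≤ m →
      DonskerRate.rho 3 (DonskerRate.nuSharp P X e β m) (DonskerRate.mBeta e β) ≤
        ENNReal.ofReal ((1 + ε) *
          ((m : ℝ) ^ (2 * β - 1) / (2 * (1 - 2 * β) * Real.Gamma (1 - β) ^ 2))) := by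

  have hα : 1 / 2 < 1 - β := by linarith
  refine ⟨fun m hm => ?_, fun ε hε => ?_⟩
  · rw [DonskerRate.nuSharp_eq hβ0 hβ hα e hXm hXi hX hm, DonskerRate.HSharp_eq hα e m]
    simp_rw [DonskerRate.hSharp_eq e hα]
    have h2 := DonskerRate.sum_norm_hSharp_cube_le hβ0 hα e hm
    -- The constant obtained is half the sum of cubes: at most 1 because the sum is at most 2, and
    -- at most the sum itself.
    refine ⟨DonskerRate.hyp_map_sumVec _ m (by linarith), DonskerRate.hyp_map_sumVec _ m ?_⟩
    exact half_le_self (Finset.sum_nonneg fun j _ => by positivity)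
  · obtain ⟨C, hC⟩ :=
      DonskerRate.exists_abs_integral_nuSharp_sub_mBeta_le hβ0 hβ e hXm hXi hX
    have hG : 0 < Real.Gamma (1 - β) := Real.Gamma_pos_of_pos (by linarith)
    -- The coefficient is ε times that of the main term, so the lower order error fits into the ε
    -- share of the bound.
    have hK : 0 < ε / (2 * (1 - 2 * β) * Real.Gamma (1 - β) ^ 2) := by
      have : 0 < 1 - 2 * β := by linarith
      positivity
    obtain ⟨m₀, hm₀, hm₀'⟩ := DonskerRate.exists_forall_error_le hβ0 C hK
    refine ⟨m₀, fun m hm => ?_⟩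
    refine iSup_le fun F => iSup₂_le fun hF hF1 => ?_
    obtain ⟨h1, h2, h3⟩ := hC m (hm₀.trans hm) F (hF.isTest hF1)
    rw [if_pos ⟨h1, h2⟩]
    refine ENNReal.ofReal_le_ofReal ((le_abs_self _).trans (h3.trans ?_))
    have h4 := hm₀' m hm
    rw [div_mul_eq_mul_div, mul_div_assoc] at h4
    linarith
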